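/- Let $a,b:\mathbb R\to\mathbb R$ be smooth functions that, together with all their derivatives, decay faster than every power, i.e. $|a^{(k)}(y)|+|b^{(k)}(y)|\le C_{k,N}(1+|y|)^{-N}$ for all $k,N\ge 0$ (Schwartz functions). For real $\beta$ put $$v_0(t,x)=t^{-1/2}e^{ix^2/4t}\,a(x/t)\,e^{i\phi(t,x/t)},\qquad \phi(t,y)=-\beta\,a(y)^2\ln t+b(y),\qquad t>0.$$ Then there is $\beta_0>0$, depending only on $a$ and $b$, such that for all real $\beta,\gamma$ with $\beta\ge 0$ or $|\beta|\le\beta_0$ there are $T>0$, a constant $C$, and a function $v:(T,\infty)\times\mathbb R\to\mathbb C$, smooth in $(t,x)$, which solves $$i\,\partial_t v+\partial_x^2 v-\beta|v|^2v-\gamma|v|^4v=0\qquad\text{on }(T,\infty)\times\mathbb R$$ and satisfies $$\|(v-v_0)(t,\cdot)\|_{L^\infty(\mathbb R)}+\|(v-v_0)(t,\cdot)\|_{L^2(\mathbb R)}\le C\,\bigl(1+\ln(1+t)\bigr)^2(1+t)^{-1}\qquad\text{for all }t>T.$$ -/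

import Mathlib

open scoped ContDiff SchwartzMap ENNReal

noncomputable section

namespace NLSScattering

/-- The phase `φ(s, y) = -β a(y)² ln |s| + b(y)`. -/
def phase (β : ℝ) (a b : ℝ → ℝ) (s y : ℝ) : ℝ :=
  -β * a y ^ 2 * Real.log |s| + b y

/-- The asymptotic amplitude `V₀(s, y) = a(y) exp(i φ(s, y))`. -/
def amplitude (β : ℝ) (a b : ℝ → ℝ) (s y : ℝ) : ℂ :=
  (a y : ℂ) * Complex.exp (Complex.I * (phase β a b s y : ℂ))

/-- The asymptotic profile `v₀(t, x) = t^(-1/2) exp(i x² / (4 t)) V₀(t, x / t)`, for `t > 0`. -/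
def profile (β : ℝ) (a b : ℝ → ℝ) (t x : ℝ) : ℂ :=
  ((t ^ (-(1 / 2) : ℝ) : ℝ) : ℂ) * Complex.exp (Complex.I * ((x ^ 2 / (4 * t) : ℝ) : ℂ)) *
    amplitude β a b t (x / t)

/-- `v` is smooth, jointly in `(t, x)`, on `(T, ∞) × ℝ` and solves there
`i ∂ₜ v + ∂ₓ² v - β |v|² v - γ |v|⁴ v = 0`. -/
def IsSmoothSolution (β γ T : ℝ) (v : ℝ → ℝ → ℂ) : Prop :=
  ContDiffOn ℝ ∞ (fun p : ℝ × ℝ => v p.1 p.2) (Set.Ioi T ×ˢ Set.univ) ∧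
  ∀ t : ℝ, T < t → ∀ x : ℝ,
    Complex.I * deriv (fun τ : ℝ => v τ x) t + iteratedDeriv 2 (fun z : ℝ => v t z) x
      - (β : ℂ) * ((‖v t x‖ ^ 2 : ℝ) : ℂ) * v t x
      - (γ : ℂ) * ((‖v t x‖ ^ 4 : ℝ) : ℂ) * v t x = 0

end NLSScattering

end

/-! Write v = t^(-1/2) e^{ix²/4t} e^{iφ} u(t, y) with y = x/t. The logarithm in φ cancels the part β
a²/t of β|v|² that is not integrable in time, and u must solve i t∂ₜu = β(|u|² - a²)u up to terms
carrying a factor t⁻¹ and at most two logarithms (`residual`). Starting from u = a, Newton steps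
improve the residual by one power of t⁻¹(ln t)² each. The linearisation i t∂ₜδ - βa²(δ + δ̄) = -ρ is
triangular in the real and imaginary parts of δ, so it only asks for primitives against dt/t of
t^(-j)(ln t)^m with j ≥ 1, and these stay in the same class (`exists_jet_linearized`,
`exists_jet_residual_mem`). The result is A with A - v₀ = O(t⁻¹(1 + ln t)²) that solves the equation
up to any prescribed power of t⁻¹.

The solution is v = A + w, where w solves the Duhamel equation from t = ∞ with ‖w‖ ≤ t^(-M).
Multiplication by A has size t^(-1/2), so the difference of nonlinearities is Lipschitz in w with
constant κ/t. Since ∫_t^∞ κ r^(-1-M) dr = (κ/M) t^(-M), the Duhamel map contracts as soon as M ≥ 2κ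
(`exists_decaying_solution`). The size and sign of β enter only through M, that is, through the
number of Newton steps.

For smoothness with a single T, all x-derivatives are put into one norm, a weighted sum whose
weights are submultiplicative against binomial coefficients and decay as fast as needed. The closure
of the Schwartz functions in it is complete and closed under products, and the free group acts
isometrically. The constants entering κ do not depend on the weights (`exists_isModulatedCurve`), so
M and the number of Newton steps are fixed before the weights. Time derivatives are recovered from
the equation, each at the price of two x-derivatives (`spatiallySmooth_of_hasDerivAt`). -/

noncomputable section

namespace NLSScattering

open MeasureTheory Set Filter Topology
open scoped NNReal FourierTransform LineDeriv BoundedContinuousFunction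

/-! ### Weights on derivatives and weighted Sobolev norms -/

/-- Positive weights on the orders of differentiation for which the weighted sum of all
derivatives is submultiplicative. -/
structure DerivWeight where
  toFun : ℕ → ℝ≥0
  pos : ∀ j, 0 < toFun j
  zero_eq_one : toFun 0 = 1
  choose_mul_le : ∀ i j, ((i + j).choose i : ℝ≥0) * toFun (i + j) ≤ toFun i * toFun j

instance : CoeFun DerivWeight (fun _ => ℕ → ℝ≥0) := ⟨DerivWeight.toFun⟩

/-- Weights may decay as fast as desired. -/
theorem DerivWeight.exists_mul_le (B : ℕ → ℝ≥0) :
    ∃ c : DerivWeight, ∀ j, j ≠ 0 → c j * B j ≤ (1 / 2) ^ j := by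
  -- Partial sums make `m` monotone, which makes the product `q` supermultiplicative; the factor 2^k
  -- leaves the geometric decay.
  set m : ℕ → ℝ≥0 := fun l => 1 + ∑ k ∈ Finset.range (l + 1), 2 ^ k * B k with hm
  have hm1 : ∀ l, 1 ≤ m l := fun l => by simp [hm]
  have hmono : Monotone m := by
    intro k l hkl
    simp only [hm]
    gcongr
  set q : ℕ → ℝ≥0 := fun j => ∏ l ∈ Finset.range j, m (l + 1) with hq
  have hq1 : ∀ j, 1 ≤ q j := fun j => Finset.one_le_prod'' (fun l => hm1 _)
  have hq0 : ∀ j, q j ≠ 0 := fun j => (lt_of_lt_of_le one_pos (hq1 j)).ne'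
  have hqmul : ∀ i j, q i * q j ≤ q (i + j) := by
    intro i j
    simp only [hq]
    rw [Finset.prod_range_add]
    gcongr with l hl
    exact hmono (by omega)
  have hqB : ∀ j, j ≠ 0 → 2 ^ j * B j ≤ q j := by
    intro j hj
    obtain ⟨i, rfl⟩ := Nat.exists_eq_succ_of_ne_zero hj
    calc 2 ^ (i + 1) * B (i + 1) ≤ m (i + 1) := by
          refine le_trans ?_ (le_add_of_nonneg_left zero_le_one)
          exact Finset.single_le_sum (f := fun k => 2 ^ k * B k) (fun _ _ => zero_le)
            (Finset.mem_range.2 (Nat.lt_succ_self _))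
      _ ≤ q i * m (i + 1) := le_mul_of_one_le_left zero_le (hq1 i)
      _ = q (i + 1) := by simp [hq, Finset.prod_range_succ]
  -- The factorials absorb the binomial coefficient exactly; supermultiplicativity of `q` does the
  -- rest.
  refine ⟨⟨fun j => (j.factorial * q j)⁻¹, fun j => ?_, by simp [hq], fun i j => ?_⟩, ?_⟩
  · have := hq0 j
    positivity
  · have h1 : ((i + j).choose i : ℝ≥0) * (((i + j).factorial : ℝ≥0) * q (i + j))⁻¹
        = ((i.factorial : ℝ≥0) * j.factorial * q (i + j))⁻¹ := by
      have := hq0 (i + j)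
      have h2 := Nat.choose_mul_factorial_mul_factorial (Nat.le_add_right i j)
      have h3 : (((i + j).choose i : ℝ≥0)) * i.factorial * j.factorial = (i + j).factorial := by
        rw [Nat.add_sub_cancel_left] at h2
        exact_mod_cast h2
      have h4 : ((i + j).choose i : ℝ≥0) ≠ 0 := by
        exact_mod_cast (Nat.choose_pos (by omega)).ne'
      rw [← h3]
      field_simp
    rw [h1, ← mul_inv]
    apply inv_anti₀
    · have := hq0 i
      have := hq0 j
      positivity
    · calc (i.factorial * q i) * (j.factorial * q j)
          = i.factorial * j.factorial * (q i * q j) := by ring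
        _ ≤ _ := by gcongr; exact hqmul i j
  · intro j hj
    have h1 := hqB j hj
    have h2 : (1 : ℝ≥0) ≤ j.factorial := by exact_mod_cast Nat.succ_le_of_lt j.factorial_pos
    have h3 := hq0 j
    have h4 : B j ≤ (1 / 2) ^ j * q j := by
      calc B j = (1 / 2) ^ j * (2 ^ j * B j) := by
            rw [← mul_assoc, ← mul_pow]; norm_num
        _ ≤ _ := by gcongr
    show ((j.factorial : ℝ≥0) * q j)⁻¹ * B j ≤ (1 / 2) ^ j
    calc ((j.factorial : ℝ≥0) * q j)⁻¹ * B j ≤ (1 * q j)⁻¹ * ((1 / 2) ^ j * q j) := by gcongr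
      _ = (1 / 2) ^ j := by field_simp

/-- The Sobolev-type norm `‖f‖_{L^p} + ‖f'‖_{L^p}`. -/
def baseNorm (p : ℝ≥0∞) (f : ℝ → ℂ) : ℝ≥0∞ := eLpNorm f p + eLpNorm (deriv f) p

/-- Weighted sum of the `W^{1,p}` norms of all derivatives. -/
def wnorm (p : ℝ≥0∞) (c : DerivWeight) (f : ℝ → ℂ) : ℝ≥0∞ :=
  ∑' j, (c j : ℝ≥0∞) * baseNorm p (iteratedDeriv j f)

theorem ENNReal_tsum_mul_tsum (u v : ℕ → ℝ≥0∞) :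
    ∑' n, ∑ q ∈ Finset.HasAntidiagonal.antidiagonal n, u q.1 * v q.2 = (∑' n, u n) * ∑' n, v n := by
  rw [← ENNReal.tsum_mul_right]
  simp_rw [← ENNReal.tsum_mul_left]
  rw [← ENNReal.tsum_prod, ← (Finset.HasAntidiagonal.sigmaAntidiagonalEquivProd (A := ℕ)).tsum_eq,
    ENNReal.tsum_sigma']
  refine tsum_congr fun n => ?_
  rw [tsum_fintype]
  exact (Finset.sum_coe_sort (Finset.HasAntidiagonal.antidiagonal n) (fun q => u q.1 * v q.2)).symm

theorem _root_.ContDiff.iteratedDeriv_infty {f : ℝ → ℂ} (hf : ContDiff ℝ ∞ f) (j : ℕ) :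
    ContDiff ℝ ∞ (iteratedDeriv j f) := by
  rw [iteratedDeriv_eq_iterate]
  exact hf.iterate_deriv j

/-- Leibniz: `choose_mul_le` absorbs the binomials, and what remains is a Cauchy product. The
functionals are abstract so that one argument gives both the L²–L² and the L^∞–L² product bounds. -/
theorem tsum_weight_iteratedDeriv_mul_le (c : DerivWeight) {N N₁ N₂ : (ℝ → ℂ) → ℝ≥0∞} {K : ℝ≥0∞}
    (hadd : ∀ f g, ContDiff ℝ ∞ f → ContDiff ℝ ∞ g → N (f + g) ≤ N f + N g)
    (hzero : N 0 = 0)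
    (hsmul : ∀ (k : ℕ) f, ContDiff ℝ ∞ f → N (fun x => (k : ℂ) * f x) ≤ k * N f)
    (hmul : ∀ f g, ContDiff ℝ ∞ f → ContDiff ℝ ∞ g → N (f * g) ≤ K * (N₁ f * N₂ g))
    {f g : ℝ → ℂ} (hf : ContDiff ℝ ∞ f) (hg : ContDiff ℝ ∞ g) :
    ∑' j, (c j : ℝ≥0∞) * N (iteratedDeriv j (f * g)) ≤
      K * ((∑' j, (c j : ℝ≥0∞) * N₁ (iteratedDeriv j f)) *
        ∑' j, (c j : ℝ≥0∞) * N₂ (iteratedDeriv j g)) := by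
  rw [← ENNReal_tsum_mul_tsum, ← ENNReal.tsum_mul_left]
  refine ENNReal.tsum_le_tsum fun j => ?_
  have hsum : ∀ (s : Finset (ℕ × ℕ)) (F : ℕ × ℕ → ℝ → ℂ), (∀ q, ContDiff ℝ ∞ (F q)) →
      N (∑ q ∈ s, F q) ≤ ∑ q ∈ s, N (F q) := by
    intro s F hF
    induction s using Finset.induction_on with
    | empty => simp [hzero]
    | insert q s hq ih =>
      rw [Finset.sum_insert hq, Finset.sum_insert hq]
      refine (hadd _ _ (hF q) ?_).trans (by gcongr)
      have : (∑ q ∈ s, F q) = fun x => ∑ q ∈ s, F q x := by ext; simp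
      rw [this]
      exact ContDiff.sum fun q _ => hF q
  have hL : iteratedDeriv j (f * g) = ∑ q ∈ Finset.HasAntidiagonal.antidiagonal j,
      (fun x => (j.choose q.1 : ℂ) * (iteratedDeriv q.1 f * iteratedDeriv q.2 g) x) := by
    ext x
    rw [iteratedDeriv_mul (hf.contDiffAt.of_le (by exact_mod_cast le_top))
      (hg.contDiffAt.of_le (by exact_mod_cast le_top)), Finset.sum_apply,
      Finset.Nat.sum_antidiagonal_eq_sum_range_succ_mk]
    simp [mul_assoc]
  rw [hL]
  have hcd : ∀ q : ℕ × ℕ, ContDiff ℝ ∞ (iteratedDeriv q.1 f * iteratedDeriv q.2 g) := fun q =>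
    (hf.iteratedDeriv_infty q.1).mul (hg.iteratedDeriv_infty q.2)
  refine (mul_le_mul_right (hsum _ _ fun q => contDiff_const.mul (hcd q)) _).trans ?_
  rw [Finset.mul_sum, Finset.mul_sum]
  refine Finset.sum_le_sum fun q hq => ?_
  have hq' : q.1 + q.2 = j := Finset.HasAntidiagonal.mem_antidiagonal.1 hq
  calc (c j : ℝ≥0∞) * N (fun x => (j.choose q.1 : ℂ) * (iteratedDeriv q.1 f * iteratedDeriv q.2 g) x)
      ≤ (c j : ℝ≥0∞) * (j.choose q.1 * (K * (N₁ (iteratedDeriv q.1 f) *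
          N₂ (iteratedDeriv q.2 g)))) := by
        gcongr
        refine (hsmul _ _ (hcd q)).trans ?_
        gcongr
        exact hmul _ _ (hf.iteratedDeriv_infty _) (hg.iteratedDeriv_infty _)
    _ = (j.choose q.1 * c j : ℝ≥0∞) * (K * (N₁ (iteratedDeriv q.1 f) *
          N₂ (iteratedDeriv q.2 g))) := by ring
    _ ≤ (c q.1 * c q.2 : ℝ≥0∞) * (K * (N₁ (iteratedDeriv q.1 f) *
          N₂ (iteratedDeriv q.2 g))) := by
        refine mul_le_mul' ?_ le_rfl
        have := c.choose_mul_le q.1 q.2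
        rw [hq'] at this
        exact_mod_cast this
    _ = _ := by ring

theorem baseNorm_add_le {p : ℝ≥0∞} (hp : 1 ≤ p) {f g : ℝ → ℂ} (hf : ContDiff ℝ ∞ f)
    (hg : ContDiff ℝ ∞ g) : baseNorm p (f + g) ≤ baseNorm p f + baseNorm p g := by
  have hf' := (hf.iteratedDeriv_infty 1).continuous
  have hg' := (hg.iteratedDeriv_infty 1).continuous
  rw [iteratedDeriv_one] at hf' hg'
  have hd : deriv (f + g) = deriv f + deriv g := by
    ext x
    exact deriv_add (hf.differentiable (by simp) x) (hg.differentiable (by simp) x)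
  unfold baseNorm
  rw [hd]
  calc _ ≤ (eLpNorm f p + eLpNorm g p) + (eLpNorm (deriv f) p + eLpNorm (deriv g) p) := by
        gcongr
        · exact eLpNorm_add_le hf.continuous.aestronglyMeasurable
            hg.continuous.aestronglyMeasurable hp
        · exact eLpNorm_add_le hf'.aestronglyMeasurable hg'.aestronglyMeasurable hp
    _ = _ := by ring

theorem baseNorm_const_mul (p : ℝ≥0∞) (k : ℂ) (f : ℝ → ℂ) :
    baseNorm p (fun x => k * f x) = ‖k‖ₑ * baseNorm p f := by
  unfold baseNorm
  have h : deriv (fun x => k * f x) = k • deriv f := by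
    ext x
    simp [deriv_const_mul_field]
  have h' : (fun x => k * f x) = k • f := rfl
  rw [h, h', eLpNorm_const_smul, eLpNorm_const_smul, mul_add]

theorem enorm_natCast_complex (k : ℕ) : ‖(k : ℂ)‖ₑ = k := by
  rw [← ofReal_norm, Complex.norm_natCast, ENNReal.ofReal_natCast]

theorem baseNorm_zero (p : ℝ≥0∞) : baseNorm p 0 = 0 := by
  simp [baseNorm]

theorem eLpNorm_mul_le_top_mul (p : ℝ≥0∞) {f g : ℝ → ℂ} (hg : Continuous g) :
    eLpNorm (f * g) p ≤ eLpNorm f ∞ * eLpNorm g p :=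
  eLpNorm_smul_le_eLpNorm_top_mul_eLpNorm p hg.aestronglyMeasurable f

theorem baseNorm_mul_le_aux (p : ℝ≥0∞) (hp : 1 ≤ p) {f g : ℝ → ℂ} (hf : ContDiff ℝ ∞ f)
    (hg : ContDiff ℝ ∞ g) :
    baseNorm p (f * g) ≤ eLpNorm f ∞ * eLpNorm g p +
      (eLpNorm (deriv f * g) p + eLpNorm f ∞ * eLpNorm (deriv g) p) := by
  have hf' := (hf.iteratedDeriv_infty 1).continuous
  have hg' := (hg.iteratedDeriv_infty 1).continuous
  rw [iteratedDeriv_one] at hf' hg'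
  have hd : deriv (f * g) = deriv f * g + f * deriv g := by
    ext x
    exact deriv_mul (hf.differentiable (by simp) x) (hg.differentiable (by simp) x)
  unfold baseNorm
  rw [hd]
  gcongr
  · exact eLpNorm_mul_le_top_mul p hg.continuous
  · refine (eLpNorm_add_le (hf'.mul hg.continuous).aestronglyMeasurable
      (hf.continuous.mul hg').aestronglyMeasurable hp).trans ?_
    gcongr
    exact eLpNorm_mul_le_top_mul p hg'

theorem baseNorm_mul_le_top (p : ℝ≥0∞) (hp : 1 ≤ p) {f g : ℝ → ℂ} (hf : ContDiff ℝ ∞ f)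
    (hg : ContDiff ℝ ∞ g) : baseNorm p (f * g) ≤ baseNorm ∞ f * baseNorm p g := by
  refine (baseNorm_mul_le_aux p hp hf hg).trans ?_
  have h := eLpNorm_mul_le_top_mul (f := deriv f) p hg.continuous
  unfold baseNorm
  generalize eLpNorm f ∞ = A, eLpNorm (deriv f) ∞ = A', eLpNorm g p = B,
    eLpNorm (deriv g) p = B', eLpNorm (deriv f * g) p = D at h ⊢
  have h1 : (A + A') * (B + B') = A * B + (A' * B + A * B') + A' * B' := by ring
  rw [h1]
  exact (add_le_add_right (add_le_add_left h _) _).trans le_self_add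

/-- Compare f(x) with f(y) by the fundamental theorem of calculus and average over y in [x, x+1]; on
this probability space L¹ norms are at most L² norms. -/
theorem enorm_le_baseNorm_two {f : ℝ → ℂ} (hf : ContDiff ℝ ∞ f) (x : ℝ) :
    ‖f x‖ₑ ≤ baseNorm 2 f := by
  have hf' := (hf.iteratedDeriv_infty 1).continuous
  rw [iteratedDeriv_one] at hf'
  set μ : Measure ℝ := volume.restrict (Icc x (x + 1)) with hμ
  have hprob : IsProbabilityMeasure μ := ⟨by simp [hμ]⟩
  have hle : ∀ g : ℝ → ℂ, Continuous g → ∫⁻ y, ‖g y‖ₑ ∂μ ≤ eLpNorm g 2 := by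
    intro g hg
    rw [← eLpNorm_one_eq_lintegral_enorm]
    refine (eLpNorm_le_eLpNorm_of_exponent_le (q := 2) (by norm_num) hg.aestronglyMeasurable).trans ?_
    exact eLpNorm_mono_measure g Measure.restrict_le_self
  have hpt : ∀ᵐ y ∂μ, ‖f x‖ₑ ≤ ‖f y‖ₑ + ∫⁻ s, ‖deriv f s‖ₑ ∂μ := by
    filter_upwards [ae_restrict_mem measurableSet_Icc] with y hy
    have h1 : ∫ s in x..y, deriv f s = f y - f x :=
      intervalIntegral.integral_deriv_eq_sub (fun s _ => hf.differentiable (by simp) s)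
        (hf'.intervalIntegrable _ _)
    have h2 : f x = f y - ∫ s in x..y, deriv f s := by rw [h1]; ring
    calc ‖f x‖ₑ = ‖f y - ∫ s in x..y, deriv f s‖ₑ := by rw [← h2]
      _ ≤ ‖f y‖ₑ + ‖∫ s in x..y, deriv f s‖ₑ := enorm_sub_le
      _ ≤ _ := by
        gcongr
        rw [intervalIntegral.integral_of_le hy.1]
        refine (enorm_integral_le_lintegral_enorm _).trans ?_
        refine lintegral_mono' (Measure.restrict_mono ?_ le_rfl) le_rfl
        exact fun s hs => ⟨hs.1.le, hs.2.trans hy.2⟩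
  calc ‖f x‖ₑ = ∫⁻ _, ‖f x‖ₑ ∂μ := by simp
    _ ≤ ∫⁻ y, (‖f y‖ₑ + ∫⁻ s, ‖deriv f s‖ₑ ∂μ) ∂μ := lintegral_mono_ae hpt
    _ = ∫⁻ y, ‖f y‖ₑ ∂μ + ∫⁻ s, ‖deriv f s‖ₑ ∂μ := by
        rw [lintegral_add_right _ measurable_const]; simp
    _ ≤ _ := add_le_add (hle f hf.continuous) (hle _ hf')

theorem eLpNorm_top_le_baseNorm_two {f : ℝ → ℂ} (hf : ContDiff ℝ ∞ f) :
    eLpNorm f ∞ ≤ baseNorm 2 f := by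
  rw [eLpNorm_exponent_top]
  exact eLpNormEssSup_le_of_ae_enorm_bound (ae_of_all _ (enorm_le_baseNorm_two hf))

theorem baseNorm_two_mul_le {f g : ℝ → ℂ} (hf : ContDiff ℝ ∞ f)
    (hg : ContDiff ℝ ∞ g) : baseNorm 2 (f * g) ≤ 2 * (baseNorm 2 f * baseNorm 2 g) := by
  refine (baseNorm_mul_le_aux 2 (by norm_num) hf hg).trans ?_
  have hf' := (hf.iteratedDeriv_infty 1).continuous
  rw [iteratedDeriv_one] at hf'
  have h : eLpNorm (deriv f * g) 2 ≤ eLpNorm g ∞ * eLpNorm (deriv f) 2 := by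
    rw [mul_comm]
    exact eLpNorm_mul_le_top_mul 2 hf'
  calc _ ≤ baseNorm 2 f * eLpNorm g 2 + (baseNorm 2 g * eLpNorm (deriv f) 2 +
        baseNorm 2 f * eLpNorm (deriv g) 2) := by
        have h1 := eLpNorm_top_le_baseNorm_two hf
        have h2 := eLpNorm_top_le_baseNorm_two hg
        gcongr
        exact h.trans (by gcongr)
    _ = baseNorm 2 f * baseNorm 2 g + baseNorm 2 g * eLpNorm (deriv f) 2 := by
        simp only [baseNorm]; ring
    _ ≤ baseNorm 2 f * baseNorm 2 g + baseNorm 2 g * baseNorm 2 f := by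
        gcongr
        exact le_add_self
    _ = _ := by ring

theorem wnorm_two_mul_le (c : DerivWeight) {f g : ℝ → ℂ} (hf : ContDiff ℝ ∞ f)
    (hg : ContDiff ℝ ∞ g) : wnorm 2 c (f * g) ≤ 2 * (wnorm 2 c f * wnorm 2 c g) :=
  tsum_weight_iteratedDeriv_mul_le c (fun _ _ => baseNorm_add_le (by norm_num)) (baseNorm_zero 2)
    (fun k f _ => by rw [baseNorm_const_mul, enorm_natCast_complex]) (fun _ _ => baseNorm_two_mul_le) hf hg

/-- The left factor enters only through sup norms. For a dispersing wave these decay like t^(-1/2)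
while the L² norms do not, and this is what makes the Lipschitz constant of the nonlinearity O(1/t).
-/
theorem wnorm_mul_le_top (c : DerivWeight) {f g : ℝ → ℂ} (hf : ContDiff ℝ ∞ f)
    (hg : ContDiff ℝ ∞ g) : wnorm 2 c (f * g) ≤ wnorm ∞ c f * wnorm 2 c g := by
  have := tsum_weight_iteratedDeriv_mul_le c (N := baseNorm 2) (N₁ := baseNorm ∞)
    (N₂ := baseNorm 2) (K := 1)
    (fun _ _ => baseNorm_add_le (by norm_num)) (baseNorm_zero 2)
    (fun k f _ => by rw [baseNorm_const_mul, enorm_natCast_complex])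
    (fun _ _ hf hg => by rw [one_mul]; exact baseNorm_mul_le_top 2 (by norm_num) hf hg) hf hg
  rwa [one_mul] at this

theorem iteratedDeriv_add_eq {f g : ℝ → ℂ} (hf : ContDiff ℝ ∞ f) (hg : ContDiff ℝ ∞ g) (j : ℕ) :
    iteratedDeriv j (f + g) = iteratedDeriv j f + iteratedDeriv j g := by
  ext x
  exact iteratedDeriv_add (hf.contDiffAt.of_le (by exact_mod_cast le_top))
    (hg.contDiffAt.of_le (by exact_mod_cast le_top))

theorem iteratedDeriv_sub_eq {f g : ℝ → ℂ} (hf : ContDiff ℝ ∞ f) (hg : ContDiff ℝ ∞ g) (j : ℕ) :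
    iteratedDeriv j (f - g) = iteratedDeriv j f - iteratedDeriv j g := by
  ext x
  exact iteratedDeriv_sub (hf.contDiffAt.of_le (by exact_mod_cast le_top))
    (hg.contDiffAt.of_le (by exact_mod_cast le_top))

theorem iteratedDeriv_smul_eq {f : ℝ → ℂ} (hf : ContDiff ℝ ∞ f) (k : ℂ) (j : ℕ) :
    iteratedDeriv j (k • f) = k • iteratedDeriv j f := by
  ext x
  exact iteratedDeriv_const_smul (hf.contDiffAt.of_le (by exact_mod_cast le_top)) k

theorem iteratedDeriv_star_eq (f : ℝ → ℂ) (j : ℕ) :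
    iteratedDeriv j (star f) = star (iteratedDeriv j f) := by
  induction j with
  | zero => simp
  | succ j ih =>
    rw [iteratedDeriv_succ, ih, iteratedDeriv_succ]
    ext x
    exact deriv.star

theorem wnorm_add_le {p : ℝ≥0∞} (hp : 1 ≤ p) (c : DerivWeight) {f g : ℝ → ℂ}
    (hf : ContDiff ℝ ∞ f) (hg : ContDiff ℝ ∞ g) :
    wnorm p c (f + g) ≤ wnorm p c f + wnorm p c g := by
  unfold wnorm
  rw [← ENNReal.tsum_add]
  refine ENNReal.tsum_le_tsum fun j => ?_
  rw [iteratedDeriv_add_eq hf hg, ← mul_add]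
  gcongr
  exact baseNorm_add_le hp (hf.iteratedDeriv_infty j) (hg.iteratedDeriv_infty j)

theorem wnorm_smul (p : ℝ≥0∞) (c : DerivWeight) {f : ℝ → ℂ} (hf : ContDiff ℝ ∞ f) (k : ℂ) :
    wnorm p c (k • f) = ‖k‖ₑ * wnorm p c f := by
  unfold wnorm
  rw [← ENNReal.tsum_mul_left]
  refine tsum_congr fun j => ?_
  have h := baseNorm_const_mul p k (iteratedDeriv j f)
  rw [iteratedDeriv_smul_eq hf, show k • iteratedDeriv j f = fun x => k * iteratedDeriv j f x
    from rfl, h]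
  ring

theorem wnorm_star (p : ℝ≥0∞) (c : DerivWeight) (f : ℝ → ℂ) :
    wnorm p c (star f) = wnorm p c f := by
  unfold wnorm baseNorm
  refine tsum_congr fun j => ?_
  have h : ∀ g : ℝ → ℂ, eLpNorm (star g) p = eLpNorm g p := fun g =>
    eLpNorm_congr_norm_ae (ae_of_all _ fun x => by simp)
  rw [iteratedDeriv_star_eq, h, ← iteratedDeriv_one (f := star _), iteratedDeriv_star_eq, h,
    iteratedDeriv_one]

theorem wnorm_zero (p : ℝ≥0∞) (c : DerivWeight) : wnorm p c 0 = 0 := by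
  have := wnorm_smul p c (f := 0) contDiff_const 0
  simpa using this

theorem wnorm_sub_le {p : ℝ≥0∞} (hp : 1 ≤ p) (c : DerivWeight) {f g : ℝ → ℂ}
    (hf : ContDiff ℝ ∞ f) (hg : ContDiff ℝ ∞ g) :
    wnorm p c (f - g) ≤ wnorm p c f + wnorm p c g := by
  have h := wnorm_smul p c hg (-1)
  rw [enorm_neg, enorm_one, one_mul] at h
  have h2 : f - g = f + (-1 : ℂ) • g := by ext; simp [sub_eq_add_neg]
  rw [h2, ← h]
  exact wnorm_add_le hp c hf (hg.const_smul (-1 : ℂ))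

theorem mul_baseNorm_le_wnorm (p : ℝ≥0∞) (c : DerivWeight) (f : ℝ → ℂ) (j : ℕ) :
    c j * baseNorm p (iteratedDeriv j f) ≤ wnorm p c f :=
  ENNReal.le_tsum j

theorem mul_enorm_iteratedDeriv_le_wnorm (c : DerivWeight) {f : ℝ → ℂ} (hf : ContDiff ℝ ∞ f)
    (j : ℕ) (x : ℝ) : c j * ‖iteratedDeriv j f x‖ₑ ≤ wnorm 2 c f := by
  refine le_trans ?_ (mul_baseNorm_le_wnorm 2 c f j)
  gcongr
  exact enorm_le_baseNorm_two (hf.iteratedDeriv_infty j) x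

theorem eLpNorm_two_le_wnorm (c : DerivWeight) (f : ℝ → ℂ) : eLpNorm f 2 ≤ wnorm 2 c f := by
  have := mul_baseNorm_le_wnorm 2 c f 0
  rw [c.zero_eq_one] at this
  simp only [ENNReal.coe_one, one_mul, iteratedDeriv_zero] at this
  exact le_self_add.trans this

/-- A form of Fatou's lemma for the weighted norms. -/
theorem wnorm_le_of_tendsto (c : DerivWeight) {f : ℝ → ℂ} {F : ℕ → ℝ → ℂ} {ε : ℝ≥0∞}
    (hF : ∀ m, ContDiff ℝ ∞ (F m)) (hε : ∀ᶠ m in atTop, wnorm 2 c (F m) ≤ ε)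
    (hlim : ∀ j x, Tendsto (fun m => iteratedDeriv j (F m) x) atTop (𝓝 (iteratedDeriv j f x))) :
    wnorm 2 c f ≤ 2 * ε := by
  -- Fatou in x and over j, separately for the functions (i = 0) and for their derivatives (i = 1);
  -- each half is at most ε, whence the factor 2.
  have key : ∀ i : ℕ, ∑' j, (c j : ℝ≥0∞) * eLpNorm (iteratedDeriv (j + i) f) 2 ≤
      liminf (fun m => ∑' j, (c j : ℝ≥0∞) * eLpNorm (iteratedDeriv (j + i) (F m)) 2) atTop := by
    intro i
    simp_rw [← lintegral_count]
    refine le_trans (lintegral_mono fun j => ?_) (lintegral_liminf_le fun m => .of_discrete)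
    refine le_trans ?_ (ENNReal.liminf_const_mul_of_ne_top ENNReal.coe_ne_top).ge
    gcongr
    exact Lp.eLpNorm_lim_le_liminf_eLpNorm
      (fun m => ((hF m).iteratedDeriv_infty _).continuous.aestronglyMeasurable) _
      (ae_of_all _ fun x => hlim _ x)
  have hsplit : ∀ g, wnorm 2 c g = ∑' j, (c j : ℝ≥0∞) * eLpNorm (iteratedDeriv (j + 0) g) 2 +
      ∑' j, (c j : ℝ≥0∞) * eLpNorm (iteratedDeriv (j + 1) g) 2 := by
    intro g
    unfold wnorm baseNorm
    rw [← ENNReal.tsum_add]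
    refine tsum_congr fun j => ?_
    rw [← iteratedDeriv_succ, mul_add, add_zero]
  rw [hsplit f, two_mul]
  refine add_le_add ((key 0).trans ?_) ((key 1).trans ?_)
  · refine liminf_le_of_frequently_le (Eventually.frequently ?_)
    filter_upwards [hε] with m hm
    rw [hsplit] at hm
    exact le_self_add.trans hm
  · refine liminf_le_of_frequently_le (Eventually.frequently ?_)
    filter_upwards [hε] with m hm
    rw [hsplit] at hm
    exact le_add_self.trans hm

/-! ### The energy space: a complete space of smooth functions, closed under products -/

/-- Smooth functions which are limits of Schwartz functions in the weighted norm `wnorm 2 c`. -/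
def energySubmodule (c : DerivWeight) : Submodule ℂ (ℝ → ℂ) where
  -- Density of the Schwartz functions is built in because the free group is defined on them and
  -- extended by continuity. The approximants have finite norm, hence so do their limits.
  carrier := {f | ContDiff ℝ ∞ f ∧ ∃ g : ℕ → 𝓢(ℝ, ℂ), (∀ n, wnorm 2 c (g n) ≠ ⊤) ∧
    Tendsto (fun n => wnorm 2 c (f - g n)) atTop (𝓝 0)}
  zero_mem' := ⟨contDiff_const, fun _ => 0, fun _ => by
    rw [show ((0 : 𝓢(ℝ, ℂ)) : ℝ → ℂ) = 0 from rfl, wnorm_zero]; simp, by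
    show Tendsto (fun _ : ℕ => wnorm 2 c (0 - 0)) atTop (𝓝 0)
    rw [sub_zero, wnorm_zero]
    exact tendsto_const_nhds⟩
  add_mem' := by
    rintro f g ⟨hf, F, hF, hF'⟩ ⟨hg, G, hG, hG'⟩
    refine ⟨hf.add hg, fun n => F n + G n, fun n => ?_, ?_⟩
    · exact ne_top_of_le_ne_top (ENNReal.add_ne_top.2 ⟨hF n, hG n⟩)
        (wnorm_add_le one_le_two c ((F n).smooth ⊤) ((G n).smooth ⊤))
    · have h0 := hF'.add hG'
      rw [add_zero] at h0
      refine tendsto_of_tendsto_of_tendsto_of_le_of_le tendsto_const_nhds h0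
        (fun _ => zero_le) fun n => ?_
      have : f + g - ⇑(F n + G n) = (f - F n) + (g - G n) := by
        ext x; simp; ring
      show wnorm 2 c (f + g - ⇑(F n + G n)) ≤ _
      rw [this]
      exact wnorm_add_le (by norm_num) c (hf.sub ((F n).smooth ⊤)) (hg.sub ((G n).smooth ⊤))
  smul_mem' := by
    rintro k f ⟨hf, F, hF, hF'⟩
    refine ⟨hf.const_smul k, fun n => k • F n, fun n => ?_, ?_⟩
    · have := wnorm_smul 2 c ((F n).smooth ⊤) k
      rw [show ⇑(k • F n) = k • ⇑(F n) from rfl, this]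
      exact ENNReal.mul_ne_top (by simp) (hF n)
    · have h0 := ENNReal.Tendsto.const_mul (a := ‖k‖ₑ) hF' (Or.inr (by simp))
      rw [mul_zero] at h0
      refine h0.congr fun n => ?_
      have h1 : k • f - ⇑(k • F n) = k • (f - F n) := by
        ext x; simp; ring
      rw [h1]
      exact (wnorm_smul 2 c (hf.sub ((F n).smooth ⊤)) k).symm

/-- The Banach space of smooth functions obtained by closing the Schwartz functions under
`wnorm 2 c`. -/
def EnergySpace (c : DerivWeight) : Type := ↥(energySubmodule c)

namespace EnergySpace

variable {c : DerivWeight}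

instance : AddCommGroup (EnergySpace c) := inferInstanceAs (AddCommGroup (energySubmodule c))
instance : Module ℂ (EnergySpace c) := inferInstanceAs (Module ℂ (energySubmodule c))
instance : CoeFun (EnergySpace c) (fun _ => ℝ → ℂ) := ⟨fun f => f.1⟩

theorem coe_add (f g : EnergySpace c) : ((f + g : EnergySpace c) : ℝ → ℂ) = f + g := rfl
theorem coe_sub (f g : EnergySpace c) : ((f - g : EnergySpace c) : ℝ → ℂ) = f - g := rfl
theorem coe_smul (k : ℂ) (f : EnergySpace c) : ((k • f : EnergySpace c) : ℝ → ℂ) = k • ⇑f := rfl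
theorem coe_zero : ((0 : EnergySpace c) : ℝ → ℂ) = 0 := rfl

theorem ext {f g : EnergySpace c} (h : ∀ x, f x = g x) : f = g := Subtype.ext (funext h)

theorem contDiff (f : EnergySpace c) : ContDiff ℝ ∞ f := f.2.1

theorem wnorm_ne_top (f : EnergySpace c) : wnorm 2 c f ≠ ⊤ := by
  obtain ⟨hf, F, hF, hF'⟩ := f.2
  obtain ⟨n, hn⟩ := (hF'.eventually_lt_const one_pos).exists
  have h : f.1 = (f.1 - F n) + F n := by simp
  rw [h]
  exact ne_top_of_le_ne_top (ENNReal.add_ne_top.2 ⟨(hn.trans_le le_top).ne, hF n⟩)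
    (wnorm_add_le one_le_two c (hf.sub ((F n).smooth ⊤)) ((F n).smooth ⊤))

instance : Norm (EnergySpace c) := ⟨fun f => (wnorm 2 c f).toReal⟩

theorem norm_def (f : EnergySpace c) : ‖f‖ = (wnorm 2 c f).toReal := rfl

theorem ofReal_norm (f : EnergySpace c) : ENNReal.ofReal ‖f‖ = wnorm 2 c f :=
  ENNReal.ofReal_toReal f.wnorm_ne_top

theorem mul_norm_iteratedDeriv_le (f : EnergySpace c) (j : ℕ) (x : ℝ) :
    c j * ‖iteratedDeriv j f x‖ ≤ ‖f‖ := by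
  have := ENNReal.toReal_mono f.wnorm_ne_top (mul_enorm_iteratedDeriv_le_wnorm c f.contDiff j x)
  rw [norm_def]
  simpa using this

theorem norm_iteratedDeriv_le (f : EnergySpace c) (j : ℕ) (x : ℝ) :
    ‖iteratedDeriv j f x‖ ≤ (c j : ℝ)⁻¹ * ‖f‖ := by
  have h : (0 : ℝ) < c j := c.pos j
  rw [← div_eq_inv_mul, le_div_iff₀ h, mul_comm]
  exact f.mul_norm_iteratedDeriv_le j x

theorem norm_apply_le (f : EnergySpace c) (x : ℝ) : ‖f x‖ ≤ ‖f‖ := by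
  have := f.norm_iteratedDeriv_le 0 x
  simpa [c.zero_eq_one] using this

theorem normedSpaceCore : NormedSpace.Core ℂ (EnergySpace c) where
  norm_nonneg _ := ENNReal.toReal_nonneg
  norm_smul k f := by
    have := wnorm_smul 2 c f.contDiff k
    rw [norm_def, norm_def, coe_smul, this, ENNReal.toReal_mul, toReal_enorm]
  norm_triangle f g := by
    rw [norm_def, norm_def, norm_def, ← ENNReal.toReal_add f.wnorm_ne_top g.wnorm_ne_top]
    exact ENNReal.toReal_mono (ENNReal.add_ne_top.2 ⟨f.wnorm_ne_top, g.wnorm_ne_top⟩)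
      (wnorm_add_le (by norm_num) c f.contDiff g.contDiff)
  norm_eq_zero_iff f := by
    constructor
    · intro h
      refine ext fun x => ?_
      have := f.norm_apply_le x
      rw [h] at this
      exact norm_le_zero_iff.1 this
    · rintro rfl
      rw [norm_def, coe_zero, wnorm_zero, ENNReal.toReal_zero]

instance : NormedAddCommGroup (EnergySpace c) := NormedAddCommGroup.ofCore normedSpaceCore
instance : NormedSpace ℂ (EnergySpace c) := NormedSpace.ofCore normedSpaceCore

theorem eLpNorm_two_le (f : EnergySpace c) : eLpNorm f 2 ≤ ENNReal.ofReal ‖f‖ := by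
  rw [ofReal_norm]
  exact eLpNorm_two_le_wnorm c f

theorem eLpNorm_top_le (f : EnergySpace c) : eLpNorm f ∞ ≤ ENNReal.ofReal ‖f‖ := by
  rw [eLpNorm_exponent_top]
  refine eLpNormEssSup_le_of_ae_enorm_bound (ae_of_all _ fun x => ?_)
  rw [← _root_.ofReal_norm]
  exact ENNReal.ofReal_le_ofReal (f.norm_apply_le x)

theorem iteratedDeriv_sub' (f g : EnergySpace c) (j : ℕ) (x : ℝ) :
    iteratedDeriv j (f - g : EnergySpace c) x = iteratedDeriv j f x - iteratedDeriv j g x := by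
  rw [coe_sub, iteratedDeriv_sub_eq f.contDiff g.contDiff]; rfl

theorem iteratedDeriv_add' (f g : EnergySpace c) (j : ℕ) (x : ℝ) :
    iteratedDeriv j (f + g : EnergySpace c) x = iteratedDeriv j f x + iteratedDeriv j g x := by
  rw [coe_add, iteratedDeriv_add_eq f.contDiff g.contDiff]; rfl

theorem iteratedDeriv_smul' (k : ℂ) (f : EnergySpace c) (j : ℕ) (x : ℝ) :
    iteratedDeriv j (k • f : EnergySpace c) x = k * iteratedDeriv j f x := by
  rw [coe_smul, iteratedDeriv_smul_eq f.contDiff]; rfl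

/-- Evaluation of the `j`-th derivative at a point, as a continuous linear functional. -/
def evalDeriv (j : ℕ) (x : ℝ) : EnergySpace c →L[ℂ] ℂ :=
  LinearMap.mkContinuous
    { toFun := fun f => iteratedDeriv j f x
      map_add' := fun f g => iteratedDeriv_add' f g j x
      map_smul' := fun k f => iteratedDeriv_smul' k f j x } (c j : ℝ)⁻¹
    fun f => f.norm_iteratedDeriv_le j x

theorem evalDeriv_apply (j : ℕ) (x : ℝ) (f : EnergySpace c) :
    evalDeriv j x f = iteratedDeriv j f x := rfl

theorem hasDerivAt_evalDeriv (j : ℕ) (x : ℝ) (f : EnergySpace c) :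
    HasDerivAt (fun y => evalDeriv j y f) (evalDeriv (j + 1) x f) x := by
  have := ((f.contDiff.iteratedDeriv_infty j).differentiable (by simp) x).hasDerivAt
  rw [← iteratedDeriv_succ] at this
  exact this

theorem norm_evalDeriv_le (j : ℕ) (x : ℝ) (f : EnergySpace c) :
    ‖evalDeriv j x f‖ ≤ (c j : ℝ)⁻¹ * ‖f‖ := f.norm_iteratedDeriv_le j x

/-- A Schwartz function of finite weighted norm, as an element of the energy space. -/
def ofSchwartz (g : 𝓢(ℝ, ℂ)) (hg : wnorm 2 c g ≠ ⊤) : EnergySpace c :=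
  ⟨g, g.smooth ⊤, fun _ => g, fun _ => hg, by
    show Tendsto (fun _ : ℕ => wnorm 2 c (g - g)) atTop (𝓝 0)
    rw [sub_self, wnorm_zero]
    exact tendsto_const_nhds⟩

theorem coe_ofSchwartz (g : 𝓢(ℝ, ℂ)) (hg : wnorm 2 c g ≠ ⊤) :
    (ofSchwartz g hg : ℝ → ℂ) = g := rfl

theorem exists_ofSchwartz_tendsto (f : EnergySpace c) :
    ∃ (g : ℕ → 𝓢(ℝ, ℂ)) (hg : ∀ n, wnorm 2 c (g n) ≠ ⊤),
      Tendsto (fun n => ofSchwartz (g n) (hg n)) atTop (𝓝 f) := by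
  obtain ⟨hf, F, hF, hF'⟩ := f.2
  refine ⟨F, hF, ?_⟩
  rw [tendsto_iff_norm_sub_tendsto_zero]
  have := (ENNReal.tendsto_toReal ENNReal.zero_ne_top).comp hF'
  refine this.congr fun n => ?_
  rw [norm_sub_rev]
  rfl

/-- Each weight is positive, so all derivatives converge uniformly and the limit is smooth. Fatou
(`wnorm_le_of_tendsto`) upgrades this to norm convergence, and approximants of the terms of the
sequence approximate the limit. -/
instance : CompleteSpace (EnergySpace c) := by
  refine Metric.complete_of_cauchySeq_tendsto fun u hu => ?_
  have huc : ∀ j, UniformCauchySeqOn (fun n x => iteratedDeriv j (u n) x) atTop univ := by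
    intro j
    rw [Metric.uniformCauchySeqOn_iff]
    intro ε hε
    have hc : (0 : ℝ) < c j := c.pos j
    obtain ⟨N, hN⟩ := Metric.cauchySeq_iff.1 hu (c j * ε) (by positivity)
    refine ⟨N, fun m hm n hn x _ => ?_⟩
    have h1 := hN m hm n hn
    rw [dist_eq_norm] at h1 ⊢
    rw [← iteratedDeriv_sub']
    have h2 := mul_norm_iteratedDeriv_le (u m - u n) j x
    exact lt_of_mul_lt_mul_left (h2.trans_lt h1) hc.le
  have hpt : ∀ j x, ∃ l, Tendsto (fun n => iteratedDeriv j (u n) x) atTop (𝓝 l) := fun j x =>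
    cauchySeq_tendsto_of_complete ((huc j).cauchySeq (mem_univ x))
  choose F hF using hpt
  have hunif : ∀ j, TendstoUniformly (fun n x => iteratedDeriv j (u n) x) (F j) atTop := fun j =>
    tendstoUniformlyOn_univ.1 ((huc j).tendstoUniformlyOn_of_tendsto fun x _ => hF j x)
  have hderiv : ∀ j x, HasDerivAt (F j) (F (j + 1) x) x := fun j =>
    hasDerivAt_of_tendstoUniformly (hunif (j + 1))
      (Eventually.of_forall fun n x => hasDerivAt_evalDeriv j x (u n)) (hF j)
  have hiter : ∀ j, iteratedDeriv j (F 0) = F j := by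
    intro j
    induction j with
    | zero => simp
    | succ j ih =>
      rw [iteratedDeriv_succ, ih]
      ext x
      exact (hderiv j x).deriv
  have hsm : ContDiff ℝ ∞ (F 0) := by
    refine contDiff_of_differentiable_iteratedDeriv fun m _ => ?_
    rw [hiter]
    exact fun x => (hderiv m x).differentiableAt
  have hclose : ∀ ε : ℝ≥0∞, ε ≠ 0 → ∀ᶠ n in atTop, wnorm 2 c (F 0 - u n) ≤ 2 * ε := by
    intro ε hε
    obtain ⟨δ, hδ, hδε⟩ : ∃ δ : ℝ, 0 < δ ∧ ENNReal.ofReal δ ≤ ε := by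
      rcases eq_or_ne ε ⊤ with h | h
      · exact ⟨1, one_pos, by simp [h]⟩
      · exact ⟨ε.toReal, ENNReal.toReal_pos hε h, by rw [ENNReal.ofReal_toReal h]⟩
    obtain ⟨N, hN⟩ := Metric.cauchySeq_iff.1 hu δ hδ
    filter_upwards [eventually_ge_atTop N] with n hn
    refine wnorm_le_of_tendsto c (F := fun m => (u m - u n : EnergySpace c))
      (fun m => (u m - u n).contDiff) ?_ fun j x => ?_
    · filter_upwards [eventually_ge_atTop N] with m hm
      have := hN m hm n hn
      rw [dist_eq_norm] at this
      rw [← ofReal_norm]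
      exact (ENNReal.ofReal_le_ofReal this.le).trans hδε
    · simp_rw [iteratedDeriv_sub']
      rw [iteratedDeriv_sub_eq hsm (u n).contDiff, Pi.sub_apply, hiter]
      exact (hF j x).sub_const _
  have htend : Tendsto (fun n => wnorm 2 c (F 0 - u n)) atTop (𝓝 0) := by
    rw [ENNReal.tendsto_nhds_zero]
    intro ε hε
    filter_upwards [hclose (ε / 2) (by simpa using hε.ne')] with n hn
    rwa [ENNReal.mul_div_cancel (by norm_num) (by norm_num)] at hn
  have hmem : F 0 ∈ energySubmodule c := by
    refine ⟨hsm, ?_⟩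
    have happ : ∀ n : ℕ, ∃ g : 𝓢(ℝ, ℂ), wnorm 2 c g ≠ ⊤ ∧
        wnorm 2 c (u n - g) ≤ (n + 1 : ℝ≥0∞)⁻¹ := by
      intro n
      obtain ⟨_, G, hG, hG'⟩ := (u n).2
      obtain ⟨m, hm⟩ := (hG'.eventually_le_const (u := (n + 1 : ℝ≥0∞)⁻¹)
        (ENNReal.inv_pos.2 (by simp))).exists
      exact ⟨G m, hG m, hm⟩
    choose g hg hg' using happ
    refine ⟨g, hg, ?_⟩
    have h1 : Tendsto (fun n : ℕ => (n + 1 : ℝ≥0∞)⁻¹) atTop (𝓝 0) := by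
      have := (tendsto_add_atTop_iff_nat 1).2 ENNReal.tendsto_inv_nat_nhds_zero
      simpa using this
    have h0 := htend.add h1
    rw [add_zero] at h0
    refine tendsto_of_tendsto_of_tendsto_of_le_of_le tendsto_const_nhds h0
      (fun _ => zero_le) fun n => ?_
    have h2 : F 0 - g n = (F 0 - u n) + (u n - g n) := by ext; simp
    show wnorm 2 c (F 0 - g n) ≤ _
    rw [h2]
    exact (wnorm_add_le one_le_two c (hsm.sub (u n).contDiff)
      ((u n).contDiff.sub ((g n).smooth ⊤))).trans (add_le_add le_rfl (hg' n))
  obtain ⟨v, hv⟩ : ∃ v : EnergySpace c, (v : ℝ → ℂ) = F 0 := ⟨⟨F 0, hmem⟩, rfl⟩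
  refine ⟨v, tendsto_iff_norm_sub_tendsto_zero.2 ?_⟩
  rw [← hv] at htend
  have := (ENNReal.tendsto_toReal ENNReal.zero_ne_top).comp htend
  refine this.congr fun n => ?_
  rw [norm_sub_rev]
  rfl

theorem mul_mem (f g : EnergySpace c) : (f * g : ℝ → ℂ) ∈ energySubmodule c := by
  have hfn := f.wnorm_ne_top
  have hgn := g.wnorm_ne_top
  obtain ⟨hf, F, hF, hF'⟩ := f.2
  obtain ⟨hg, G, hG, hG'⟩ := g.2
  refine ⟨hf.mul hg, fun n => SchwartzMap.pairing (ContinuousLinearMap.mul ℂ ℂ) (F n) (G n), ?_, ?_⟩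
  · intro n
    have h1 : ⇑(SchwartzMap.pairing (ContinuousLinearMap.mul ℂ ℂ) (F n) (G n)) = F n * G n := by
      ext; simp [SchwartzMap.pairing_apply_apply]
    rw [h1]
    refine ne_top_of_le_ne_top ?_ (wnorm_two_mul_le c ((F n).smooth ⊤) ((G n).smooth ⊤))
    exact ENNReal.mul_ne_top (by norm_num) (ENNReal.mul_ne_top (hF n) (hG n))
  · have h0 : Tendsto (fun n => 2 * (wnorm 2 c (f - F n) * wnorm 2 c g) +
        (2 * (wnorm 2 c f * wnorm 2 c (g - G n)) +
          2 * (wnorm 2 c (f - F n) * wnorm 2 c (g - G n)))) atTop (𝓝 0) := by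
      have e1 := ENNReal.Tendsto.const_mul (a := 2)
        (ENNReal.Tendsto.mul_const (b := wnorm 2 c g) hF' (Or.inr hgn)) (Or.inr (by norm_num))
      have e2 := ENNReal.Tendsto.const_mul (a := 2)
        (ENNReal.Tendsto.const_mul (a := wnorm 2 c f) hG' (Or.inr hfn)) (Or.inr (by norm_num))
      have e3 := ENNReal.Tendsto.const_mul (a := 2)
        (ENNReal.Tendsto.mul hF' (Or.inr ENNReal.zero_ne_top) hG' (Or.inr ENNReal.zero_ne_top))
        (Or.inr (by norm_num))
      simpa using e1.add (e2.add e3)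
    refine tendsto_of_tendsto_of_tendsto_of_le_of_le tendsto_const_nhds h0
      (fun _ => zero_le) fun n => ?_
    -- Expanded around f and g, so that no uniform bound on the approximants is needed.
    have h1 : f * g - ⇑(SchwartzMap.pairing (ContinuousLinearMap.mul ℂ ℂ) (F n) (G n))
        = (f - F n) * g + (f * (g - G n) - (f - F n) * (g - G n)) := by
      ext x; simp [SchwartzMap.pairing_apply_apply]; ring
    show wnorm 2 c (f * g - ⇑(SchwartzMap.pairing (ContinuousLinearMap.mul ℂ ℂ) (F n) (G n))) ≤ _
    rw [h1]
    have hfF := hf.sub ((F n).smooth ⊤)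
    have hgG := hg.sub ((G n).smooth ⊤)
    refine (wnorm_add_le (by norm_num) c (hfF.mul hg) ((hf.mul hgG).sub (hfF.mul hgG))).trans ?_
    refine add_le_add (wnorm_two_mul_le c hfF hg) ?_
    refine (wnorm_sub_le (by norm_num) c (hf.mul hgG) (hfF.mul hgG)).trans ?_
    exact add_le_add (wnorm_two_mul_le c hf hgG) (wnorm_two_mul_le c hfF hgG)

theorem _root_.ContDiff.star_complex {f : ℝ → ℂ} (hf : ContDiff ℝ ∞ f) : ContDiff ℝ ∞ (star f) :=
  Complex.conjCLE.contDiff.comp hf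

theorem star_mem (f : EnergySpace c) : (star (f : ℝ → ℂ)) ∈ energySubmodule c := by
  obtain ⟨hf, F, hF, hF'⟩ := f.2
  have h1 : ∀ n, ⇑((F n).postcompCLM (𝕜 := ℝ) (Complex.conjCLE : ℂ →L[ℝ] ℂ)) =
      star (F n : ℝ → ℂ) := by
    intro n; ext x; simp [SchwartzMap.postcompCLM_apply]
  refine ⟨hf.star_complex,
    fun n => (F n).postcompCLM (𝕜 := ℝ) (Complex.conjCLE : ℂ →L[ℝ] ℂ), fun n => ?_, ?_⟩
  · rw [h1, wnorm_star]; exact hF n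
  · simp_rw [h1, ← star_sub, wnorm_star]
    exact hF'

instance : Mul (EnergySpace c) := ⟨fun f g => ⟨(f * g : ℝ → ℂ), mul_mem f g⟩⟩
instance : Star (EnergySpace c) := ⟨fun f => ⟨star (f : ℝ → ℂ), star_mem f⟩⟩

theorem coe_mul (f g : EnergySpace c) : ((f * g : EnergySpace c) : ℝ → ℂ) = f * g := rfl
theorem coe_star (f : EnergySpace c) : ((star f : EnergySpace c) : ℝ → ℂ) = star (f : ℝ → ℂ) := rfl

theorem norm_mul_le_two (f g : EnergySpace c) : ‖f * g‖ ≤ 2 * ‖f‖ * ‖g‖ := by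
  have := ENNReal.toReal_mono (ENNReal.mul_ne_top (by norm_num) (ENNReal.mul_ne_top
    f.wnorm_ne_top g.wnorm_ne_top)) (wnorm_two_mul_le c f.contDiff g.contDiff)
  rw [ENNReal.toReal_mul, ENNReal.toReal_mul] at this
  rw [mul_assoc]
  exact this

theorem norm_mul_le_of_wnorm_top_le (f g : EnergySpace c) {m : ℝ} (hm : 0 ≤ m)
    (hf : wnorm ∞ c f ≤ ENNReal.ofReal m) : ‖f * g‖ ≤ m * ‖g‖ := by
  have h := (wnorm_mul_le_top c f.contDiff g.contDiff).trans (mul_le_mul' hf le_rfl)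
  have := ENNReal.toReal_mono (ENNReal.mul_ne_top ENNReal.ofReal_ne_top g.wnorm_ne_top) h
  rw [ENNReal.toReal_mul, ENNReal.toReal_ofReal hm] at this
  exact this

theorem norm_star' (f : EnergySpace c) : ‖star f‖ = ‖f‖ := by
  rw [norm_def, norm_def, coe_star, wnorm_star]

theorem continuous_star' : Continuous (star : EnergySpace c → EnergySpace c) := by
  refine (LipschitzWith.of_dist_le_mul (K := 1) fun f g => ?_).continuous
  have h : star f - star g = star (f - g) := ext fun x => by simp [coe_sub, coe_star]
  rw [dist_eq_norm, dist_eq_norm, h, norm_star', NNReal.coe_one, one_mul]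

/-- Multiplication as a bounded bilinear map. -/
def mulL : EnergySpace c →L[ℂ] EnergySpace c →L[ℂ] EnergySpace c :=
  LinearMap.mkContinuous₂
    (LinearMap.mk₂ ℂ (fun f g => f * g)
      (fun f g h => ext fun x => by simp [coe_add, coe_mul]; ring)
      (fun k f g => ext fun x => by simp [coe_smul, coe_mul]; ring)
      (fun f g h => ext fun x => by simp [coe_add, coe_mul]; ring)
      (fun k f g => ext fun x => by simp [coe_smul, coe_mul]; ring)) 2
    fun f g => norm_mul_le_two f g

instance : ContinuousMul (EnergySpace c) :=
  ⟨(mulL (c := c)).continuous₂⟩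

end EnergySpace

/-! ### The free Schrödinger group on Schwartz functions -/

theorem hasDerivAt_cexp_I_mul (u : ℝ) :
    HasDerivAt (fun u : ℝ => Complex.exp (Complex.I * (u : ℂ)))
      (Complex.I * Complex.exp (Complex.I * (u : ℂ))) u := by
  have h := ((hasDerivAt_id u).ofReal_comp.const_mul Complex.I).cexp
  simpa [mul_comm] using h

theorem norm_cexp_I_mul (u : ℝ) : ‖Complex.exp (Complex.I * (u : ℂ))‖ = 1 := by
  rw [mul_comm]; exact Complex.norm_exp_ofReal_mul_I u

theorem contDiff_cexp_I_mul : ContDiff ℝ ∞ (fun u : ℝ => Complex.exp (Complex.I * (u : ℂ))) :=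
  (contDiff_const.mul Complex.ofRealCLM.contDiff).cexp

theorem hasTemperateGrowth_cexp_I_mul :
    Function.HasTemperateGrowth (fun u : ℝ => Complex.exp (Complex.I * (u : ℂ))) := by
  refine ⟨contDiff_cexp_I_mul, fun n => ⟨0, 1, fun x => ?_⟩⟩
  have h : ∀ n : ℕ, iteratedDeriv n (fun u : ℝ => Complex.exp (Complex.I * (u : ℂ))) =
      fun u : ℝ => Complex.I ^ n * Complex.exp (Complex.I * (u : ℂ)) := by
    intro n
    induction n with
    | zero => simp
    | succ n ih =>
      rw [iteratedDeriv_succ, ih]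
      ext u
      rw [((hasDerivAt_cexp_I_mul u).const_mul _).deriv, pow_succ]
      ring
  rw [norm_iteratedFDeriv_eq_norm_iteratedDeriv, h, norm_mul, norm_cexp_I_mul]
  simp

/-- The symbol of the free Schrödinger propagator. -/
def freeSymbol (t ξ : ℝ) : ℂ := Complex.exp (Complex.I * ((-(4 * Real.pi ^ 2 * ξ ^ 2) * t : ℝ) : ℂ))

theorem norm_freeSymbol (t ξ : ℝ) : ‖freeSymbol t ξ‖ = 1 := norm_cexp_I_mul _

theorem hasTemperateGrowth_freeSymbol (t : ℝ) : (freeSymbol t).HasTemperateGrowth := by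
  have h : (fun ξ : ℝ => -(4 * Real.pi ^ 2 * ξ ^ 2) * t).HasTemperateGrowth := by fun_prop
  exact hasTemperateGrowth_cexp_I_mul.comp h

theorem freeSymbol_add (s t : ℝ) : freeSymbol s * freeSymbol t = freeSymbol (s + t) := by
  ext ξ
  simp only [freeSymbol, Pi.mul_apply, ← Complex.exp_add]
  congr 1
  push_cast
  ring

theorem hasDerivAt_freeSymbol (t ξ : ℝ) : HasDerivAt (fun t => freeSymbol t ξ)
    (Complex.I * ((-(4 * Real.pi ^ 2 * ξ ^ 2) : ℝ) : ℂ) * freeSymbol t ξ) t := by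
  have h := (hasDerivAt_cexp_I_mul (-(4 * Real.pi ^ 2 * ξ ^ 2) * t)).scomp t
    ((hasDerivAt_id t).const_mul (-(4 * Real.pi ^ 2 * ξ ^ 2)))
  refine h.congr_deriv ?_
  simp only [freeSymbol, mul_one, Complex.real_smul]
  ring

theorem norm_freeSymbol_sub_le (s t ξ : ℝ) :
    ‖freeSymbol t ξ - freeSymbol s ξ‖ ≤ 4 * Real.pi ^ 2 * ξ ^ 2 * |t - s| := by
  have := Convex.norm_image_sub_le_of_norm_hasDerivWithin_le (f := fun t => freeSymbol t ξ)
    (C := 4 * Real.pi ^ 2 * ξ ^ 2) (s := univ) (x := s) (y := t)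
    (fun x _ => (hasDerivAt_freeSymbol x ξ).hasDerivWithinAt) (fun x _ => by
      rw [norm_mul, norm_mul, norm_freeSymbol, Complex.norm_I, Complex.norm_real, norm_neg,
        Real.norm_of_nonneg (by positivity)]
      simp) convex_univ (mem_univ _) (mem_univ _)
  simpa using this

/-- The free Schrödinger propagator `exp(i t ∂²)` on Schwartz functions. -/
def freeS (t : ℝ) : 𝓢(ℝ, ℂ) →L[ℂ] 𝓢(ℝ, ℂ) := SchwartzMap.fourierMultiplierCLM ℂ (freeSymbol t)

theorem freeS_zero (f : 𝓢(ℝ, ℂ)) : freeS 0 f = f := by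
  have h : freeSymbol 0 = fun _ => 1 := by ext; simp [freeSymbol]
  rw [freeS, h, SchwartzMap.fourierMultiplierCLM_const]
  simp

theorem freeS_freeS (s t : ℝ) (f : 𝓢(ℝ, ℂ)) : freeS s (freeS t f) = freeS (s + t) f := by
  rw [freeS, freeS, SchwartzMap.fourierMultiplierCLM_fourierMultiplierCLM_apply
    (hasTemperateGrowth_freeSymbol s) (hasTemperateGrowth_freeSymbol t), freeSymbol_add, freeS]

/-- The derivative of a Schwartz function. -/
def derivS : 𝓢(ℝ, ℂ) →L[ℂ] 𝓢(ℝ, ℂ) := SchwartzMap.derivCLM ℂ ℂ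

theorem coe_derivS (f : 𝓢(ℝ, ℂ)) : ⇑(derivS f) = deriv f := by
  ext x; simp [derivS]

theorem coe_derivS_iterate (f : 𝓢(ℝ, ℂ)) (j : ℕ) : ⇑(derivS^[j] f) = iteratedDeriv j f := by
  induction j with
  | zero => simp
  | succ j ih => rw [Function.iterate_succ_apply', coe_derivS, ih, iteratedDeriv_succ]

/-- The symbol of the derivative. -/
def derivSymbol (ξ : ℝ) : ℂ := 2 * Real.pi * Complex.I * ξ

theorem fourier_derivS (f : 𝓢(ℝ, ℂ)) (ξ : ℝ) : 𝓕 (derivS f) ξ = derivSymbol ξ * 𝓕 f ξ := by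
  have h := Real.fourier_deriv (f := (f : ℝ → ℂ)) f.integrable f.differentiable
    (by rw [← coe_derivS]; exact (derivS f).integrable)
  rw [SchwartzMap.fourier_coe, coe_derivS, h, SchwartzMap.fourier_coe]
  simp [derivSymbol]

theorem fourier_freeS (t : ℝ) (f : 𝓢(ℝ, ℂ)) (ξ : ℝ) :
    𝓕 (freeS t f) ξ = freeSymbol t ξ * 𝓕 f ξ := by
  rw [freeS, SchwartzMap.fourierMultiplierCLM_apply, FourierTransform.fourier_fourierInv_eq,
    SchwartzMap.smulLeftCLM_apply_apply (hasTemperateGrowth_freeSymbol t), smul_eq_mul]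

theorem fourierS_injective {f g : 𝓢(ℝ, ℂ)} (h : ∀ ξ, 𝓕 f ξ = 𝓕 g ξ) : f = g := by
  have : 𝓕 f = 𝓕 g := SchwartzMap.ext h
  rw [← FourierTransform.fourierInv_fourier_eq (F := 𝓢(ℝ, ℂ)) f, this,
    FourierTransform.fourierInv_fourier_eq]

theorem freeS_derivS (t : ℝ) (f : 𝓢(ℝ, ℂ)) : freeS t (derivS f) = derivS (freeS t f) :=
  fourierS_injective fun ξ => by
    rw [fourier_freeS, fourier_derivS, fourier_derivS, fourier_freeS]; ring

theorem freeS_derivS_iterate (t : ℝ) (f : 𝓢(ℝ, ℂ)) (j : ℕ) :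
    freeS t (derivS^[j] f) = derivS^[j] (freeS t f) := by
  induction j with
  | zero => rfl
  | succ j ih => rw [Function.iterate_succ_apply', Function.iterate_succ_apply', freeS_derivS, ih]

theorem eLpNorm_schwartz_ne_top (f : 𝓢(ℝ, ℂ)) : eLpNorm f 2 ≠ ⊤ := (f.memLp 2 volume).2.ne

theorem eLpNorm_fourierS (f : 𝓢(ℝ, ℂ)) : eLpNorm (𝓕 f : 𝓢(ℝ, ℂ)) 2 = eLpNorm f 2 := by
  have h := SchwartzMap.norm_fourier_toL2_eq f
  have key : ∀ g : 𝓢(ℝ, ℂ), ‖g.toLp 2 volume‖ = ‖f.toLp 2 volume‖ →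
      eLpNorm g 2 = eLpNorm f 2 := by
    intro g hg
    rw [SchwartzMap.norm_toLp, SchwartzMap.norm_toLp] at hg
    exact (ENNReal.toReal_eq_toReal_iff' (eLpNorm_schwartz_ne_top g)
      (eLpNorm_schwartz_ne_top f)).1 hg
  exact key _ h

theorem fourierS_sub (f g : 𝓢(ℝ, ℂ)) : 𝓕 (f - g) = 𝓕 f - 𝓕 g :=
  map_sub (FourierTransform.fourierCLM ℂ 𝓢(ℝ, ℂ)) f g

theorem eLpNorm_freeS (t : ℝ) (f : 𝓢(ℝ, ℂ)) : eLpNorm (freeS t f) 2 = eLpNorm f 2 := by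
  refine (eLpNorm_fourierS (freeS t f)).symm.trans (Eq.trans ?_ (eLpNorm_fourierS f))
  refine eLpNorm_congr_norm_ae (ae_of_all _ fun ξ => ?_)
  rw [fourier_freeS, norm_mul, norm_freeSymbol, one_mul]

/-- By Plancherel, since the symbols differ by at most |t - s| times 4π²ξ², the modulus of the
symbol of ∂². -/
theorem eLpNorm_freeS_sub_le (s t : ℝ) (f : 𝓢(ℝ, ℂ)) :
    eLpNorm (freeS t f - freeS s f : 𝓢(ℝ, ℂ)) 2 ≤
      ENNReal.ofReal |t - s| * eLpNorm (derivS^[2] f) 2 := by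
  have h1 : ∀ ξ, 𝓕 (freeS t f - freeS s f) ξ = (freeSymbol t ξ - freeSymbol s ξ) * 𝓕 f ξ := by
    intro ξ
    rw [fourierS_sub, _root_.sub_apply, fourier_freeS, fourier_freeS]; ring
  have h2 : ∀ ξ, 𝓕 (derivS^[2] f) ξ = derivSymbol ξ ^ 2 * 𝓕 f ξ := by
    intro ξ
    simp only [Function.iterate_succ, Function.iterate_zero, Function.comp, id]
    rw [fourier_derivS, fourier_derivS]; ring
  have key : eLpNorm (𝓕 (freeS t f - freeS s f) : 𝓢(ℝ, ℂ)) 2 ≤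
      ENNReal.ofReal |t - s| * eLpNorm (𝓕 (derivS^[2] f) : 𝓢(ℝ, ℂ)) 2 := by
    refine (eLpNorm_le_mul_eLpNorm_of_ae_le_mul (ae_of_all _ fun ξ => ?_) 2)
    rw [h1, h2, norm_mul, norm_mul, ← mul_assoc]
    refine mul_le_mul_of_nonneg_right ?_ (norm_nonneg _)
    refine (norm_freeSymbol_sub_le s t ξ).trans (le_of_eq ?_)
    simp [derivSymbol, abs_of_pos Real.pi_pos, mul_pow]
    ring
  rwa [eLpNorm_fourierS, eLpNorm_fourierS] at key

theorem freeS_apply (t : ℝ) (f : 𝓢(ℝ, ℂ)) (x : ℝ) :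
    freeS t f x = ∫ ξ, Complex.exp (Complex.I * ((2 * Real.pi * ξ * x : ℝ) : ℂ)) *
      (freeSymbol t ξ * 𝓕 f ξ) := by
  have h : freeS t f x = 𝓕⁻ (𝓕 (freeS t f)) x := by rw [FourierTransform.fourierInv_fourier_eq]
  rw [h, SchwartzMap.fourierInv_coe, Real.fourierInv_eq']
  refine integral_congr_ae (ae_of_all _ fun ξ => ?_)
  simp only [fourier_freeS, smul_eq_mul]
  congr 2
  simp
  ring

/-- Differentiation under the Fourier inversion integral; the t-derivative of the symbol is i(2πiξ)²
times the symbol, dominated by the integrable transform of f″. -/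
theorem hasDerivAt_freeS (f : 𝓢(ℝ, ℂ)) (t x : ℝ) :
    HasDerivAt (fun t => freeS t f x) (Complex.I * (derivS^[2] (freeS t f)) x) t := by
  have hd : (derivS^[2] (freeS t f)) x = freeS t (derivS^[2] f) x := by rw [freeS_derivS_iterate]
  have h2 : ∀ ξ, 𝓕 (derivS^[2] f) ξ = derivSymbol ξ ^ 2 * 𝓕 f ξ := by
    intro ξ
    simp only [Function.iterate_succ, Function.iterate_zero, Function.comp, id]
    rw [fourier_derivS, fourier_derivS]; ring
  rw [hd]
  simp_rw [freeS_apply]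
  have hcont : ∀ t, Continuous (freeSymbol t) := fun t =>
    (hasTemperateGrowth_freeSymbol t).1.continuous
  have hcexp : Continuous fun ξ : ℝ =>
      Complex.exp (Complex.I * ((2 * Real.pi * ξ * x : ℝ) : ℂ)) := by fun_prop
  have hint : ∀ (t : ℝ) (g : 𝓢(ℝ, ℂ)), Integrable (fun ξ : ℝ =>
      Complex.exp (Complex.I * ((2 * Real.pi * ξ * x : ℝ) : ℂ)) * (freeSymbol t ξ * 𝓕 g ξ)) := by
    intro t g
    refine ((𝓕 g : 𝓢(ℝ, ℂ)).integrable (μ := volume)).norm.mono'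
      ((hcexp.mul ((hcont t).mul (𝓕 g : 𝓢(ℝ, ℂ)).continuous)).aestronglyMeasurable)
      (ae_of_all _ fun ξ => ?_)
    rw [norm_mul, norm_mul, norm_cexp_I_mul, norm_freeSymbol, one_mul, one_mul]
  have key := hasDerivAt_integral_of_dominated_loc_of_deriv_le (μ := volume)
    (F := fun t ξ => Complex.exp (Complex.I * ((2 * Real.pi * ξ * x : ℝ) : ℂ)) *
      (freeSymbol t ξ * 𝓕 f ξ))
    (F' := fun t ξ => Complex.exp (Complex.I * ((2 * Real.pi * ξ * x : ℝ) : ℂ)) *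
      (Complex.I * (freeSymbol t ξ * 𝓕 (derivS^[2] f) ξ)))
    (bound := fun ξ => ‖𝓕 (derivS^[2] f) ξ‖) (x₀ := t) (s := univ) Filter.univ_mem
    (Eventually.of_forall fun t => (hint t f).aestronglyMeasurable) (hint t f)
    (((hint t (derivS^[2] f)).const_mul Complex.I).aestronglyMeasurable.congr
      (ae_of_all _ fun ξ => by ring))
    (ae_of_all _ fun ξ s _ => by
      rw [norm_mul, norm_mul, norm_mul, norm_cexp_I_mul, norm_freeSymbol, Complex.norm_I]; simp)
    ((𝓕 (derivS^[2] f) : 𝓢(ℝ, ℂ)).integrable (μ := volume)).norm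
    (ae_of_all _ fun ξ s _ => by
      refine (((hasDerivAt_freeSymbol s ξ).mul_const (𝓕 f ξ)).const_mul _).congr_deriv ?_
      rw [h2]
      simp only [derivSymbol]
      push_cast
      ring_nf
      simp only [Complex.I_pow_three]
      ring)
  refine key.2.congr_deriv ?_
  rw [← integral_const_mul]
  refine integral_congr_ae (ae_of_all _ fun ξ => ?_)
  simp only
  ring

theorem baseNorm_schwartz (f : 𝓢(ℝ, ℂ)) : baseNorm 2 f = eLpNorm f 2 + eLpNorm (derivS f) 2 := by
  rw [baseNorm, coe_derivS]

theorem baseNorm_freeS (t : ℝ) (f : 𝓢(ℝ, ℂ)) : baseNorm 2 (freeS t f) = baseNorm 2 f := by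
  rw [baseNorm_schwartz, baseNorm_schwartz, ← freeS_derivS, eLpNorm_freeS, eLpNorm_freeS]

theorem wnorm_freeS (c : DerivWeight) (t : ℝ) (f : 𝓢(ℝ, ℂ)) :
    wnorm 2 c (freeS t f) = wnorm 2 c f := by
  unfold wnorm
  refine tsum_congr fun j => ?_
  rw [← coe_derivS_iterate, ← coe_derivS_iterate, ← freeS_derivS_iterate, baseNorm_freeS]

theorem baseNorm_freeS_sub_le (s t : ℝ) (f : 𝓢(ℝ, ℂ)) :
    baseNorm 2 (freeS t f - freeS s f : 𝓢(ℝ, ℂ)) ≤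
      ENNReal.ofReal |t - s| * baseNorm 2 (derivS^[2] f) := by
  rw [baseNorm_schwartz, baseNorm_schwartz, map_sub, ← freeS_derivS, ← freeS_derivS, mul_add]
  gcongr
  · exact eLpNorm_freeS_sub_le s t f
  · exact eLpNorm_freeS_sub_le s t (derivS f)

/-- The bound Lipschitz in time loses two derivatives, which the weights need not control after
summation. It is therefore used for each j alone, and dominated convergence over j with majorant 2
c_j‖f^(j)‖ concludes. -/
theorem tendsto_wnorm_freeS_sub (c : DerivWeight) {f : 𝓢(ℝ, ℂ)} (hf : wnorm 2 c f ≠ ⊤) (t : ℝ) :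
    Tendsto (fun s => wnorm 2 c (freeS s f - freeS t f : 𝓢(ℝ, ℂ))) (𝓝 t) (𝓝 0) := by
  have hj : ∀ (s : ℝ) (j : ℕ), iteratedDeriv j (freeS s f - freeS t f : 𝓢(ℝ, ℂ)) =
      ⇑(freeS s (derivS^[j] f) - freeS t (derivS^[j] f)) := by
    intro s j
    rw [← coe_derivS_iterate, iterate_map_sub, freeS_derivS_iterate, freeS_derivS_iterate]
  have h := tendsto_lintegral_filter_of_dominated_convergence (μ := Measure.count (α := ℕ))
    (l := 𝓝 t)
    (F := fun s j => (c j : ℝ≥0∞) *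
      baseNorm 2 (iteratedDeriv j (freeS s f - freeS t f : 𝓢(ℝ, ℂ)))) (f := fun _ => 0)
    (fun j => 2 * ((c j : ℝ≥0∞) * baseNorm 2 (iteratedDeriv j f)))
    (Eventually.of_forall fun s => .of_discrete)
    (Eventually.of_forall fun s => ae_of_all _ fun j => ?_) ?_ (ae_of_all _ fun j => ?_)
  · simp only [lintegral_count, tsum_zero] at h
    exact h
  · rw [hj, mul_left_comm, ← coe_derivS_iterate]
    refine mul_le_mul' le_rfl ?_
    rw [two_mul]
    have h1 := baseNorm_add_le (p := 2) (by norm_num) ((freeS s (derivS^[j] f)).smooth ⊤)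
      ((-freeS t (derivS^[j] f)).smooth ⊤)
    have h2 := baseNorm_const_mul 2 (-1) (freeS t (derivS^[j] f))
    have h3 : (fun x => -1 * (freeS t (derivS^[j] f)) x) = ⇑(-freeS t (derivS^[j] f)) := by
      ext x; simp
    rw [h3, enorm_neg, enorm_one, one_mul] at h2
    rw [h2, baseNorm_freeS, baseNorm_freeS] at h1
    rw [sub_eq_add_neg]
    exact h1
  · rw [lintegral_count, ENNReal.tsum_mul_left]
    exact ENNReal.mul_ne_top (by norm_num) hf
  · have hb : baseNorm 2 (derivS^[2] (derivS^[j] f)) ≠ ⊤ := by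
      rw [baseNorm_schwartz]
      exact ENNReal.add_ne_top.2 ⟨eLpNorm_schwartz_ne_top _, eLpNorm_schwartz_ne_top _⟩
    have h0 : Tendsto (fun s => (c j : ℝ≥0∞) * (ENNReal.ofReal |s - t| *
        baseNorm 2 (derivS^[2] (derivS^[j] f)))) (𝓝 t) (𝓝 0) := by
      have h1 : Tendsto (fun s => ENNReal.ofReal |s - t|) (𝓝 t) (𝓝 0) := by
        have : Continuous fun s => ENNReal.ofReal |s - t| :=
          ENNReal.continuous_ofReal.comp (by fun_prop)
        simpa using this.tendsto t
      have h2 := ENNReal.Tendsto.const_mul (a := (c j : ℝ≥0∞))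
        (ENNReal.Tendsto.mul_const h1 (Or.inr hb)) (Or.inr ENNReal.coe_ne_top)
      simpa using h2
    refine tendsto_of_tendsto_of_tendsto_of_le_of_le tendsto_const_nhds h0
      (fun _ => zero_le) fun s => ?_
    simp only [hj]
    exact mul_le_mul' le_rfl (baseNorm_freeS_sub_le t s _)

/-- The Schwartz functions of finite weighted norm. -/
def finiteSchwartz (c : DerivWeight) : Submodule ℂ 𝓢(ℝ, ℂ) where
  carrier := {f | wnorm 2 c f ≠ ⊤}
  zero_mem' := by
    show wnorm 2 c (0 : ℝ → ℂ) ≠ ⊤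
    rw [wnorm_zero]; exact ENNReal.zero_ne_top
  add_mem' {f g} hf hg := ne_top_of_le_ne_top (ENNReal.add_ne_top.2 ⟨hf, hg⟩)
    (wnorm_add_le one_le_two c (f.smooth ⊤) (g.smooth ⊤))
  smul_mem' k f hf := by
    show wnorm 2 c (k • (f : ℝ → ℂ)) ≠ ⊤
    rw [wnorm_smul 2 c (f.smooth ⊤)]
    exact ENNReal.mul_ne_top enorm_ne_top hf

/-- The free propagator as an automorphism of the Schwartz functions of finite weighted norm. -/
def freeEquiv (c : DerivWeight) (t : ℝ) : finiteSchwartz c ≃ₗ[ℂ] finiteSchwartz c where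
  toFun f := ⟨freeS t f, by
    show wnorm 2 c (freeS t f) ≠ ⊤
    rw [wnorm_freeS]; exact f.2⟩
  invFun f := ⟨freeS (-t) f, by
    show wnorm 2 c (freeS (-t) f) ≠ ⊤
    rw [wnorm_freeS]; exact f.2⟩
  map_add' f g := Subtype.ext (map_add (freeS t) f.1 g.1)
  map_smul' k f := Subtype.ext (map_smul (freeS t) k f.1)
  left_inv f := Subtype.ext (by simp [freeS_freeS, freeS_zero])
  right_inv f := Subtype.ext (by simp [freeS_freeS, freeS_zero])

/-! ### The free group on the energy space -/

namespace EnergySpace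

variable {c : DerivWeight}

/-- The inclusion of Schwartz functions. -/
def inclSchwartz (c : DerivWeight) : finiteSchwartz c →ₗ[ℂ] EnergySpace c where
  toFun f := ofSchwartz f.1 f.2
  map_add' _ _ := ext fun _ => rfl
  map_smul' _ _ := ext fun _ => rfl

theorem denseRange_inclSchwartz : DenseRange (inclSchwartz c) := by
  intro f
  obtain ⟨g, hg, h⟩ := f.exists_ofSchwartz_tendsto
  exact mem_closure_of_tendsto h (Eventually.of_forall fun n => ⟨⟨g n, hg n⟩, rfl⟩)

/-- The free Schrödinger propagator on the energy space. -/
def free (t : ℝ) : EnergySpace c ≃ₗᵢ[ℂ] EnergySpace c :=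
  (freeEquiv c t).extendOfIsometry (inclSchwartz c) (inclSchwartz c) denseRange_inclSchwartz
    denseRange_inclSchwartz fun f => by
      show (wnorm 2 c (freeS t f)).toReal = (wnorm 2 c f).toReal
      rw [wnorm_freeS]

theorem free_ofSchwartz (t : ℝ) (g : 𝓢(ℝ, ℂ)) (hg : wnorm 2 c g ≠ ⊤) :
    free t (ofSchwartz g hg) = ofSchwartz (freeS t g) (by rwa [wnorm_freeS]) :=
  LinearEquiv.extendOfIsometry_eq (f := freeEquiv c t) (e₁ := inclSchwartz c)
    (e₂ := inclSchwartz c) _ _ _ ⟨g, hg⟩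

theorem norm_free (t : ℝ) (f : EnergySpace c) : ‖free t f‖ = ‖f‖ := (free t).norm_map f

theorem free_free_neg (t : ℝ) (f : EnergySpace c) : free t (free (-t) f) = f := by
  obtain ⟨g, hg, h⟩ := f.exists_ofSchwartz_tendsto
  have h1 := ((free t).continuous.tendsto _).comp (((free (-t)).continuous.tendsto _).comp h)
  refine tendsto_nhds_unique (h1.congr fun n => ?_) h
  refine ext fun x => ?_
  simp only [Function.comp, free_ofSchwartz, coe_ofSchwartz, freeS_freeS]
  rw [add_neg_cancel, freeS_zero]

theorem tendstoUniformly_free {F : ℕ → EnergySpace c} {f : EnergySpace c}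
    (h : Tendsto F atTop (𝓝 f)) :
    TendstoUniformly (fun n t => free t (F n)) (fun t => free t f) atTop := by
  rw [Metric.tendstoUniformly_iff]
  intro ε hε
  filter_upwards [Metric.tendsto_nhds.1 h ε hε] with n hn t
  rw [(free t).dist_map, dist_comm]
  exact hn

theorem continuous_free (f : EnergySpace c) : Continuous fun t => free t f := by
  obtain ⟨g, hg, h⟩ := f.exists_ofSchwartz_tendsto
  refine (tendstoUniformly_free h).continuous (Frequently.of_forall fun n => ?_)
  rw [continuous_iff_continuousAt]
  intro t
  refine tendsto_iff_norm_sub_tendsto_zero.2 ?_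
  have := (ENNReal.tendsto_toReal ENNReal.zero_ne_top).comp (tendsto_wnorm_freeS_sub c (hg n) t)
  refine this.congr fun s => ?_
  show _ = ‖free s (ofSchwartz (g n) (hg n)) - free t (ofSchwartz (g n) (hg n))‖
  rw [free_ofSchwartz, free_ofSchwartz]
  rfl

/-- Strong continuity and isometry together give continuity along a moving argument. -/
theorem continuousWithinAt_free {u : ℝ → EnergySpace c} {s : Set ℝ} {t : ℝ}
    (hu : ContinuousWithinAt u s t) {τ : ℝ → ℝ} (hτ : Continuous τ) :
    ContinuousWithinAt (fun t => free (τ t) (u t)) s t := by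
  refine tendsto_iff_norm_sub_tendsto_zero.2 ?_
  have h1 := tendsto_iff_norm_sub_tendsto_zero.1 hu
  have h2 := tendsto_iff_norm_sub_tendsto_zero.1
    ((((continuous_free (u t)).comp hτ).tendsto t).mono_left (nhdsWithin_le_nhds (s := s)))
  have h3 := h1.add h2
  rw [add_zero] at h3
  refine squeeze_zero (fun _ => norm_nonneg _) (fun r => ?_) h3
  have h4 : free (τ r) (u r) - free (τ t) (u t) = free (τ r) (u r - u t) +
      (free (τ r) (u t) - free (τ t) (u t)) := by
    rw [map_sub]; abel
  rw [h4]
  refine (norm_add_le _ _).trans (le_of_eq ?_)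
  rw [norm_free]
  rfl

theorem continuousOn_free {u : ℝ → EnergySpace c} {s : Set ℝ} (hu : ContinuousOn u s) {τ : ℝ → ℝ}
    (hτ : Continuous τ) : ContinuousOn (fun t => free (τ t) (u t)) s := fun t ht =>
  continuousWithinAt_free (hu t ht) hτ

/-- The derivative is taken after evaluation at a point, because f need not lie in the domain of the
generator. The formula for Schwartz functions passes to the limit, as isometry makes convergence
uniform in t. -/
theorem hasDerivAt_evalDeriv_free (j : ℕ) (x : ℝ) (f : EnergySpace c) (t : ℝ) :
    HasDerivAt (fun t => evalDeriv j x (free t f))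
      (Complex.I * evalDeriv (j + 2) x (free t f)) t := by
  obtain ⟨g, hg, h⟩ := f.exists_ofSchwartz_tendsto
  have hu := tendstoUniformly_free h
  have h1 : TendstoUniformly
      (fun n t => Complex.I * evalDeriv (j + 2) x (free t (ofSchwartz (g n) (hg n))))
      (fun t => Complex.I * evalDeriv (j + 2) x (free t f)) atTop :=
    ((uniformContinuous_const_smul Complex.I).comp
      (evalDeriv (j + 2) x).uniformContinuous).comp_tendstoUniformly hu
  refine hasDerivAt_of_tendstoUniformly
    (f := fun n t => evalDeriv j x (free t (ofSchwartz (g n) (hg n)))) h1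
    (Eventually.of_forall fun n t => ?_) (fun t => ?_) t
  · simp only [free_ofSchwartz, evalDeriv_apply, coe_ofSchwartz]
    have h2 := hasDerivAt_freeS (derivS^[j] (g n)) t x
    simp only [freeS_derivS_iterate, ← Function.iterate_add_apply, coe_derivS_iterate] at h2
    rw [add_comm] at h2
    exact h2
  · exact ((evalDeriv j x).continuous.tendsto _).comp (hu.tendsto_at t)

end EnergySpace

/-! ### Duhamel integrals from infinity and the contraction -/

theorem norm_integral_Ioi_le_rpow {E : Type*} [NormedAddCommGroup E] [NormedSpace ℝ E]
    {M K t : ℝ} (hM : 0 < M) (ht : 0 < t) {F : ℝ → E}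
    (hF : ∀ r, t < r → ‖F r‖ ≤ K * r ^ (-M - 1)) : ‖∫ r in Ioi t, F r‖ ≤ K / M * t ^ (-M) := by
  have hi : IntegrableOn (fun r : ℝ => K * r ^ (-M - 1)) (Ioi t) :=
    (integrableOn_Ioi_rpow_of_lt (by linarith) ht).const_mul K
  refine (norm_integral_le_of_norm_le hi ?_).trans (le_of_eq ?_)
  · filter_upwards [ae_restrict_mem measurableSet_Ioi] with r hr using hF r hr
  · rw [integral_const_mul, integral_Ioi_rpow_of_lt (by linarith) ht]
    have : -M - 1 + 1 = -M := by ring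
    rw [this]
    field_simp

theorem integrableOn_Ioi_of_norm_le_rpow {E : Type*} [NormedAddCommGroup E]
    {M K T : ℝ} (hM : 0 < M) (hT : 0 < T) {F : ℝ → E} (hc : ContinuousOn F (Ici T))
    (hF : ∀ r, T ≤ r → ‖F r‖ ≤ K * r ^ (-M - 1)) : IntegrableOn F (Ioi T) := by
  have hi : IntegrableOn (fun r : ℝ => K * r ^ (-M - 1)) (Ioi T) :=
    (integrableOn_Ioi_rpow_of_lt (by linarith) hT).const_mul K
  refine Integrable.mono' hi ((hc.mono Ioi_subset_Ici_self).aestronglyMeasurable measurableSet_Ioi) ?_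
  filter_upwards [ae_restrict_mem measurableSet_Ioi] with r hr using hF r (le_of_lt hr)

section
variable {E : Type*} [NormedAddCommGroup E] [NormedSpace ℝ E]

theorem integral_Ioi_eq_sub_intervalIntegral {T t : ℝ} {F : ℝ → E} (hi : IntegrableOn F (Ioi T))
    (ht : T ≤ t) : ∫ r in Ioi t, F r = (∫ r in Ioi T, F r) - ∫ r in T..t, F r := by
  have := intervalIntegral.integral_interval_add_Ioi hi (hi.mono_set (Ioi_subset_Ioi ht))
  rw [← this]; abel

theorem hasDerivAt_integral_Ioi [CompleteSpace E] {T t : ℝ} {F : ℝ → E} (hi : IntegrableOn F (Ioi T))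
    (hc : ContinuousOn F (Ici T)) (ht : T < t) :
    HasDerivAt (fun t => ∫ r in Ioi t, F r) (-F t) t := by
  have hct : ContinuousAt F t := hc.continuousAt (Ici_mem_nhds ht)
  have hii : IntervalIntegrable F volume T t :=
    (intervalIntegrable_iff_integrableOn_Ioc_of_le ht.le).2 (hi.mono_set Ioc_subset_Ioi_self)
  have h1 := intervalIntegral.integral_hasDerivAt_right hii
    ((hc.mono Ioi_subset_Ici_self).stronglyMeasurableAtFilter isOpen_Ioi t ht) hct
  have h2 := h1.const_sub (∫ r in Ioi T, F r)
  refine h2.congr_of_eventuallyEq ?_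
  filter_upwards [Ioi_mem_nhds ht] with s hs
  exact integral_Ioi_eq_sub_intervalIntegral hi (le_of_lt hs)

theorem continuousOn_integral_Ioi {T : ℝ} {F : ℝ → E} (hi : IntegrableOn F (Ioi T)) :
    ContinuousOn (fun t => ∫ r in Ioi t, F r) (Ici T) := by
  have h : ContinuousOn (fun t => (∫ r in Ioi T, F r) - ∫ r in T..t, F r) (Ici T) := by
    refine continuousOn_const.sub ?_
    intro t ht
    have h1 : IntegrableOn F (Icc T (t + 1)) :=
      (integrableOn_Icc_iff_integrableOn_Ioc (by simp)).2 (hi.mono_set Ioc_subset_Ioi_self)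
    have h2 := intervalIntegral.continuousOn_primitive_interval
      (by rwa [uIcc_of_le (by linarith [mem_Ici.1 ht])]) (f := F) (a := T) (b := t + 1)
    rw [uIcc_of_le (by linarith [mem_Ici.1 ht])] at h2
    refine (h2 t ⟨ht, by linarith⟩).mono_of_mem_nhdsWithin ?_
    rw [← Ici_inter_Iic]
    exact inter_mem self_mem_nhdsWithin (mem_nhdsWithin_of_mem_nhds (Iic_mem_nhds (by linarith)))
  exact h.congr fun t ht => integral_Ioi_eq_sub_intervalIntegral hi ht

end

namespace EnergySpace
variable {c : DerivWeight}

/-- Solutions of the nonlinear Schrödinger equation which decay as `t → ∞`, in the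
interaction picture. -/
theorem exists_decaying_solution {T M κ : ℝ} (hT : 0 < T) (hM : 0 < M) (hκ : 0 ≤ κ)
    (hκM : 2 * κ ≤ M) (N : ℝ → EnergySpace c → EnergySpace c)
    (hcont : ∀ w : ℝ → EnergySpace c, ContinuousOn w (Ici T) →
      ContinuousOn (fun r => N r (w r)) (Ici T))
    (hLip : ∀ r, T ≤ r → ∀ w w', ‖w‖ ≤ r ^ (-M) → ‖w'‖ ≤ r ^ (-M) →
      ‖N r w - N r w'‖ ≤ κ * r⁻¹ * ‖w - w'‖)
    (hzero : ∀ r, T ≤ r → ‖N r 0‖ ≤ M / 2 * r ^ (-M - 1)) :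
    ∃ z : ℝ → EnergySpace c, ContinuousOn z (Ici T) ∧ (∀ t, T ≤ t → ‖z t‖ ≤ t ^ (-M)) ∧
      ∀ t, T < t → HasDerivAt z (-(Complex.I • free (-t) (N t (free t (z t))))) t := by
  -- The unknown is z = r^(-M) ζ with ζ bounded and continuous, so the sup norm of ζ is the weighted
  -- norm of z; `projIci` only serves to extend ζ below T.
  set Z : (Ici T →ᵇ EnergySpace c) → ℝ → EnergySpace c := fun ζ r => (r ^ (-M)) • ζ (projIci T r) with hZ
  set F : (Ici T →ᵇ EnergySpace c) → ℝ → EnergySpace c := fun ζ r =>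
    -(Complex.I • free (-r) (N r (free r (Z ζ r)))) with hFdef
  have hpos : ∀ r, T ≤ r → 0 < r := fun r hr => hT.trans_le hr
  have hwc : ContinuousOn (fun r : ℝ => r ^ (-M)) (Ici T) :=
    continuousOn_id.rpow_const fun r hr => Or.inl (hpos r hr).ne'
  have hZc : ∀ ζ, ContinuousOn (Z ζ) (Ici T) := fun ζ =>
    hwc.smul (ζ.continuous.comp (continuous_const.max continuous_id |>.subtype_mk _)).continuousOn
  have hFc : ∀ ζ, ContinuousOn (F ζ) (Ici T) := fun ζ =>
    ((continuousOn_free (hcont _ (continuousOn_free (hZc ζ) continuous_id))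
      continuous_neg).const_smul Complex.I).neg
  have hZn : ∀ ζ : (Ici T →ᵇ EnergySpace c), ‖ζ‖ ≤ 1 → ∀ r, T ≤ r → ‖Z ζ r‖ ≤ r ^ (-M) := by
    intro ζ hζ r hr
    simp only [hZ]
    rw [norm_smul, Real.norm_of_nonneg (Real.rpow_nonneg (hpos r hr).le _)]
    exact mul_le_of_le_one_right (Real.rpow_nonneg (hpos r hr).le _)
      ((ζ.norm_coe_le_norm _).trans hζ)
  have hpow : ∀ r, T ≤ r → r⁻¹ * r ^ (-M) = r ^ (-M - 1) := by
    intro r hr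
    rw [Real.rpow_sub (hpos r hr), Real.rpow_one]; field_simp
  -- The Lipschitz constant κ/r turns the weight r^(-M) into κ r^(-M-1), whose integral over (t, ∞)
  -- is (κ/M) t^(-M): the division by M is the source of the contraction.
  have hFd : ∀ ζ ζ' : (Ici T →ᵇ EnergySpace c), ‖ζ‖ ≤ 1 → ‖ζ'‖ ≤ 1 → ∀ r, T ≤ r →
      ‖F ζ r - F ζ' r‖ ≤ κ * ‖ζ - ζ'‖ * r ^ (-M - 1) := by
    intro ζ ζ' hζ hζ' r hr
    have h1 : F ζ r - F ζ' r = -(Complex.I • free (-r) (N r (free r (Z ζ r)) -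
        N r (free r (Z ζ' r)))) := by
      simp only [hFdef, map_sub, smul_sub]; abel
    rw [h1, norm_neg, norm_smul, Complex.norm_I, one_mul, norm_free]
    refine (hLip r hr _ _ (by rw [norm_free]; exact hZn ζ hζ r hr)
      (by rw [norm_free]; exact hZn ζ' hζ' r hr)).trans ?_
    rw [← map_sub, norm_free, ← hpow r hr]
    have h2 : Z ζ r - Z ζ' r = (r ^ (-M)) • (ζ - ζ') (projIci T r) := by
      simp only [hZ, BoundedContinuousFunction.coe_sub, Pi.sub_apply, smul_sub]
    rw [h2, norm_smul, Real.norm_of_nonneg (Real.rpow_nonneg (hpos r hr).le _)]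
    have h3 := (ζ - ζ').norm_coe_le_norm (projIci T r)
    have h4 := Real.rpow_nonneg (hpos r hr).le (-M)
    have h5 := inv_nonneg.2 (hpos r hr).le
    calc κ * r⁻¹ * (r ^ (-M) * ‖(ζ - ζ') (projIci T r)‖)
        ≤ κ * r⁻¹ * (r ^ (-M) * ‖ζ - ζ'‖) := by gcongr
      _ = _ := by ring
  have hF0 : ∀ r, T ≤ r → ‖F 0 r‖ ≤ M / 2 * r ^ (-M - 1) := by
    intro r hr
    have h0 : Z 0 r = 0 := by simp [hZ]
    simp only [hFdef, h0, map_zero]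
    rw [norm_neg, norm_smul, Complex.norm_I, one_mul, norm_free]
    exact hzero r hr
  have hFn : ∀ ζ : (Ici T →ᵇ EnergySpace c), ‖ζ‖ ≤ 1 → ∀ r, T ≤ r → ‖F ζ r‖ ≤ M * r ^ (-M - 1) := by
    intro ζ hζ r hr
    have h1 := hFd ζ 0 hζ (by simp) r hr
    have h2 := hF0 r hr
    have h3 : ‖F ζ r‖ ≤ ‖F ζ r - F 0 r‖ + ‖F 0 r‖ := by
      simpa using norm_add_le (F ζ r - F 0 r) (F 0 r)
    rw [sub_zero] at h1
    have h4 := Real.rpow_nonneg (hpos r hr).le (-M - 1)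
    -- M/2 from the linear growth and M/2 from the forcing add up to M, so the unit ball is mapped
    -- to itself.
    have h5 : κ * ‖ζ‖ ≤ M / 2 := by nlinarith
    calc ‖F ζ r‖ ≤ M / 2 * r ^ (-M - 1) + M / 2 * r ^ (-M - 1) := by
          refine h3.trans (add_le_add (h1.trans ?_) h2)
          gcongr
      _ = _ := by ring
  have hFi : ∀ ζ : (Ici T →ᵇ EnergySpace c), ‖ζ‖ ≤ 1 → IntegrableOn (F ζ) (Ioi T) := fun ζ hζ =>
    integrableOn_Ioi_of_norm_le_rpow hM hT (hFc ζ) (hFn ζ hζ)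
  have hmul : ∀ t, T ≤ t → t ^ M * t ^ (-M) = 1 := by
    intro t ht
    rw [← Real.rpow_add (hpos t ht), add_neg_cancel, Real.rpow_zero]
  have hbound : ∀ (K : ℝ) (G : ℝ → EnergySpace c) (t : ℝ), T ≤ t →
      (∀ r, T ≤ r → ‖G r‖ ≤ K * r ^ (-M - 1)) → ‖(t ^ M) • (-∫ r in Ioi t, G r)‖ ≤ K / M := by
    intro K G t ht hG
    rw [norm_smul, norm_neg, Real.norm_of_nonneg (Real.rpow_nonneg (hpos t ht).le _)]
    have h1 := norm_integral_Ioi_le_rpow hM (hpos t ht) fun r hr => hG r (ht.trans hr.le)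
    calc t ^ M * ‖∫ r in Ioi t, G r‖ ≤ t ^ M * (K / M * t ^ (-M)) := by
          gcongr
          exact Real.rpow_nonneg (hpos t ht).le _
      _ = K / M * (t ^ M * t ^ (-M)) := by ring
      _ = K / M := by rw [hmul t ht, mul_one]
  set B := Metric.closedBall (0 : (Ici T →ᵇ EnergySpace c)) 1 with hB
  have hBn : ∀ ζ : B, ‖(ζ : (Ici T →ᵇ EnergySpace c))‖ ≤ 1 := fun ζ => mem_closedBall_zero_iff.1 ζ.2
  let Φ₀ : B → (Ici T →ᵇ EnergySpace c) := fun ζ => BoundedContinuousFunction.ofNormedAddCommGroup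
    (fun t : Ici T => ((t : ℝ) ^ M) • (-∫ r in Ioi (t : ℝ), F ζ r))
    (by
      have h1 : ContinuousOn (fun t : ℝ => (t ^ M) • (-∫ r in Ioi t, F ζ r)) (Ici T) :=
        (continuousOn_id.rpow_const fun r hr => Or.inl (hpos r hr).ne').smul
          (continuousOn_integral_Ioi (hFi ζ (hBn ζ))).neg
      exact continuousOn_iff_continuous_domRestrict.1 h1) 1
    (fun t => by
      have := hbound M (F ζ) t t.2 (hFn ζ (hBn ζ))
      rwa [div_self hM.ne'] at this)
  have hΦapp : ∀ (ζ : B) (t : Ici T), Φ₀ ζ t = ((t : ℝ) ^ M) • (-∫ r in Ioi (t : ℝ), F ζ r) :=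
    fun _ _ => rfl
  have hΦB : ∀ ζ, Φ₀ ζ ∈ B := fun ζ => by
    rw [hB, mem_closedBall_zero_iff]
    exact BoundedContinuousFunction.norm_ofNormedAddCommGroup_le _ zero_le_one _
  let Φ : B → B := fun ζ => ⟨Φ₀ ζ, hΦB ζ⟩
  have hcontr : ContractingWith (1 / 2) Φ := by
    refine ⟨by rw [← NNReal.coe_lt_coe]; norm_num, LipschitzWith.of_dist_le_mul fun ζ ζ' => ?_⟩
    rw [Subtype.dist_eq, Subtype.dist_eq, dist_eq_norm, dist_eq_norm]
    refine (BoundedContinuousFunction.norm_le (by positivity)).2 fun t => ?_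
    have h1 : (Φ₀ ζ - Φ₀ ζ') t = ((t : ℝ) ^ M) • (-∫ r in Ioi (t : ℝ), (F ζ r - F ζ' r)) := by
      rw [BoundedContinuousFunction.coe_sub, Pi.sub_apply, hΦapp, hΦapp, integral_sub
        ((hFi ζ (hBn ζ)).mono_set (Ioi_subset_Ioi t.2))
        ((hFi ζ' (hBn ζ')).mono_set (Ioi_subset_Ioi t.2)), ← smul_sub]
      congr 1
      abel
    show ‖(Φ₀ ζ - Φ₀ ζ') t‖ ≤ _
    rw [h1]
    refine (hbound _ _ t t.2 (hFd ζ ζ' (hBn ζ) (hBn ζ'))).trans ?_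
    rw [mul_comm κ, mul_div_assoc, mul_comm]
    have h2 : κ / M ≤ 1 / 2 := by
      rw [div_le_div_iff₀ hM (by norm_num)]; linarith
    have h3 : ((1 / 2 : ℝ≥0) : ℝ) = 1 / 2 := by norm_num
    rw [h3]
    gcongr
  have : CompleteSpace B := Metric.isClosed_closedBall.completeSpace_coe
  have : Nonempty B := ⟨⟨0, by simp [hB]⟩⟩
  set ζ := hcontr.fixedPoint Φ
  have hfix : Φ ζ = ζ := hcontr.fixedPoint_isFixedPt
  have hz : ∀ t, T ≤ t → Z ζ t = -∫ r in Ioi t, F ζ r := by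
    intro t ht
    have h1 : (ζ : (Ici T →ᵇ EnergySpace c)) ⟨t, ht⟩ = (t ^ M) • (-∫ r in Ioi t, F ζ r) := by
      have := congrArg (fun ξ : B => (ξ : (Ici T →ᵇ EnergySpace c)) ⟨t, ht⟩) hfix
      exact this.symm
    simp only [hZ]
    rw [projIci_of_mem ht, h1, smul_smul, mul_comm, hmul t ht, one_smul]
  refine ⟨Z ζ, hZc ζ, hZn ζ (hBn ζ), fun t ht => ?_⟩
  have h1 := (hasDerivAt_integral_Ioi (hFi ζ (hBn ζ)) (hFc ζ) ht).neg
  rw [neg_neg] at h1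
  refine h1.congr_of_eventuallyEq ?_
  filter_upwards [Ioi_mem_nhds ht] with s hs
  exact hz s (le_of_lt hs)

end EnergySpace

/-! ### Joint smoothness in time and space -/

/-- A function of two variables with `C^n` partial derivatives on a half space is `C^(n+1)`. -/
theorem contDiffOn_succ_of_partial {T : ℝ} {n : ℕ} {f f₁ f₂ : ℝ → ℝ → ℂ}
    (h₁ : ∀ t, T < t → ∀ x, HasDerivAt (fun s => f s x) (f₁ t x) t)
    (h₂ : ∀ t, T < t → ∀ x, HasDerivAt (f t) (f₂ t x) x)
    (hc₁ : ContDiffOn ℝ n (fun p : ℝ × ℝ => f₁ p.1 p.2) (Ioi T ×ˢ univ))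
    (hc₂ : ContDiffOn ℝ n (fun p : ℝ × ℝ => f₂ p.1 p.2) (Ioi T ×ˢ univ)) :
    ContDiffOn ℝ (n + 1 : ℕ) (fun p : ℝ × ℝ => f p.1 p.2) (Ioi T ×ˢ univ) := by
  have ho : IsOpen (Ioi T ×ˢ (univ : Set ℝ)) := isOpen_Ioi.prod isOpen_univ
  set g₁ : ℝ → ℝ → ℝ →L[ℝ] ℂ := fun t x => (1 : ℝ →L[ℝ] ℝ).smulRight (f₁ t x) with hg₁
  set g₂ : ℝ → ℝ → ℝ →L[ℝ] ℂ := fun t x => (1 : ℝ →L[ℝ] ℝ).smulRight (f₂ t x) with hg₂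
  have hgc₁ : ContDiffOn ℝ n (fun p : ℝ × ℝ => g₁ p.1 p.2) (Ioi T ×ˢ univ) :=
    contDiffOn_const.smulRight hc₁
  have hgc₂ : ContDiffOn ℝ n (fun p : ℝ × ℝ => g₂ p.1 p.2) (Ioi T ×ˢ univ) :=
    contDiffOn_const.smulRight hc₂
  have hfd : ∀ p ∈ Ioi T ×ˢ (univ : Set ℝ), HasFDerivAt (fun p : ℝ × ℝ => f p.1 p.2)
      ((g₁ p.1 p.2).coprod (g₂ p.1 p.2)) p := by
    intro p hp
    have hp' : Ioi T ×ˢ (univ : Set ℝ) ∈ 𝓝 p := ho.mem_nhds hp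
    have := hasStrictFDerivAt_uncurry_coprod (𝕜 := ℝ) (u := p) (f := f) (f₁ := g₁) (f₂ := g₂)
      (by
        filter_upwards [hp'] with q hq
        exact (h₁ q.1 hq.1 q.2).hasFDerivAt)
      (by
        filter_upwards [hp'] with q hq
        exact (h₂ q.1 hq.1 q.2).hasFDerivAt)
      (hgc₁.continuousOn.continuousAt hp') (hgc₂.continuousOn.continuousAt hp')
    exact this.hasFDerivAt
  rw [Nat.cast_add, Nat.cast_one, contDiffOn_succ_iff_fderiv_of_isOpen ho]
  refine ⟨fun p hp => (hfd p hp).differentiableAt.differentiableWithinAt, by simp, ?_⟩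
  have h3 : ContDiffOn ℝ n (fun p : ℝ × ℝ => (g₁ p.1 p.2).comp (ContinuousLinearMap.fst ℝ ℝ ℝ) +
      (g₂ p.1 p.2).comp (ContinuousLinearMap.snd ℝ ℝ ℝ)) (Ioi T ×ˢ univ) :=
    (hgc₁.clm_comp contDiffOn_const).add (hgc₂.clm_comp contDiffOn_const)
  refine h3.congr fun p hp => ?_
  rw [(hfd p hp).fderiv]
  ext <;> simp

/-- All space derivatives of `f` are jointly of class `C^n` for times after `T`. -/
def SpatiallySmooth (n : ℕ∞) (T : ℝ) (f : ℝ → ℝ → ℂ) : Prop :=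
  ∀ j : ℕ, ContDiffOn ℝ n (fun p : ℝ × ℝ => iteratedDeriv j (f p.1) p.2) (Ioi T ×ˢ univ)

namespace SpatiallySmooth
variable {n : ℕ∞} {T : ℝ} {f g : ℝ → ℝ → ℂ}

theorem add (hf : SpatiallySmooth n T f) (hg : SpatiallySmooth n T g)
    (hf' : ∀ t, T < t → ContDiff ℝ ∞ (f t)) (hg' : ∀ t, T < t → ContDiff ℝ ∞ (g t)) :
    SpatiallySmooth n T (fun t => f t + g t) := fun j =>
  ((hf j).add (hg j)).congr fun p hp => by
    rw [iteratedDeriv_add_eq (hf' _ hp.1) (hg' _ hp.1)]; rfl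

theorem sub (hf : SpatiallySmooth n T f) (hg : SpatiallySmooth n T g)
    (hf' : ∀ t, T < t → ContDiff ℝ ∞ (f t)) (hg' : ∀ t, T < t → ContDiff ℝ ∞ (g t)) :
    SpatiallySmooth n T (fun t => f t - g t) := fun j =>
  ((hf j).sub (hg j)).congr fun p hp => by
    rw [iteratedDeriv_sub_eq (hf' _ hp.1) (hg' _ hp.1)]; rfl

theorem smul (hf : SpatiallySmooth n T f) (hf' : ∀ t, T < t → ContDiff ℝ ∞ (f t)) (k : ℂ) :
    SpatiallySmooth n T (fun t => k • f t) := fun j =>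
  ((hf j).const_smul k).congr fun p hp => by
    rw [iteratedDeriv_smul_eq (hf' _ hp.1)]; rfl

theorem star (hf : SpatiallySmooth n T f) : SpatiallySmooth n T (fun t => star (f t)) := fun j =>
  (Complex.conjCLE.contDiff.comp_contDiffOn (hf j)).congr fun p _ => by
    rw [iteratedDeriv_star_eq]; rfl

theorem mul (hf : SpatiallySmooth n T f) (hg : SpatiallySmooth n T g)
    (hf' : ∀ t, T < t → ContDiff ℝ ∞ (f t)) (hg' : ∀ t, T < t → ContDiff ℝ ∞ (g t)) :
    SpatiallySmooth n T (fun t => f t * g t) := fun j => by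
  have h : ContDiffOn ℝ n (fun p : ℝ × ℝ => ∑ i ∈ Finset.range (j + 1), (j.choose i : ℂ) *
      iteratedDeriv i (f p.1) p.2 * iteratedDeriv (j - i) (g p.1) p.2) (Ioi T ×ˢ univ) :=
    ContDiffOn.sum fun i _ => (contDiffOn_const.mul (hf i)).mul (hg (j - i))
  refine h.congr fun p hp => ?_
  exact iteratedDeriv_mul ((hf' _ hp.1).contDiffAt.of_le (by exact_mod_cast le_top))
    ((hg' _ hp.1).contDiffAt.of_le (by exact_mod_cast le_top))

end SpatiallySmooth

/-- A product rule at the zero of the first factor, where continuity of the second one suffices. -/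
theorem hasDerivAt_sub_mul_of_continuousAt {h : ℝ → ℂ} {t : ℝ} (hh : ContinuousAt h t) :
    HasDerivAt (fun s : ℝ => ((s - t : ℝ) : ℂ) * h s) (h t) t := by
  rw [hasDerivAt_iff_tendsto_slope]
  refine (hh.tendsto.mono_left nhdsWithin_le_nhds).congr' ?_
  filter_upwards [self_mem_nhdsWithin] with s hs
  have hne : ((s - t : ℝ) : ℂ) ≠ 0 := by
    exact_mod_cast sub_ne_zero.2 hs
  rw [slope_def_module]
  simp only [sub_self, Complex.ofReal_zero, zero_mul, sub_zero, Complex.real_smul,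
    Complex.ofReal_inv]
  rw [inv_mul_cancel_left₀ hne]

namespace EnergySpace
variable {c : DerivWeight}

theorem evalDeriv_real_smul (j : ℕ) (x r : ℝ) (f : EnergySpace c) :
    evalDeriv j x (r • f) = r * evalDeriv j x f := by
  have h : r • f = (r : ℂ) • f := (Complex.coe_smul r f).symm
  rw [h, map_smul, smul_eq_mul]

/-- With z(s) = z(t) + (s - t)·`dslope z t s`, the first term falls under the free evolution of a
fixed vector. The second is s - t times a function that is merely continuous in s, which is all the
preceding product rule needs. -/
theorem hasDerivAt_evalDeriv_free_apply {z : ℝ → EnergySpace c} {z' : EnergySpace c} {t : ℝ}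
    (hz : HasDerivAt z z' t) (j : ℕ) (x : ℝ) :
    HasDerivAt (fun s => evalDeriv j x (free s (z s)))
      (Complex.I * evalDeriv (j + 2) x (free t (z t)) + evalDeriv j x (free t z')) t := by
  have h1 := hasDerivAt_evalDeriv_free j x (z t) t
  have hd : ContinuousAt (dslope z t) t := continuousAt_dslope_same.2 hz.differentiableAt
  have hc : ContinuousAt (fun s => evalDeriv j x (free s (dslope z t s))) t := by
    refine (evalDeriv j x).continuous.continuousAt.comp ?_
    have := continuousWithinAt_free (s := univ) (hd.continuousWithinAt) continuous_id
    exact this.continuousAt Filter.univ_mem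
  have h2 := hasDerivAt_sub_mul_of_continuousAt hc
  rw [dslope_same, hz.deriv] at h2
  refine (h1.add h2).congr_of_eventuallyEq (Eventually.of_forall fun s => ?_)
  have h3 : z s = z t + (s - t) • dslope z t s := by
    rw [sub_smul_dslope]; abel
  have h4 : free s (z s) = free s (z t) + (s - t) • free s (dslope z t s) := by
    conv_lhs => rw [h3]
    rw [map_add]
    congr 1
    exact map_real_smul (free s).toLinearIsometry.toLinearMap.toAddMonoidHom
      (free s).continuous (s - t) (dslope z t s)
  show evalDeriv j x (free s (z s)) = _
  rw [h4, map_add, evalDeriv_real_smul]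
  rfl

theorem continuousOn_evalDeriv {w : ℝ → EnergySpace c} {T : ℝ} (hw : ContinuousOn w (Ioi T))
    (j : ℕ) : ContinuousOn (fun p : ℝ × ℝ => evalDeriv j p.2 (w p.1)) (Ioi T ×ˢ univ) := by
  intro p hp
  have h1 : ContinuousWithinAt (fun q : ℝ × ℝ => w q.1) (Ioi T ×ˢ univ) p :=
    (hw p.1 hp.1).comp continuousWithinAt_fst fun q hq => hq.1
  have h2 : ContinuousWithinAt (fun q : ℝ × ℝ => evalDeriv j q.2 (w p.1)) (Ioi T ×ˢ univ) p :=
    ((((w p.1).contDiff.iteratedDeriv_infty j).continuous.comp continuous_snd).continuousAt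
      (x := p)).continuousWithinAt
  have h3 := (tendsto_iff_norm_sub_tendsto_zero.1 h1).const_mul ((c j : ℝ)⁻¹)
  have h4 := tendsto_iff_norm_sub_tendsto_zero.1 h2
  have h5 := h3.add h4
  rw [mul_zero, add_zero] at h5
  refine tendsto_iff_norm_sub_tendsto_zero.2
    (squeeze_zero (fun _ => norm_nonneg _) (fun q => ?_) h5)
  have h6 : evalDeriv j q.2 (w q.1) - evalDeriv j p.2 (w p.1) = evalDeriv j q.2 (w q.1 - w p.1) +
      (evalDeriv j q.2 (w p.1) - evalDeriv j p.2 (w p.1)) := by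
    rw [map_sub]; abel
  rw [h6]
  exact (norm_add_le _ _).trans (add_le_add (norm_evalDeriv_le j _ _) le_rfl)

/-- Propagation of regularity in time for mild solutions. -/
theorem spatiallySmooth_of_hasDerivAt {w : ℝ → EnergySpace c} {T : ℝ}
    (hw : ContinuousOn w (Ioi T)) {F : ℝ → ℝ → ℂ}
    (hderiv : ∀ j t, T < t → ∀ x, HasDerivAt (fun s => evalDeriv j x (w s))
      (Complex.I * evalDeriv (j + 2) x (w t) - Complex.I * iteratedDeriv j (F t) x) t)
    (hF : ∀ n : ℕ, SpatiallySmooth n T (fun t => w t) → SpatiallySmooth n T F) (n : ℕ) :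
    SpatiallySmooth n T (fun t => w t) := by
  induction n with
  | zero =>
    intro j
    rw [Nat.cast_zero]
    exact contDiffOn_zero.2 (continuousOn_evalDeriv hw j)
  | succ n ih =>
    intro j
    refine contDiffOn_succ_of_partial (f := fun t x => iteratedDeriv j (w t) x) (hderiv j)
      -- The hypothesis covers every j, so the two x-derivatives spent on one time derivative are
      -- always available.
      (fun t _ x => hasDerivAt_evalDeriv j x (w t)) ?_ (ih (j + 1))
    exact (contDiffOn_const.mul (ih (j + 2))).sub (contDiffOn_const.mul (hF n ih j))

/-! ### Lipschitz estimates for the nonlinearity -/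

/-- The power nonlinearity `β |v|² v + γ |v|⁴ v`. -/
def nonlinearity (β γ : ℝ) (v : EnergySpace c) : EnergySpace c :=
  (β : ℂ) • (v * (star v * v)) + (γ : ℂ) • (v * (star v * (v * (star v * v))))

theorem continuous_nonlinearity (β γ : ℝ) :
    Continuous (nonlinearity β γ : EnergySpace c → EnergySpace c) := by
  have h : Continuous fun v : EnergySpace c => star v := continuous_star'
  unfold nonlinearity
  fun_prop

/-- Multiplication by `f` has operator norm at most `m`. -/
def MulBound (f : EnergySpace c) (m : ℝ) : Prop := ∀ g, ‖f * g‖ ≤ m * ‖g‖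

theorem MulBound.star {f : EnergySpace c} {m : ℝ} (h : MulBound f m) : MulBound (star f) m := by
  intro g
  have h1 : Star.star f * g = Star.star (f * Star.star g) :=
    ext fun x => by simp [coe_star, coe_mul]
  rw [h1, norm_star', ← norm_star' g]
  exact h _

theorem MulBound.add {f g : EnergySpace c} {m k : ℝ} (hf : MulBound f m) (hg : MulBound g k) :
    MulBound (f + g) (m + k) := by
  intro h
  have h1 : (f + g) * h = f * h + g * h := ext fun x => by simp [coe_add, coe_mul]; ring
  rw [h1, add_mul]
  exact (norm_add_le _ _).trans (add_le_add (hf h) (hg h))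

theorem MulBound.mono {f : EnergySpace c} {m k : ℝ} (hf : MulBound f m) (hmk : m ≤ k) :
    MulBound f k := fun g => (hf g).trans (by gcongr)

theorem mulBound_two_norm (f : EnergySpace c) : MulBound f (2 * ‖f‖) := norm_mul_le_two f

theorem norm_cubic_sub_le {v w : EnergySpace c} {m : ℝ} (hm : 0 ≤ m) (hv : MulBound v m)
    (hw : MulBound w m) : ‖v * (star v * v) - w * (star w * w)‖ ≤ 3 * m ^ 2 * ‖v - w‖ := by
  -- The difference is kept as the last factor of each term, because `MulBound` controls
  -- multiplication from the left.
  have h1 : v * (star v * v) - w * (star w * w) =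
      v * (star v * (v - w)) + w * (v * star (v - w)) + w * (star w * (v - w)) :=
    ext fun x => by simp [coe_sub, coe_add, coe_star, coe_mul]; ring
  have hb : ∀ {f g : EnergySpace c} (d : EnergySpace c), MulBound f m → MulBound g m →
      ‖f * (g * d)‖ ≤ m ^ 2 * ‖d‖ := by
    intro f g d hf hg
    calc ‖f * (g * d)‖ ≤ m * (m * ‖d‖) := (hf _).trans (by gcongr; exact hg d)
      _ = _ := by ring
  rw [h1]
  have e1 := hb (v - w) hv hv.star
  have e2 := hb (star (v - w)) hw hv
  have e3 := hb (v - w) hw hw.star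
  rw [norm_star'] at e2
  calc _ ≤ m ^ 2 * ‖v - w‖ + m ^ 2 * ‖v - w‖ + m ^ 2 * ‖v - w‖ := norm_add₃_le.trans (by gcongr)
    _ = _ := by ring

theorem norm_quintic_sub_le {v w : EnergySpace c} {m : ℝ} (hm : 0 ≤ m) (hv : MulBound v m)
    (hw : MulBound w m) : ‖v * (star v * (v * (star v * v))) - w * (star w * (w * (star w * w)))‖
      ≤ 5 * m ^ 4 * ‖v - w‖ := by
  have h1 : v * (star v * (v * (star v * v))) - w * (star w * (w * (star w * w))) =
      v * (star v * (v * (star v * v) - w * (star w * w))) +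
      v * (w * (star w * (w * star (v - w)))) + star w * (w * (star w * (w * (v - w)))) :=
    ext fun x => by simp [coe_sub, coe_add, coe_star, coe_mul]; ring
  have hb : ∀ {f g : EnergySpace c} (d : EnergySpace c), MulBound f m → MulBound g m →
      ‖f * (g * d)‖ ≤ m ^ 2 * ‖d‖ := by
    intro f g d hf hg
    calc ‖f * (g * d)‖ ≤ m * (m * ‖d‖) := (hf _).trans (by gcongr; exact hg d)
      _ = _ := by ring
  rw [h1]
  have e1 : ‖v * (star v * (v * (star v * v) - w * (star w * w)))‖ ≤
      m ^ 2 * (3 * m ^ 2 * ‖v - w‖) :=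
    (hb _ hv hv.star).trans (by gcongr; exact norm_cubic_sub_le hm hv hw)
  have e2 : ‖v * (w * (star w * (w * star (v - w))))‖ ≤ m ^ 2 * (m ^ 2 * ‖v - w‖) := by
    refine (hb _ hv hw).trans ?_
    have := hb (star (v - w)) hw.star hw
    rw [norm_star'] at this
    gcongr
  have e3 : ‖star w * (w * (star w * (w * (v - w))))‖ ≤ m ^ 2 * (m ^ 2 * ‖v - w‖) :=
    (hb _ hw.star hw).trans (by gcongr; exact hb _ hw.star hw)
  calc _ ≤ m ^ 2 * (3 * m ^ 2 * ‖v - w‖) + m ^ 2 * (m ^ 2 * ‖v - w‖) + m ^ 2 * (m ^ 2 * ‖v - w‖) :=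
        norm_add₃_le.trans (by gcongr)
    _ = _ := by ring

/-- To be used with m of order t^(-1/2): the cubic part is then O(1/t) and the quintic part O(1/t²).
-/
theorem norm_nonlinearity_sub_le (β γ : ℝ) {v w : EnergySpace c} {m : ℝ} (hm : 0 ≤ m)
    (hv : MulBound v m) (hw : MulBound w m) :
    ‖nonlinearity β γ v - nonlinearity β γ w‖ ≤ (3 * |β| * m ^ 2 + 5 * |γ| * m ^ 4) * ‖v - w‖ := by
  have h1 : nonlinearity β γ v - nonlinearity β γ w =
      (β : ℂ) • (v * (star v * v) - w * (star w * w)) + (γ : ℂ) •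
      (v * (star v * (v * (star v * v))) - w * (star w * (w * (star w * w)))) := by
    simp only [nonlinearity, smul_sub]; abel
  rw [h1]
  have e1 := norm_cubic_sub_le hm hv hw
  have e2 := norm_quintic_sub_le hm hv hw
  calc _ ≤ |β| * (3 * m ^ 2 * ‖v - w‖) + |γ| * (5 * m ^ 4 * ‖v - w‖) := by
        refine (norm_add_le _ _).trans ?_
        rw [norm_smul, norm_smul, Complex.norm_real, Complex.norm_real, Real.norm_eq_abs,
          Real.norm_eq_abs]
        gcongr
    _ = _ := by ring

end EnergySpace

/-! ### Calculus of expansions in t^(-j) (ln t)^m -/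

/-- The product of two Schwartz functions. -/
def mulS (f g : 𝓢(ℝ, ℂ)) : 𝓢(ℝ, ℂ) := SchwartzMap.pairing (ContinuousLinearMap.mul ℂ ℂ) f g

theorem mulS_apply (f g : 𝓢(ℝ, ℂ)) (y : ℝ) : mulS f g y = f y * g y := by
  simp [mulS, SchwartzMap.pairing_apply_apply]

/-- The complex conjugate of a Schwartz function. -/
def conjS (f : 𝓢(ℝ, ℂ)) : 𝓢(ℝ, ℂ) := f.postcompCLM (𝕜 := ℝ) (Complex.conjCLE : ℂ →L[ℝ] ℂ)

theorem conjS_apply (f : 𝓢(ℝ, ℂ)) (y : ℝ) : conjS f y = star (f y) := by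
  simp [conjS, SchwartzMap.postcompCLM_apply]

/-- A Schwartz function multiplied by the coordinate. -/
def coordMulS (f : 𝓢(ℝ, ℂ)) : 𝓢(ℝ, ℂ) := SchwartzMap.smulLeftCLM ℂ (fun y : ℝ => (y : ℂ)) f

theorem coordMulS_apply (f : 𝓢(ℝ, ℂ)) (y : ℝ) : coordMulS f y = y * f y := by
  rw [coordMulS, SchwartzMap.smulLeftCLM_apply_apply (by fun_prop), smul_eq_mul]

/-- The monomial `t^(-j) (ln t)^m f(y)`. -/
def logMonomial (j m : ℕ) (f : 𝓢(ℝ, ℂ)) : ℝ → ℝ → ℂ :=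
  fun t y => (((t⁻¹) ^ j * Real.log t ^ m : ℝ) : ℂ) * f y

/-- Linear combinations of `t^(-j) (ln t)^m f(y)` with `k ≤ j`, `m ≤ 2 j` and `f` Schwartz. -/
def logClass (k : ℕ) : Submodule ℂ (ℝ → ℝ → ℂ) :=
  Submodule.span ℂ {g | ∃ j m f, k ≤ j ∧ m ≤ 2 * j ∧ g = logMonomial j m f}

/-- The function `t^(-1) (ln t)^m`. -/
def tau (m : ℕ) : ℝ → ℝ → ℂ := fun t _ => ((t⁻¹ * Real.log t ^ m : ℝ) : ℂ)

/-- The coordinate `y`. -/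
def coordY : ℝ → ℝ → ℂ := fun _ y => (y : ℂ)

namespace logClass
variable {k l n : ℕ} {g h : ℝ → ℝ → ℂ}

theorem monomial_mem {j m : ℕ} (f : 𝓢(ℝ, ℂ)) (hj : k ≤ j) (hm : m ≤ 2 * j) :
    logMonomial j m f ∈ logClass k := Submodule.subset_span ⟨j, m, f, hj, hm, rfl⟩

theorem mono (hkl : k ≤ l) (hg : g ∈ logClass l) : g ∈ logClass k := by
  refine Submodule.span_mono ?_ hg
  rintro _ ⟨j, m, f, hj, hm, rfl⟩
  exact ⟨j, m, f, hkl.trans hj, hm, rfl⟩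

theorem induction {p : (ℝ → ℝ → ℂ) → Prop} (hg : g ∈ logClass k)
    (hmon : ∀ j m f, k ≤ j → m ≤ 2 * j → p (logMonomial j m f)) (hzero : p 0)
    (hadd : ∀ g h, p g → p h → p (g + h)) (hsmul : ∀ (r : ℂ) g, p g → p (r • g)) : p g := by
  refine Submodule.span_induction (p := fun g _ => p g) ?_ hzero (fun g h _ _ => hadd g h)
    (fun r g _ => hsmul r g) hg
  rintro _ ⟨j, m, f, hj, hm, rfl⟩
  exact hmon j m f hj hm

theorem mul_mem (hg : g ∈ logClass k) (hh : h ∈ logClass l) (hn : n ≤ k + l) :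
    g * h ∈ logClass n := by
  refine mono hn ?_
  have h1 := Submodule.mul_mem_mul hg hh
  unfold logClass at h1
  rw [Submodule.span_mul_span] at h1
  refine Submodule.span_mono ?_ h1
  rintro _ ⟨_, ⟨j, m, f, hj, hm, rfl⟩, _, ⟨j', m', f', hj', hm', rfl⟩, rfl⟩
  refine ⟨j + j', m + m', mulS f f', by omega, by omega, ?_⟩
  ext t y
  simp only [logMonomial, Pi.mul_apply, mulS_apply]
  push_cast
  ring

theorem star_mem (hg : g ∈ logClass k) : star g ∈ logClass k := by
  refine induction (p := fun g => star g ∈ logClass k) hg ?_ ?_ ?_ ?_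
  · intro j m f hj hm
    have : star (logMonomial j m f) = logMonomial j m (conjS f) := by
      ext t y
      simp [logMonomial, conjS_apply]
    rw [this]
    exact monomial_mem _ hj hm
  · rw [star_zero]; exact zero_mem _
  · intro g h hg hh
    rw [star_add]; exact add_mem hg hh
  · intro r g hg
    rw [star_smul]; exact Submodule.smul_mem _ _ hg

/-- One more power of t⁻¹ allows two more logarithms; this is the budget that t⁻¹(∂_yφ)² requires.
-/
theorem tau_mul_mem {m : ℕ} (hm : m ≤ 2) (hg : g ∈ logClass k) (hn : n ≤ k + 1) :
    tau m * g ∈ logClass n := by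
  refine mono hn ?_
  refine induction (p := fun g => tau m * g ∈ logClass (k + 1)) hg ?_ ?_ ?_ ?_
  · intro j m' f hj hm'
    have : tau m * logMonomial j m' f = logMonomial (j + 1) (m + m') f := by
      ext t y
      simp only [logMonomial, tau, Pi.mul_apply]
      push_cast
      ring
    rw [this]
    exact monomial_mem _ (by omega) (by omega)
  · rw [mul_zero]; exact zero_mem _
  · intro g h hg hh
    rw [mul_add]; exact add_mem hg hh
  · intro r g hg
    rw [mul_smul_comm]; exact Submodule.smul_mem _ _ hg

theorem coordY_mul_mem (hg : g ∈ logClass k) : coordY * g ∈ logClass k := by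
  refine induction (p := fun g => coordY * g ∈ logClass k) hg ?_ ?_ ?_ ?_
  · intro j m f hj hm
    have : coordY * logMonomial j m f = logMonomial j m (coordMulS f) := by
      ext t y
      simp only [logMonomial, coordY, Pi.mul_apply, coordMulS_apply]
      ring
    rw [this]
    exact monomial_mem _ hj hm
  · rw [mul_zero]; exact zero_mem _
  · intro g h hg hh
    rw [mul_add]; exact add_mem hg hh
  · intro r g hg
    rw [mul_smul_comm]; exact Submodule.smul_mem _ _ hg

theorem exists_hasDerivAt_right (hg : g ∈ logClass k) :
    ∃ g' ∈ logClass k, ∀ t y, HasDerivAt (g t) (g' t y) y := by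
  refine induction (p := fun g => ∃ g' ∈ logClass k, ∀ t y, HasDerivAt (g t) (g' t y) y)
    hg ?_ ?_ ?_ ?_
  · intro j m f hj hm
    refine ⟨_, monomial_mem (derivS f) hj hm, fun t y => ?_⟩
    refine HasDerivAt.const_mul _ ?_
    rw [coe_derivS]
    exact f.differentiableAt.hasDerivAt
  · exact ⟨0, zero_mem _, fun t y => hasDerivAt_const _ _⟩
  · rintro g h ⟨g', hg', hg⟩ ⟨h', hh', hh⟩
    exact ⟨g' + h', add_mem hg' hh', fun t y => (hg t y).add (hh t y)⟩
  · rintro r g ⟨g', hg', hg⟩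
    exact ⟨r • g', Submodule.smul_mem _ _ hg', fun t y => (hg t y).const_smul r⟩

theorem hasDerivAt_logMonomial (j m : ℕ) (f : 𝓢(ℝ, ℂ)) {t : ℝ} (ht : 0 < t) (y : ℝ) :
    HasDerivAt (fun s => logMonomial j m f s y)
      ((t⁻¹ : ℝ) * (-(j : ℂ) * logMonomial j m f t y + m * logMonomial j (m - 1) f t y)) t := by
  have h1 : HasDerivAt (fun s : ℝ => s⁻¹ ^ j * Real.log s ^ m)
      (t⁻¹ * (-j * (t⁻¹ ^ j * Real.log t ^ m) + m * (t⁻¹ ^ j * Real.log t ^ (m - 1)))) t := by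
    have h2 := ((hasDerivAt_inv ht.ne').pow j).mul ((Real.hasDerivAt_log ht.ne').pow m)
    refine h2.congr_deriv ?_
    simp only [Pi.pow_apply]
    rcases j with _ | j
    · simp; ring
    · simp only [Nat.add_sub_cancel]
      rw [show (t ^ 2)⁻¹ = t⁻¹ * t⁻¹ by rw [← mul_inv, sq]]
      push_cast
      ring
  refine (h1.ofReal_comp.mul_const (f y)).congr_deriv ?_
  simp only [logMonomial]
  push_cast
  ring

/-- Integration by parts: ∫ t^(-j-1)(ln t)^m dt = -j⁻¹ t^(-j)(ln t)^m + (m/j) ∫ t^(-j-1)(ln t)^(m-1)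
dt. As j ≥ 1, no logarithm is gained; for j = 0 one would be. -/
theorem exists_primitive_left (hk : k ≠ 0) (hg : g ∈ logClass k) :
    ∃ G ∈ logClass k, ∀ t, 0 < t → ∀ y, HasDerivAt (fun s => G s y) ((t⁻¹ : ℝ) * g t y) t := by
  refine induction (p := fun g => ∃ G ∈ logClass k, ∀ t, 0 < t → ∀ y,
    HasDerivAt (fun s => G s y) ((t⁻¹ : ℝ) * g t y) t) hg ?_ ?_ ?_ ?_
  · intro j m f hj hm
    have hj0 : (j : ℂ) ≠ 0 := by
      have : j ≠ 0 := by omega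
      exact_mod_cast this
    induction m with
    | zero =>
      refine ⟨(-(j : ℂ)⁻¹) • logMonomial j 0 f,
        Submodule.smul_mem _ _ (monomial_mem f hj (by omega)), fun t ht y => ?_⟩
      refine ((hasDerivAt_logMonomial j 0 f ht y).const_smul (-(j : ℂ)⁻¹)).congr_deriv ?_
      simp only [smul_eq_mul]
      field_simp
      simp
      ring
    | succ m ih =>
      obtain ⟨G, hG, hG'⟩ := ih (by omega)
      refine ⟨(-(j : ℂ)⁻¹) • logMonomial j (m + 1) f + ((m + 1 : ℕ) / j : ℂ) • G,
        add_mem (Submodule.smul_mem _ _ (monomial_mem f hj hm)) (Submodule.smul_mem _ _ hG),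
        fun t ht y => ?_⟩
      refine (((hasDerivAt_logMonomial j (m + 1) f ht y).const_smul (-(j : ℂ)⁻¹)).add
        ((hG' t ht y).const_smul ((m + 1 : ℕ) / j : ℂ))).congr_deriv ?_
      simp only [smul_eq_mul, Nat.add_sub_cancel]
      field_simp
      ring
  · exact ⟨0, zero_mem _, fun t _ y => by simpa using hasDerivAt_const t (0 : ℂ)⟩
  · rintro g h ⟨g', hg', hg⟩ ⟨h', hh', hh⟩
    refine ⟨g' + h', add_mem hg' hh', fun t ht y => ((hg t ht y).add (hh t ht y)).congr_deriv ?_⟩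
    simp only [Pi.add_apply]; ring
  · rintro r g ⟨g', hg', hg⟩
    refine ⟨r • g', Submodule.smul_mem _ _ hg', fun t ht y =>
      ((hg t ht y).const_smul r).congr_deriv ?_⟩
    simp only [Pi.smul_apply, smul_eq_mul]; ring

/-- The real part of a primitive is a primitive of the real part. -/
theorem exists_real_primitive_left (hk : k ≠ 0) (hg : g ∈ logClass k) (hr : star g = g) :
    ∃ G ∈ logClass k, star G = G ∧
      ∀ t, 0 < t → ∀ y, HasDerivAt (fun s => G s y) ((t⁻¹ : ℝ) * g t y) t := by
  obtain ⟨G, hG, hG'⟩ := exists_primitive_left hk hg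
  refine ⟨(1 / 2 : ℂ) • (G + star G), Submodule.smul_mem _ _ (add_mem hG (star_mem hG)), ?_,
    fun t ht y => ?_⟩
  · ext t y
    simp
    ring
  · refine (((hG' t ht y).add (hG' t ht y).star).const_smul (1 / 2 : ℂ)).congr_deriv ?_
    have h1 : star (g t y) = g t y := congrFun (congrFun hr t) y
    have h2 : star (((t⁻¹ : ℝ) : ℂ)) = ((t⁻¹ : ℝ) : ℂ) := Complex.conj_ofReal _
    rw [star_mul', h1, h2, smul_eq_mul]
    ring

theorem contDiffOn (hg : g ∈ logClass k) :
    ContDiffOn ℝ ∞ (fun p : ℝ × ℝ => g p.1 p.2) (Ioi 0 ×ˢ univ) := by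
  refine induction (p := fun g => ContDiffOn ℝ ∞ (fun p : ℝ × ℝ => g p.1 p.2) (Ioi 0 ×ˢ univ))
    hg ?_ contDiffOn_const (fun g h hg hh => hg.add hh) (fun r g hg => hg.const_smul r)
  intro j m f _ _
  have h1 : ContDiffOn ℝ ∞ (fun p : ℝ × ℝ => p.1) (Ioi 0 ×ˢ univ) := contDiffOn_fst
  have hne : ∀ p ∈ Ioi (0 : ℝ) ×ˢ (univ : Set ℝ), p.1 ≠ 0 := fun p hp => ne_of_gt hp.1
  exact (Complex.ofRealCLM.contDiff.comp_contDiffOn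
    (((h1.inv hne).pow j).mul ((h1.log hne).pow m))).mul ((f.smooth ⊤).comp_contDiffOn contDiffOn_snd)

theorem inv_mul_log_sq_le {t : ℝ} (ht : 1 ≤ t) : t⁻¹ * (1 + Real.log t) ^ 2 ≤ 4 := by
  have ht0 : 0 < t := by linarith
  -- ln t = 2 ln √t ≤ 2√t - 2 gives 1 + ln t ≤ 2√t, whence the constant 4.
  have h1 : Real.log t = 2 * Real.log (√t) := by
    rw [Real.log_sqrt ht0.le]; ring
  have h2 := Real.log_le_sub_one_of_pos (Real.sqrt_pos.2 ht0)
  have h3 := Real.log_nonneg ht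
  have h4 := Real.sq_sqrt ht0.le
  have h5 : 1 + Real.log t ≤ 2 * √t := by linarith
  rw [inv_mul_le_iff₀ ht0]
  calc (1 + Real.log t) ^ 2 ≤ (2 * √t) ^ 2 := by gcongr
    _ = t * 4 := by rw [mul_pow, h4]; ring

theorem exists_norm_le_schwartz (f : 𝓢(ℝ, ℂ)) : ∃ C, 0 ≤ C ∧ ∀ y, ‖f y‖ ≤ C * (1 + y ^ 2)⁻¹ := by
  obtain ⟨C₀, hC₀, h0⟩ := f.decay 0 0
  obtain ⟨C₂, hC₂, h2⟩ := f.decay 2 0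
  refine ⟨C₀ + C₂, by positivity, fun y => ?_⟩
  have e0 := h0 y
  have e2 := h2 y
  simp only [norm_iteratedFDeriv_zero, pow_zero, one_mul, Real.norm_eq_abs, sq_abs] at e0 e2
  rw [← div_eq_mul_inv, le_div_iff₀ (by positivity)]
  linarith

/-- The pointwise bound satisfied by elements of `logClass k`. -/
theorem exists_norm_le (hg : g ∈ logClass k) : ∃ C, 0 ≤ C ∧ ∀ t, 1 ≤ t → ∀ y,
    ‖g t y‖ ≤ C * (t⁻¹ * (1 + Real.log t) ^ 2) ^ k * (1 + y ^ 2)⁻¹ := by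
  refine induction (p := fun g => ∃ C, 0 ≤ C ∧ ∀ t, 1 ≤ t → ∀ y,
    ‖g t y‖ ≤ C * (t⁻¹ * (1 + Real.log t) ^ 2) ^ k * (1 + y ^ 2)⁻¹) hg ?_ ?_ ?_ ?_
  · intro j m f hj hm
    obtain ⟨C, hC, hf⟩ := exists_norm_le_schwartz f
    refine ⟨4 ^ (j - k) * C, by positivity, fun t ht y => ?_⟩
    have ht0 : 0 < t := by linarith
    have hlog := Real.log_nonneg ht
    have h1 : t⁻¹ ^ j * Real.log t ^ m ≤
        4 ^ (j - k) * (t⁻¹ * (1 + Real.log t) ^ 2) ^ k := by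
      calc t⁻¹ ^ j * Real.log t ^ m ≤ t⁻¹ ^ j * (1 + Real.log t) ^ m := by
            gcongr; linarith
        _ ≤ t⁻¹ ^ j * (1 + Real.log t) ^ (2 * j) := by
            gcongr; linarith
        -- The surplus powers beyond order k are bounded by 4 each.
        _ = (t⁻¹ * (1 + Real.log t) ^ 2) ^ (j - k) * (t⁻¹ * (1 + Real.log t) ^ 2) ^ k := by
            rw [← pow_add, Nat.sub_add_cancel hj, mul_pow, pow_mul]
        _ ≤ _ := by
            gcongr
            exact inv_mul_log_sq_le ht
    simp only [logMonomial]
    rw [norm_mul, Complex.norm_real, Real.norm_of_nonneg (by positivity)]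
    calc _ ≤ (4 ^ (j - k) * (t⁻¹ * (1 + Real.log t) ^ 2) ^ k) * (C * (1 + y ^ 2)⁻¹) :=
          mul_le_mul h1 (hf y) (norm_nonneg _) (by positivity)
      _ = _ := by ring
  · exact ⟨0, le_rfl, fun t _ y => by simp⟩
  · rintro g h ⟨C, hC, hg⟩ ⟨C', hC', hh⟩
    refine ⟨C + C', by positivity, fun t ht y => (norm_add_le _ _).trans ?_⟩
    rw [add_mul, add_mul]
    exact add_le_add (hg t ht y) (hh t ht y)
  · rintro r g ⟨C, hC, hg⟩
    refine ⟨‖r‖ * C, by positivity, fun t ht y => ?_⟩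
    simp only [Pi.smul_apply]
    rw [norm_smul, mul_assoc, mul_assoc, ← mul_assoc C]
    gcongr
    exact hg t ht y

end logClass

/-! ### The profile equation and its Newton iteration -/

/-- A family in `logClass k` together with its first two derivatives in `y` and its derivative
`t ∂_t`. -/
structure Jet (k : ℕ) where
  val : ℝ → ℝ → ℂ
  dy : ℝ → ℝ → ℂ
  dyy : ℝ → ℝ → ℂ
  dθ : ℝ → ℝ → ℂ
  val_mem : val ∈ logClass k
  dy_mem : dy ∈ logClass k
  dyy_mem : dyy ∈ logClass k
  dθ_mem : dθ ∈ logClass k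
  hasDerivAt_dy : ∀ t y, HasDerivAt (val t) (dy t y) y
  hasDerivAt_dyy : ∀ t y, HasDerivAt (dy t) (dyy t y) y
  hasDerivAt_dθ : ∀ t, 0 < t → ∀ y, HasDerivAt (fun s => val s y) ((t⁻¹ : ℝ) * dθ t y) t

/-- The sum of two jets. -/
def Jet.add {k : ℕ} (J K : Jet k) : Jet k where
  val := J.val + K.val
  dy := J.dy + K.dy
  dyy := J.dyy + K.dyy
  dθ := J.dθ + K.dθ
  val_mem := add_mem J.val_mem K.val_mem
  dy_mem := add_mem J.dy_mem K.dy_mem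
  dyy_mem := add_mem J.dyy_mem K.dyy_mem
  dθ_mem := add_mem J.dθ_mem K.dθ_mem
  hasDerivAt_dy t y := (J.hasDerivAt_dy t y).add (K.hasDerivAt_dy t y)
  hasDerivAt_dyy t y := (J.hasDerivAt_dyy t y).add (K.hasDerivAt_dyy t y)
  hasDerivAt_dθ t ht y := ((J.hasDerivAt_dθ t ht y).add (K.hasDerivAt_dθ t ht y)).congr_deriv
    (by simp only [Pi.add_apply]; ring)

/-- A jet regarded in a larger class. -/
def Jet.mono {k l : ℕ} (J : Jet l) (h : k ≤ l) : Jet k :=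
  { J with
    val_mem := logClass.mono h J.val_mem
    dy_mem := logClass.mono h J.dy_mem
    dyy_mem := logClass.mono h J.dyy_mem
    dθ_mem := logClass.mono h J.dθ_mem }

/-- The terms of the residual that gain one order. -/
def lowerOrder (Φ Φ' Ψ : ℝ → ℝ → ℂ) {k : ℕ} (J : Jet k) : ℝ → ℝ → ℂ :=
  tau 0 * J.dyy + (2 * Complex.I) • (Φ * J.dy) + Complex.I • (Φ' * J.val) - Ψ * J.val

/-- The residual of the profile equation. -/
def residual (β γ : ℝ) (α Φ Φ' Ψ : ℝ → ℝ → ℂ) {k : ℕ} (J : Jet k) : ℝ → ℝ → ℂ :=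
  Complex.I • J.dθ + (β : ℂ) • (α * α * J.val) + lowerOrder Φ Φ' Ψ J
    - (β : ℂ) • (J.val * (star J.val * J.val))
    - (γ : ℂ) • (tau 0 * (J.val * (star J.val * (J.val * (star J.val * J.val)))))

section Newton
variable {α Φ Φ' Ψ : ℝ → ℝ → ℂ}

theorem lowerOrder_mem (hΦ : Φ ∈ logClass 1) (hΦ' : Φ' ∈ logClass 1) (hΨ : Ψ ∈ logClass 1)
    {k : ℕ} (J : Jet k) : lowerOrder Φ Φ' Ψ J ∈ logClass (k + 1) := by
  have hk : k + 1 ≤ 1 + k := by omega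
  exact sub_mem (add_mem (add_mem (logClass.tau_mul_mem (by norm_num) J.dyy_mem le_rfl)
    (Submodule.smul_mem _ _ (logClass.mul_mem hΦ J.dy_mem hk)))
    (Submodule.smul_mem _ _ (logClass.mul_mem hΦ' J.val_mem hk)))
    (logClass.mul_mem hΨ J.val_mem hk)

/-- Solvability of the linearised profile equation. -/
theorem exists_jet_linearized (β : ℝ) (hα : α ∈ logClass 0) (hαs : star α = α) {k : ℕ}
    (hk : k ≠ 0) {ρ : ℝ → ℝ → ℂ} (hρ : ρ ∈ logClass k) :
    ∃ J : Jet k, Complex.I • J.dθ - (β : ℂ) • (α * α * (J.val + star J.val)) = -ρ := by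
  have hI : star Complex.I = -Complex.I := Complex.conj_I
  have hβ : star (β : ℂ) = β := Complex.conj_ofReal _
  -- With δ = p + iq the equation splits into t∂ₜp = -Im ρ and t∂ₜq = Re ρ - 2βα²p, solved in this
  -- order.
  obtain ⟨p, hp, hps, hpd⟩ := logClass.exists_real_primitive_left hk
    (g := (Complex.I / 2) • (ρ - star ρ))
    (Submodule.smul_mem _ _ (sub_mem hρ (logClass.star_mem hρ)))
    (by rw [star_smul, star_sub, star_star, star_div₀, hI]; simp; ext t y; simp; ring)
  obtain ⟨q, hq, hqs, hqd⟩ := logClass.exists_real_primitive_left hk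
    (g := (1 / 2 : ℂ) • (ρ + star ρ) - (2 * β : ℂ) • (α * α * p))
    (sub_mem (Submodule.smul_mem _ _ (add_mem hρ (logClass.star_mem hρ)))
      (Submodule.smul_mem _ _ (logClass.mul_mem (logClass.mul_mem hα hα le_rfl) hp (by omega))))
    (by
      have h2 : star (2 : ℂ) = 2 := Complex.conj_ofNat 2
      rw [star_sub, star_smul, star_smul, star_add, star_star, star_mul', star_mul', star_mul', hαs, hps]
      simp [hβ, add_comm])
  have hv : p + Complex.I • q ∈ logClass k := add_mem hp (Submodule.smul_mem _ _ hq)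
  obtain ⟨dy, hdy, hdy'⟩ := logClass.exists_hasDerivAt_right hv
  obtain ⟨dyy, hdyy, hdyy'⟩ := logClass.exists_hasDerivAt_right hdy
  refine ⟨⟨p + Complex.I • q, dy, dyy,
    (Complex.I / 2) • (ρ - star ρ) +
      Complex.I • ((1 / 2 : ℂ) • (ρ + star ρ) - (2 * β : ℂ) • (α * α * p)), hv, hdy, hdyy,
    add_mem (Submodule.smul_mem _ _ (sub_mem hρ (logClass.star_mem hρ))) (Submodule.smul_mem _ _ ?_),
    hdy', hdyy', fun t ht y => ?_⟩, ?_⟩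
  · exact (sub_mem (Submodule.smul_mem _ _ (add_mem hρ (logClass.star_mem hρ)))
      (Submodule.smul_mem _ _ (logClass.mul_mem (logClass.mul_mem hα hα le_rfl) hp (by omega))))
  · refine ((hpd t ht y).add ((hqd t ht y).const_smul Complex.I)).congr_deriv ?_
    simp only [Pi.add_apply, Pi.smul_apply, Pi.sub_apply, smul_eq_mul]
    ring
  · simp only [star_add, star_smul, hps, hqs, hI]
    ext t y
    simp only [Pi.add_apply, Pi.smul_apply, Pi.sub_apply, Pi.mul_apply, Pi.neg_apply, smul_eq_mul]
    linear_combination (ρ t y - 2 * β * (α t y * α t y * p t y)) * Complex.I_sq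

/-- One Newton step. The terms linear in δ with coefficients frozen at α cancel the old residual.
Every other term gains an order: it has a lower-order coefficient, or a factor u - α of class 1, or
is quadratic in δ (2k ≥ k + 1), or carries the t⁻¹ of the quintic term. -/
theorem residual_add_mem (β γ : ℝ) (hα : α ∈ logClass 0) (hαs : star α = α) (hΦ : Φ ∈ logClass 1)
    (hΦ' : Φ' ∈ logClass 1) (hΨ : Ψ ∈ logClass 1) {k : ℕ} (hk : k ≠ 0) {J : Jet 0} (K : Jet k)
    (hJ : J.val - α ∈ logClass 1)
    (hK : Complex.I • K.dθ - (β : ℂ) • (α * α * (K.val + star K.val)) =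
      -residual β γ α Φ Φ' Ψ J) :
    residual β γ α Φ Φ' Ψ (J.add (K.mono (Nat.zero_le k))) ∈ logClass (k + 1) := by
  set u := J.val with hu
  set δ := K.val with hδ
  have mu : u ∈ logClass 0 := J.val_mem
  have mδ : δ ∈ logClass k := K.val_mem
  have mus := logClass.star_mem mu
  have mδs := logClass.star_mem mδ
  have mδ0 := logClass.mono (Nat.zero_le k) mδ
  have mδs0 := logClass.mono (Nat.zero_le k) mδs
  have hJs : star u - α ∈ logClass 1 := by
    have := logClass.star_mem hJ
    rwa [star_sub, hαs] at this
  have e1 : (2 : ℂ) • (((u - α) * star u + α * (star u - α)) * δ) ∈ logClass (k + 1) :=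
    Submodule.smul_mem _ _ (logClass.mul_mem (add_mem (logClass.mul_mem hJ mus le_rfl)
      (logClass.mul_mem hα hJs (by omega))) mδ (by omega))
  have e2 : (u - α) * (u + α) * star δ ∈ logClass (k + 1) :=
    logClass.mul_mem (logClass.mul_mem hJ (add_mem mu hα) le_rfl) mδs (by omega)
  have e3 : δ * ((2 : ℂ) • (u * star δ) + δ * star u + δ * star δ) ∈ logClass (k + 1) :=
    logClass.mul_mem mδ (add_mem (add_mem (Submodule.smul_mem _ _
      (logClass.mul_mem mu mδs (n := k) (by omega))) (logClass.mul_mem mδ mus (by omega)))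
      (logClass.mul_mem mδ mδs (by omega))) (by omega)
  have mx : u + δ ∈ logClass 0 := add_mem mu mδ0
  have my : star u + star δ ∈ logClass 0 := add_mem mus mδs0
  have e4 : tau 0 * (δ * (((u + δ) * (u + δ) + (u + δ) * u + u * u) *
      ((star u + star δ) * (star u + star δ))) +
      star δ * (u * u * u * (star u + star δ + star u))) ∈ logClass (k + 1) := by
    have z : ∀ {g h : ℝ → ℝ → ℂ}, g ∈ logClass 0 → h ∈ logClass 0 → g * h ∈ logClass 0 :=
      fun hg hh => logClass.mul_mem hg hh le_rfl
    refine logClass.tau_mul_mem (by norm_num) (add_mem (logClass.mul_mem (n := k) mδ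
      (z (add_mem (add_mem (z mx mx) (z mx mu)) (z mu mu)) (z my my)) le_rfl)
      (logClass.mul_mem mδs (z (z (z mu mu) mu) (add_mem my mus)) le_rfl)) le_rfl
  have e5 := lowerOrder_mem hΦ hΦ' hΨ K
  have key : residual β γ α Φ Φ' Ψ (J.add (K.mono (Nat.zero_le k))) =
      lowerOrder Φ Φ' Ψ K - (β : ℂ) • ((2 : ℂ) • (((u - α) * star u + α * (star u - α)) * δ) +
        (u - α) * (u + α) * star δ + δ * ((2 : ℂ) • (u * star δ) + δ * star u + δ * star δ)) -
      (γ : ℂ) • (tau 0 * (δ * (((u + δ) * (u + δ) + (u + δ) * u + u * u) *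
      ((star u + star δ) * (star u + star δ))) +
      star δ * (u * u * u * (star u + star δ + star u)))) := by
    ext t y
    have hK' := congrFun (congrFun hK t) y
    simp only [residual, lowerOrder, Jet.add, Jet.mono, Pi.add_apply, Pi.smul_apply, Pi.sub_apply,
      Pi.mul_apply, Pi.neg_apply, Pi.star_apply, smul_eq_mul, star_add, ← hu, ← hδ] at hK' ⊢
    linear_combination hK'
  rw [key]
  exact sub_mem (sub_mem e5 (Submodule.smul_mem _ _ (add_mem (add_mem e1 e2) e3)))
    (Submodule.smul_mem _ _ e4)

/-- Approximate solutions of the profile equation to arbitrary order. -/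
theorem exists_jet_residual_mem (β γ : ℝ) (f : 𝓢(ℝ, ℂ))
    (hf : star (logMonomial 0 0 f) = logMonomial 0 0 f) (hΦ : Φ ∈ logClass 1)
    (hΦ' : Φ' ∈ logClass 1) (hΨ : Ψ ∈ logClass 1) (n : ℕ) :
    ∃ J : Jet 0, J.val - logMonomial 0 0 f ∈ logClass 1 ∧
      residual β γ (logMonomial 0 0 f) Φ Φ' Ψ J ∈ logClass (n + 1) := by
  have hα : logMonomial 0 0 f ∈ logClass 0 := logClass.monomial_mem f le_rfl le_rfl
  induction n with
  | zero =>
    have hd : ∀ (g : 𝓢(ℝ, ℂ)) t y, HasDerivAt (logMonomial 0 0 g t)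
        (logMonomial 0 0 (derivS g) t y) y := fun g t y => by
      refine HasDerivAt.const_mul _ ?_
      rw [coe_derivS]
      exact g.differentiableAt.hasDerivAt
    let J : Jet 0 :=
      ⟨logMonomial 0 0 f, logMonomial 0 0 (derivS f), logMonomial 0 0 (derivS (derivS f)), 0, hα,
      logClass.monomial_mem _ le_rfl le_rfl, logClass.monomial_mem _ le_rfl le_rfl, zero_mem _,
      hd f, hd _, fun t _ y => by
        simpa [logMonomial] using hasDerivAt_const t (f y)⟩
    refine ⟨J, by simp [J], ?_⟩
    -- For u = α, real and independent of t, the two cubic terms cancel: this is the role of the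
    -- logarithmic phase.
    have key : residual β γ (logMonomial 0 0 f) Φ Φ' Ψ J = lowerOrder Φ Φ' Ψ J -
        (γ : ℂ) • (tau 0 * (J.val * (star J.val * (J.val * (star J.val * J.val))))) := by
      simp only [residual, J, hf, smul_zero, mul_assoc]
      abel
    rw [key]
    have mu := J.val_mem
    have z : ∀ {g h : ℝ → ℝ → ℂ}, g ∈ logClass 0 → h ∈ logClass 0 → g * h ∈ logClass 0 :=
      fun hg hh => logClass.mul_mem hg hh le_rfl
    have mus := logClass.star_mem mu
    exact sub_mem (lowerOrder_mem hΦ hΦ' hΨ J) (Submodule.smul_mem _ _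
      (logClass.tau_mul_mem (by norm_num) (z mu (z mus (z mu (z mus mu)))) le_rfl))
  | succ n ih =>
    obtain ⟨J, hJ, hres⟩ := ih
    obtain ⟨K, hK⟩ := exists_jet_linearized β hα hf (Nat.succ_ne_zero n) hres
    refine ⟨J.add (K.mono (Nat.zero_le _)), ?_,
      residual_add_mem β γ hα hf hΦ hΦ' hΨ (Nat.succ_ne_zero n) K hJ hK⟩
    have : (J.add (K.mono (Nat.zero_le _))).val - logMonomial 0 0 f =
        (J.val - logMonomial 0 0 f) + K.val := by
      simp only [Jet.add, Jet.mono]; abel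
    rw [this]
    exact add_mem hJ (logClass.mono (by omega) K.val_mem)

end Newton

/-! ### The oscillating factor and the passage from profiles to the Schrödinger equation -/

/-- The complexification of a real Schwartz function. -/
def complexS (f : 𝓢(ℝ, ℝ)) : 𝓢(ℝ, ℂ) := f.postcompCLM (𝕜 := ℝ) Complex.ofRealCLM

theorem complexS_apply (f : 𝓢(ℝ, ℝ)) (y : ℝ) : complexS f y = (f y : ℂ) := by
  simp [complexS, SchwartzMap.postcompCLM_apply]

/-- The real derivative of a Schwartz function. -/
def derivR : 𝓢(ℝ, ℝ) →L[ℝ] 𝓢(ℝ, ℝ) := SchwartzMap.derivCLM ℝ ℝ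

theorem hasDerivAt_schwartz (f : 𝓢(ℝ, ℝ)) (y : ℝ) : HasDerivAt f (derivR f y) y := by
  have h : derivR f y = deriv f y := by
    simp [derivR, SchwartzMap.derivCLM_apply]
  rw [h]
  exact f.differentiableAt.hasDerivAt

/-- The coefficient of `ln t` in the derivative of the phase. -/
def slopeLog (β : ℝ) (a : 𝓢(ℝ, ℝ)) : 𝓢(ℝ, ℂ) :=
  (-2 * β : ℂ) • mulS (complexS a) (complexS (derivR a))

/-- `t^(-1)` times the derivative of the phase whose slope has coefficients `f` and `g`. -/
def slope (f g : 𝓢(ℝ, ℂ)) : ℝ → ℝ → ℂ := logMonomial 1 1 f + logMonomial 1 0 g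

/-- `t^(-1)` times the square of the derivative of the phase. -/
def slopeSq (f g : 𝓢(ℝ, ℂ)) : ℝ → ℝ → ℂ :=
  logMonomial 1 2 (mulS f f) + (2 : ℂ) • logMonomial 1 1 (mulS f g) + logMonomial 1 0 (mulS g g)

theorem slope_mem (f g : 𝓢(ℝ, ℂ)) : slope f g ∈ logClass 1 :=
  add_mem (logClass.monomial_mem _ le_rfl (by norm_num))
    (logClass.monomial_mem _ le_rfl (by norm_num))

theorem slopeSq_mem (f g : 𝓢(ℝ, ℂ)) : slopeSq f g ∈ logClass 1 :=
  add_mem (add_mem (logClass.monomial_mem _ le_rfl (by norm_num))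
    (Submodule.smul_mem _ _ (logClass.monomial_mem _ le_rfl (by norm_num))))
    (logClass.monomial_mem _ le_rfl (by norm_num))

theorem hasDerivAt_slope (f g : 𝓢(ℝ, ℂ)) (t y : ℝ) :
    HasDerivAt (slope f g t) (slope (derivS f) (derivS g) t y) y := by
  refine HasDerivAt.add (HasDerivAt.const_mul _ ?_) (HasDerivAt.const_mul _ ?_) <;>
  · rw [coe_derivS]
    exact SchwartzMap.differentiableAt _ |>.hasDerivAt

/-- Two x-derivatives produce (t⁻¹∂_yφ)², whereas the profile equation, multiplied by t, contains
t⁻¹(∂_yφ)². -/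
theorem tau_mul_slopeSq (f g : 𝓢(ℝ, ℂ)) : tau 0 * slopeSq f g = slope f g * slope f g := by
  ext t y
  simp only [tau, slopeSq, slope, logMonomial, Pi.mul_apply, Pi.add_apply, Pi.smul_apply,
    mulS_apply, smul_eq_mul]
  push_cast
  ring

section Carrier
variable (β : ℝ) (a b : 𝓢(ℝ, ℝ))

/-- `t^(-1) ∂_y φ`. -/
def phaseSlope : ℝ → ℝ → ℂ := slope (slopeLog β a) (complexS (derivR b))

theorem phaseSlope_apply (t y : ℝ) : phaseSlope β a b t y =
    ((t⁻¹ * (-β * (2 * a y * derivR a y) * Real.log t + derivR b y) : ℝ) : ℂ) := by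
  simp only [phaseSlope, slope, slopeLog, logMonomial, Pi.add_apply, _root_.smul_apply,
    mulS_apply, complexS_apply, smul_eq_mul]
  push_cast
  ring

theorem hasDerivAt_phase (t y : ℝ) :
    HasDerivAt (phase β a b t) (-β * (2 * a y * derivR a y) * Real.log t + derivR b y) y := by
  have h := ((((hasDerivAt_schwartz a y).pow 2).const_mul (-β)).mul_const (Real.log |t|)).add
    (hasDerivAt_schwartz b y)
  refine h.congr_deriv ?_
  rw [Real.log_abs]
  push_cast
  ring

theorem hasDerivAt_phase_along {t : ℝ} (ht : 0 < t) (x : ℝ) :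
    HasDerivAt (fun s => phase β a b s (x / s)) (-β * a (x / t) ^ 2 * t⁻¹ +
      (-β * (2 * a (x / t) * derivR a (x / t)) * Real.log t + derivR b (x / t)) *
        (-(x / t) * t⁻¹)) t := by
  have hx : HasDerivAt (fun s : ℝ => x / s) (-(x / t) * t⁻¹) t := by
    have := (hasDerivAt_inv ht.ne').const_mul x
    refine this.congr_deriv ?_
    field_simp
  have ha := (hasDerivAt_schwartz a (x / t)).comp t hx
  have hb := (hasDerivAt_schwartz b (x / t)).comp t hx
  have hl : HasDerivAt (fun s : ℝ => Real.log |s|) t⁻¹ t := by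
    simp_rw [Real.log_abs]
    exact Real.hasDerivAt_log ht.ne'
  refine ((((ha.pow 2).const_mul (-β)).mul hl).add hb).congr_deriv ?_
  simp only [Function.comp_apply, Pi.pow_apply, Real.log_abs]
  push_cast
  ring

/-- The oscillating factor `t^(-1/2) e^{i x² / (4 t)} e^{i φ(t, x / t)}`. -/
def carrier (t x : ℝ) : ℂ :=
  ((t ^ (-(1 / 2) : ℝ) : ℝ) : ℂ) *
    Complex.exp (Complex.I * ((x ^ 2 / (4 * t) + phase β a b t (x / t) : ℝ) : ℂ))

/-- The function of `(t, x)` whose profile, in the variables `(t, y)` with `y = x / t`, is `g`. -/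
def modulate (g : ℝ → ℝ → ℂ) (t x : ℝ) : ℂ := carrier β a b t x * g t (x / t)

theorem profile_eq_modulate (t x : ℝ) :
    profile β a b t x = modulate β a b (logMonomial 0 0 (complexS a)) t x := by
  simp only [profile, amplitude, modulate, carrier, logMonomial, complexS_apply]
  push_cast
  rw [mul_add, Complex.exp_add]
  ring

theorem norm_carrier {t : ℝ} (ht : 0 < t) (x : ℝ) :
    ‖carrier β a b t x‖ = t ^ (-(1 / 2) : ℝ) := by
  rw [carrier, norm_mul, norm_cexp_I_mul, mul_one, Complex.norm_real,
    Real.norm_of_nonneg (by positivity)]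

/-- Turns the cubic and quintic powers of v into t⁻¹ and t⁻² times those of the profile. -/
theorem carrier_mul_star {t : ℝ} (ht : 0 < t) (x : ℝ) :
    carrier β a b t x * star (carrier β a b t x) = ((t⁻¹ : ℝ) : ℂ) := by
  have h : star (carrier β a b t x) = (starRingEnd ℂ) (carrier β a b t x) := rfl
  rw [h, Complex.mul_conj, Complex.normSq_eq_norm_sq, norm_carrier β a b ht, ← Real.rpow_natCast,
    ← Real.rpow_mul ht.le]
  norm_num [Real.rpow_neg_one]

theorem hasDerivAt_carrier_right {t : ℝ} (ht : 0 < t) (x : ℝ) :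
    HasDerivAt (carrier β a b t) (carrier β a b t x *
      (Complex.I / 2 * (x / t : ℝ) + Complex.I * phaseSlope β a b t (x / t))) x := by
  have hx : HasDerivAt (fun x : ℝ => x / t) t⁻¹ x := by
    simpa using (hasDerivAt_id x).div_const t
  have h1 : HasDerivAt (fun x : ℝ => x ^ 2 / (4 * t)) (x / t / 2) x := by
    refine ((hasDerivAt_pow 2 x).div_const (4 * t)).congr_deriv ?_
    field_simp
    push_cast
    ring
  have h2 := h1.add ((hasDerivAt_phase β a b t (x / t)).comp x hx)
  have h3 := ((hasDerivAt_cexp_I_mul _).scomp x h2).const_mul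
    (((t ^ (-(1 / 2) : ℝ) : ℝ) : ℂ))
  refine h3.congr_deriv ?_
  rw [phaseSlope_apply]
  simp only [carrier, Function.comp_apply, Pi.add_apply, Complex.real_smul]
  push_cast
  ring

theorem hasDerivAt_carrier_left {t : ℝ} (ht : 0 < t) (x : ℝ) :
    HasDerivAt (fun s => carrier β a b s x) (carrier β a b t x *
      (-(1 / 2) * (t⁻¹ : ℝ) - Complex.I / 4 * (x / t : ℝ) ^ 2 -
        Complex.I * β * (a (x / t) : ℂ) ^ 2 * (t⁻¹ : ℝ) -
        Complex.I * (x / t : ℝ) * phaseSlope β a b t (x / t))) t := by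
  have h0 : HasDerivAt (fun s : ℝ => s ^ (-(1 / 2) : ℝ)) (t ^ (-(1 / 2) : ℝ) * (-(1 / 2) * t⁻¹)) t := by
    refine (Real.hasDerivAt_rpow_const (Or.inl ht.ne')).congr_deriv ?_
    rw [Real.rpow_sub_one ht.ne']
    ring
  have h1 : HasDerivAt (fun s : ℝ => x ^ 2 / (4 * s)) (-(x / t) ^ 2 / 4) t := by
    have := ((hasDerivAt_inv ht.ne').const_mul (x ^ 2 / 4))
    have h' : (fun s : ℝ => x ^ 2 / (4 * s)) = fun s => x ^ 2 / 4 * s⁻¹ := by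
      ext s; rw [div_mul_eq_div_div, div_eq_mul_inv (x ^ 2 / 4)]
    rw [h']
    refine this.congr_deriv ?_
    field_simp
  have h2 := h1.add (hasDerivAt_phase_along β a b ht x)
  have h3 := h0.ofReal_comp.mul ((hasDerivAt_cexp_I_mul _).scomp t h2)
  refine h3.congr_deriv ?_
  rw [phaseSlope_apply]
  simp only [carrier, Function.comp_apply, Pi.add_apply, Complex.real_smul]
  push_cast
  ring

theorem contDiffOn_modulate {k : ℕ} {g : ℝ → ℝ → ℂ} (hg : g ∈ logClass k) :
    ContDiffOn ℝ ∞ (fun p : ℝ × ℝ => modulate β a b g p.1 p.2) (Ioi 0 ×ˢ univ) := by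
  have ht : ContDiffOn ℝ ∞ (fun p : ℝ × ℝ => p.1) (Ioi 0 ×ˢ univ) := contDiffOn_fst
  have hx : ContDiffOn ℝ ∞ (fun p : ℝ × ℝ => p.2) (Ioi 0 ×ˢ univ) := contDiffOn_snd
  have hne : ∀ p ∈ Ioi (0 : ℝ) ×ˢ (univ : Set ℝ), p.1 ≠ 0 := fun p hp => ne_of_gt hp.1
  have hq : ContDiffOn ℝ ∞ (fun p : ℝ × ℝ => p.2 / p.1) (Ioi 0 ×ˢ univ) := hx.div ht hne
  have hs : ∀ f : 𝓢(ℝ, ℝ), ContDiffOn ℝ ∞ (fun p : ℝ × ℝ => f (p.2 / p.1)) (Ioi 0 ×ˢ univ) :=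
    fun f => (f.smooth ⊤).comp_contDiffOn hq
  have hφ : ContDiffOn ℝ ∞ (fun p : ℝ × ℝ => phase β a b p.1 (p.2 / p.1)) (Ioi 0 ×ˢ univ) := by
    unfold phase
    simp_rw [Real.log_abs]
    exact ((contDiffOn_const.mul ((hs a).pow 2)).mul (ht.log hne)).add (hs b)
  have h4 : ContDiffOn ℝ ∞ (fun p : ℝ × ℝ => p.2 ^ 2 / (4 * p.1)) (Ioi 0 ×ˢ univ) :=
    (hx.pow 2).div (contDiffOn_const.mul ht) fun p hp => mul_ne_zero (by norm_num) (hne p hp)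
  have hr : ContDiffOn ℝ ∞ (fun p : ℝ × ℝ => p.1 ^ (-(1 / 2) : ℝ)) (Ioi 0 ×ˢ univ) :=
    ht.rpow_const_of_ne hne
  have hm : ContDiffOn ℝ ∞ (fun p : ℝ × ℝ => (p.1, p.2 / p.1)) (Ioi 0 ×ˢ univ) := ht.prodMk hq
  exact ((Complex.ofRealCLM.contDiff.comp_contDiffOn hr).mul
    (contDiff_cexp_I_mul.comp_contDiffOn (h4.add hφ))).mul
    ((logClass.contDiffOn hg).comp hm fun p hp => ⟨hp.1, mem_univ _⟩)

/-- The derivative in `x`, on the level of profiles. -/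
theorem hasDerivAt_modulate_right {g g' : ℝ → ℝ → ℂ} {t : ℝ} (ht : 0 < t)
    (hg : ∀ y, HasDerivAt (g t) (g' t y) y) (x : ℝ) :
    HasDerivAt (modulate β a b g t) (modulate β a b ((Complex.I / 2) • (coordY * g) +
      Complex.I • (phaseSlope β a b * g) + tau 0 * g') t x) x := by
  have hx : HasDerivAt (fun x : ℝ => x / t) t⁻¹ x := by
    simpa using (hasDerivAt_id x).div_const t
  have h := (hasDerivAt_carrier_right β a b ht x).mul ((hg (x / t)).scomp x hx)
  refine h.congr_deriv ?_
  simp only [modulate, coordY, tau, Pi.add_apply, Pi.smul_apply, Pi.mul_apply, smul_eq_mul,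
    Function.comp_apply, Complex.real_smul, pow_zero, mul_one]
  ring

/-- Differentiating e^{ix²/4t} in x brings down iy/2, harmless on Schwartz profiles; the other two
terms have an extra t⁻¹. Hence no x-derivative worsens the decay in time. -/
theorem exists_hasDerivAt_modulate {k : ℕ} {g : ℝ → ℝ → ℂ} (hg : g ∈ logClass k) :
    ∃ g' ∈ logClass k, ∀ t, 0 < t → ∀ x,
      HasDerivAt (modulate β a b g t) (modulate β a b g' t x) x := by
  obtain ⟨g', hg', h⟩ := logClass.exists_hasDerivAt_right hg
  refine ⟨_, ?_, fun t ht x => hasDerivAt_modulate_right β a b ht (h t) x⟩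
  exact add_mem (add_mem (Submodule.smul_mem _ _ (logClass.coordY_mul_mem hg))
    (Submodule.smul_mem _ _ (logClass.mul_mem (slope_mem _ _) hg (by omega))))
    (logClass.tau_mul_mem (by norm_num) hg' (by omega))

theorem exists_iteratedDeriv_modulate {k : ℕ} {g : ℝ → ℝ → ℂ} (hg : g ∈ logClass k) :
    ∃ G : ℕ → ℝ → ℝ → ℂ, ∀ j, G j ∈ logClass k ∧ ∀ t, 0 < t →
      iteratedDeriv j (modulate β a b g t) = modulate β a b (G j) t := by
  have h : ∀ j, ∃ h ∈ logClass k, ∀ t, 0 < t →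
      iteratedDeriv j (modulate β a b g t) = modulate β a b h t := by
    intro j
    induction j with
    | zero => exact ⟨g, hg, fun t _ => iteratedDeriv_zero⟩
    | succ j ih =>
      obtain ⟨h, hh, hd⟩ := ih
      obtain ⟨h', hh', hd'⟩ := exists_hasDerivAt_modulate β a b hh
      refine ⟨h', hh', fun t ht => ?_⟩
      rw [iteratedDeriv_succ, hd t ht]
      ext x
      exact (hd' t ht x).deriv
  choose G hG hG' using h
  exact ⟨G, fun j => ⟨hG j, hG' j⟩⟩

theorem contDiff_modulate {k : ℕ} {g : ℝ → ℝ → ℂ} (hg : g ∈ logClass k) {t : ℝ} (ht : 0 < t) :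
    ContDiff ℝ ∞ (modulate β a b g t) := by
  have h : ContDiff ℝ ∞ fun x : ℝ => (t, x) := contDiff_prodMk_right t
  exact contDiffOn_univ.1 ((contDiffOn_modulate β a b hg).comp h.contDiffOn fun x _ =>
    (⟨ht, mem_univ _⟩ : (t, x) ∈ Ioi (0 : ℝ) ×ˢ univ))

/-- Chain rule along s ↦ (s, x/s): joint smoothness supplies a total derivative, whose two
components are identified with the derivatives stored in the jet. -/
theorem Jet.hasDerivAt_modulate_left (J : Jet 0) {t : ℝ} (ht : 0 < t) (x : ℝ) :
    HasDerivAt (fun s => modulate β a b J.val s x) (carrier β a b t x *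
      ((-(1 / 2) * (t⁻¹ : ℝ) - Complex.I / 4 * (x / t : ℝ) ^ 2 -
        Complex.I * β * (a (x / t) : ℂ) ^ 2 * (t⁻¹ : ℝ) -
        Complex.I * (x / t : ℝ) * phaseSlope β a b t (x / t)) * J.val t (x / t) +
        ((t⁻¹ : ℝ) * J.dθ t (x / t) - (t⁻¹ : ℝ) * (x / t : ℝ) * J.dy t (x / t)))) t := by
  have hx : HasDerivAt (fun s : ℝ => x / s) (-(x / t) * t⁻¹) t := by
    have := (hasDerivAt_inv ht.ne').const_mul x
    refine this.congr_deriv ?_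
    field_simp
  have hmem : ((t, x / t) : ℝ × ℝ) ∈ Ioi (0 : ℝ) ×ˢ (univ : Set ℝ) := ⟨ht, mem_univ _⟩
  have hd : DifferentiableAt ℝ (fun p : ℝ × ℝ => J.val p.1 p.2) (t, x / t) :=
    ((logClass.contDiffOn J.val_mem).contDiffAt ((isOpen_Ioi.prod isOpen_univ).mem_nhds hmem)).differentiableAt (by simp)
  obtain ⟨L, hL⟩ := hd
  have h1 : L (1, 0) = (t⁻¹ : ℝ) * J.dθ t (x / t) := by
    refine (HasFDerivAt.comp_hasDerivAt (f := fun s : ℝ => (s, x / t)) t hL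
      ((hasDerivAt_id t).prodMk (hasDerivAt_const t (x / t)))).unique (J.hasDerivAt_dθ t ht (x / t))
  have h2 : L (0, 1) = J.dy t (x / t) :=
    (HasFDerivAt.comp_hasDerivAt (f := fun y : ℝ => (t, y)) (x / t) hL
      ((hasDerivAt_const (x / t) t).prodMk (hasDerivAt_id (x / t)))).unique
      (J.hasDerivAt_dy t (x / t))
  have h3 : HasDerivAt (fun s => J.val s (x / s))
      ((t⁻¹ : ℝ) * J.dθ t (x / t) - (t⁻¹ : ℝ) * (x / t : ℝ) * J.dy t (x / t)) t := by
    refine (HasFDerivAt.comp_hasDerivAt (f := fun s : ℝ => (s, x / s)) t hL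
      ((hasDerivAt_id t).prodMk hx)).congr_deriv ?_
    have h4 : ((1 : ℝ), -(x / t) * t⁻¹) = (1, 0) + (-(x / t) * t⁻¹) • ((0 : ℝ), (1 : ℝ)) := by
      simp
    rw [h4, map_add, map_smul, h1, h2, Complex.real_smul]
    push_cast
    ring
  refine ((hasDerivAt_carrier_left β a b ht x).mul h3).congr_deriv ?_
  ring

/-- The residual of the profile equation is the residual of the Schrödinger equation. -/
theorem modulate_residual (γ : ℝ) (J : Jet 0) {t : ℝ} (ht : 0 < t) (x : ℝ) :
    HasDerivAt (fun s => modulate β a b J.val s x)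
      (Complex.I * iteratedDeriv 2 (modulate β a b J.val t) x - Complex.I *
      ((β : ℂ) * (modulate β a b J.val t x *
          (star (modulate β a b J.val t x) * modulate β a b J.val t x)) +
        (γ : ℂ) * (modulate β a b J.val t x * (star (modulate β a b J.val t x) *
          (modulate β a b J.val t x *
          (star (modulate β a b J.val t x) * modulate β a b J.val t x)))) +
        modulate β a b (tau 0 * residual β γ (logMonomial 0 0 (complexS a)) (phaseSlope β a b)
          (slope (derivS (slopeLog β a)) (derivS (complexS (derivR b))))
          (slopeSq (slopeLog β a) (complexS (derivR b))) J) t x)) t := by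
  have hy : ∀ y, HasDerivAt (coordY t) 1 y := fun y => (hasDerivAt_id y).ofReal_comp
  have hΦ := hasDerivAt_slope (slopeLog β a) (complexS (derivR b)) t
  have h1 : deriv (modulate β a b J.val t) = modulate β a b ((Complex.I / 2) • (coordY * J.val) +
      Complex.I • (phaseSlope β a b * J.val) + tau 0 * J.dy) t :=
    funext fun x => (hasDerivAt_modulate_right β a b ht (J.hasDerivAt_dy t) x).deriv
  have h2 := (hasDerivAt_modulate_right β a b (g := (Complex.I / 2) • (coordY * J.val) +
      Complex.I • (phaseSlope β a b * J.val) + tau 0 * J.dy)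
      (g' := (Complex.I / 2) • (1 * J.val + coordY * J.dy) +
      Complex.I • ((slope (derivS (slopeLog β a)) (derivS (complexS (derivR b)))) * J.val +
        phaseSlope β a b * J.dy) + tau 0 * J.dyy) ht (fun y =>
        ((((hy y).mul (J.hasDerivAt_dy t y)).const_smul (Complex.I / 2)).add
        (((hΦ y).mul (J.hasDerivAt_dy t y)).const_smul Complex.I)).add
        ((J.hasDerivAt_dyy t y).const_mul _)) x).deriv
  refine (J.hasDerivAt_modulate_left β a b ht x).congr_deriv ?_
  rw [iteratedDeriv_succ, iteratedDeriv_one, h1, h2]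
  have hsq := congrFun (congrFun (tau_mul_slopeSq (slopeLog β a) (complexS (derivR b))) t) (x / t)
  have hc := carrier_mul_star β a b ht x
  simp only [modulate, residual, lowerOrder, tau, coordY, logMonomial, complexS_apply, Pi.add_apply,
    Pi.smul_apply, Pi.mul_apply, Pi.sub_apply, Pi.star_apply, smul_eq_mul,
    star_mul', pow_zero, mul_one, Complex.ofReal_one, one_mul,
    phaseSlope] at hsq hc ⊢
  -- What remains is a polynomial identity modulo E Ē = t⁻¹, t⁻¹Ψ = Φ² and i² = -1.
  generalize carrier β a b t x = E at *
  generalize star E = E' at *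
  generalize ((x / t : ℝ) : ℂ) = y at *
  generalize slope (slopeLog β a) (complexS (derivR b)) t (x / t) = Φ at *
  generalize slope (derivS (slopeLog β a)) (derivS (complexS (derivR b))) t (x / t) = Φ' at *
  generalize slopeSq (slopeLog β a) (complexS (derivR b)) t (x / t) = Ψ at *
  generalize J.val t (x / t) = u at *
  generalize star u = v at *
  generalize ((t⁻¹ : ℝ) : ℂ) = τ at *
  generalize J.dθ t (x / t) = uθ at *
  generalize J.dy t (x / t) = uy at *
  generalize J.dyy t (x / t) = uyy at *
  generalize (a (x / t) : ℂ) = A at *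
  linear_combination (Complex.I * β * E * u ^ 2 * v + Complex.I * γ * E * u ^ 3 * v ^ 2 *
    (E * E' + τ)) * hc - Complex.I * E * u * hsq + (E * τ * uθ - Complex.I / 4 * E * y ^ 2 * u -
    Complex.I * E * y * Φ * u - Complex.I * E * Φ ^ 2 * u - E * (y * τ * uy + τ * u / 2)) *
    Complex.I_sq

end Carrier

/-! ### Norms and continuity of modulated profiles -/

/-- The rate `t^(-1) (1 + ln t)^2`. -/
def logRate (t : ℝ) : ℝ := t⁻¹ * (1 + Real.log t) ^ 2

theorem logRate_nonneg {t : ℝ} (ht : 1 ≤ t) : 0 ≤ logRate t := by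
  have : 0 < t := by linarith
  unfold logRate; positivity

theorem logRate_le_four {t : ℝ} (ht : 1 ≤ t) : logRate t ≤ 4 := logClass.inv_mul_log_sq_le ht

/-- An `L²` bound from a pointwise bound by a rescaled Lorentzian. -/
theorem eLpNorm_two_le_of_norm_le {f : ℝ → ℂ} {D t : ℝ} (hD : 0 ≤ D) (ht : 0 < t)
    (hf : ∀ x, ‖f x‖ ≤ D * t ^ (-(1 / 2) : ℝ) * (1 + (x / t) ^ 2)⁻¹) :
    eLpNorm f 2 ≤ ENNReal.ofReal (2 * D) := by
  have hint : Integrable fun x : ℝ => D ^ 2 * t⁻¹ * (1 + (x / t) ^ 2)⁻¹ :=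
    (integrable_inv_one_add_sq.comp_div ht.ne').const_mul _
  have hval : ∫ x : ℝ, D ^ 2 * t⁻¹ * (1 + (x / t) ^ 2)⁻¹ ≤ (2 * D) ^ 2 := by
    rw [integral_const_mul, Measure.integral_comp_div (fun x : ℝ => (1 + x ^ 2)⁻¹) t,
      integral_univ_inv_one_add_sq, abs_of_pos ht, smul_eq_mul]
    -- The carrier's t⁻¹ compensates the width t of the wave, so the L² norm is bounded in time; π ≤
    -- 4 gives the constant 2D.
    calc D ^ 2 * t⁻¹ * (t * Real.pi) = D ^ 2 * Real.pi := by field_simp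
      _ ≤ D ^ 2 * 4 := by gcongr; exact Real.pi_le_four
      _ = _ := by ring
  have hpt : ∀ x, ‖f x‖ₑ ^ (2 : ℝ) ≤ ENNReal.ofReal (D ^ 2 * t⁻¹ * (1 + (x / t) ^ 2)⁻¹) := by
    intro x
    have h0 : 0 < (1 + (x / t) ^ 2)⁻¹ := by positivity
    have h1 : (1 + (x / t) ^ 2)⁻¹ ≤ 1 := inv_le_one_of_one_le₀ (by nlinarith [sq_nonneg (x / t)])
    have h2 : (t ^ (-(1 / 2) : ℝ)) ^ 2 = t⁻¹ := by
      rw [← Real.rpow_natCast, ← Real.rpow_mul ht.le]; norm_num [Real.rpow_neg_one]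
    rw [← ofReal_norm, ENNReal.ofReal_rpow_of_nonneg (norm_nonneg _) (by norm_num)]
    refine ENNReal.ofReal_le_ofReal ?_
    rw [Real.rpow_two]
    calc ‖f x‖ ^ 2 ≤ (D * t ^ (-(1 / 2) : ℝ) * (1 + (x / t) ^ 2)⁻¹) ^ 2 := by
          gcongr; exact hf x
      _ = D ^ 2 * t⁻¹ * ((1 + (x / t) ^ 2)⁻¹ * (1 + (x / t) ^ 2)⁻¹) := by
          rw [mul_pow, mul_pow, h2]; ring
      _ ≤ D ^ 2 * t⁻¹ * ((1 + (x / t) ^ 2)⁻¹ * 1) := by gcongr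
      _ = _ := by ring
  rw [eLpNorm_eq_lintegral_rpow_enorm_toReal (by norm_num) (by norm_num), ENNReal.toReal_ofNat,
    show ENNReal.ofReal (2 * D) = (ENNReal.ofReal ((2 * D) ^ 2)) ^ (1 / (2 : ℝ)) by
      rw [ENNReal.ofReal_rpow_of_nonneg (by positivity) (by norm_num), ← Real.sqrt_eq_rpow,
        Real.sqrt_sq (by positivity)]]
  refine ENNReal.rpow_le_rpow ?_ (by norm_num)
  calc ∫⁻ x, ‖f x‖ₑ ^ (2 : ℝ) ≤ ∫⁻ x, ENNReal.ofReal (D ^ 2 * t⁻¹ * (1 + (x / t) ^ 2)⁻¹) :=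
        lintegral_mono hpt
    _ = ENNReal.ofReal (∫ x : ℝ, D ^ 2 * t⁻¹ * (1 + (x / t) ^ 2)⁻¹) := by
        rw [ofReal_integral_eq_lintegral_ofReal hint (ae_of_all _ fun x => by
          simp only [Pi.zero_apply]; positivity)]
    _ ≤ _ := ENNReal.ofReal_le_ofReal hval

section Modulate
variable (β : ℝ) (a b : 𝓢(ℝ, ℝ)) {k : ℕ} {g : ℝ → ℝ → ℂ}

theorem exists_norm_modulate_le (hg : g ∈ logClass k) : ∃ C : ℝ≥0, ∀ t, 1 ≤ t → ∀ x,
    ‖modulate β a b g t x‖ ≤ C * logRate t ^ k * t ^ (-(1 / 2) : ℝ) * (1 + (x / t) ^ 2)⁻¹ := by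
  obtain ⟨C, hC, h⟩ := logClass.exists_norm_le hg
  lift C to ℝ≥0 using hC
  refine ⟨C, fun t ht x => ?_⟩
  have ht0 : 0 < t := by linarith
  rw [modulate, norm_mul, norm_carrier β a b ht0]
  calc _ ≤ t ^ (-(1 / 2) : ℝ) * (C * logRate t ^ k * (1 + (x / t) ^ 2)⁻¹) := by
        gcongr; exact h t ht (x / t)
    _ = _ := by ring

theorem exists_eLpNorm_modulate_le (hg : g ∈ logClass k) : ∃ C : ℝ≥0, ∀ t, 1 ≤ t →
    eLpNorm (modulate β a b g t) 2 ≤ C * ENNReal.ofReal (logRate t ^ k) ∧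
    eLpNorm (modulate β a b g t) ∞ ≤ C * ENNReal.ofReal (logRate t ^ k * t ^ (-(1 / 2) : ℝ)) := by
  obtain ⟨C, h⟩ := exists_norm_modulate_le β a b hg
  refine ⟨2 * C, fun t ht => ?_⟩
  have ht0 : 0 < t := by linarith
  have hr := logRate_nonneg ht
  constructor
  · refine (eLpNorm_two_le_of_norm_le (by positivity) ht0 (h t ht)).trans_eq ?_
    rw [← ENNReal.ofReal_coe_nnreal, ← ENNReal.ofReal_mul (by positivity)]
    push_cast
    ring_nf
  · rw [eLpNorm_exponent_top]
    refine eLpNormEssSup_le_of_ae_enorm_bound (ae_of_all _ fun x => ?_)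
    rw [← ofReal_norm, ← ENNReal.ofReal_coe_nnreal, ← ENNReal.ofReal_mul (by positivity)]
    refine ENNReal.ofReal_le_ofReal ((h t ht x).trans ?_)
    have h1 : (1 + (x / t) ^ 2)⁻¹ ≤ 1 := inv_le_one_of_one_le₀ (by nlinarith [sq_nonneg (x / t)])
    push_cast
    calc _ ≤ C * logRate t ^ k * t ^ (-(1 / 2) : ℝ) * 1 := by gcongr
      _ ≤ 2 * (C * logRate t ^ k * t ^ (-(1 / 2) : ℝ)) := by
        have : 0 ≤ C * logRate t ^ k * t ^ (-(1 / 2) : ℝ) := by positivity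
        linarith
      _ = _ := by ring

/-- Dominated convergence in x: for s ≤ t + 1 all the Lorentzian bounds lie under the one of width t
+ 1. -/
theorem tendsto_eLpNorm_modulate_sub (hg : g ∈ logClass k) {t : ℝ} (ht : 1 ≤ t) :
    Tendsto (fun s => eLpNorm (modulate β a b g s - modulate β a b g t) 2) (𝓝[Ici 1] t) (𝓝 0) := by
  obtain ⟨C, hC⟩ := exists_norm_modulate_le β a b hg
  have ht0 : 0 < t := by linarith
  set h : ℝ → ℝ := fun x => (2 * (C * 4 ^ k)) ^ 2 * (1 + (x / (t + 1)) ^ 2)⁻¹ with hh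
  have hint : Integrable h := (integrable_inv_one_add_sq.comp_div (by positivity)).const_mul _
  have hnear : ∀ᶠ s in 𝓝[Ici 1] t, 1 ≤ s ∧ s ≤ t + 1 :=
    (eventually_mem_nhdsWithin).and (mem_nhdsWithin_of_mem_nhds (Iic_mem_nhds (by linarith)))
  have hb : ∀ s, 1 ≤ s → s ≤ t + 1 → ∀ x, ‖modulate β a b g s x‖ ≤
      C * 4 ^ k * (1 + (x / (t + 1)) ^ 2)⁻¹ := by
    intro s hs hst x
    have hs0 : 0 < s := by linarith
    have h1 : s ^ (-(1 / 2) : ℝ) ≤ 1 := Real.rpow_le_one_of_one_le_of_nonpos hs (by norm_num)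
    have h2 : (x / (t + 1)) ^ 2 ≤ (x / s) ^ 2 := by
      rw [div_pow, div_pow]; gcongr
    have h3 := logRate_nonneg hs
    calc _ ≤ _ := hC s hs x
      _ ≤ C * 4 ^ k * 1 * (1 + (x / (t + 1)) ^ 2)⁻¹ := by
        gcongr; exact logRate_le_four hs
      _ = _ := by ring
  have hlim := tendsto_lintegral_filter_of_dominated_convergence (μ := volume) (l := 𝓝[Ici 1] t)
    (F := fun s x => ‖(modulate β a b g s - modulate β a b g t) x‖ₑ ^ (2 : ℝ)) (f := fun _ => 0)
    (fun x => ENNReal.ofReal (h x)) ?_ ?_ ?_ ?_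
  · simp only [lintegral_const, zero_mul] at hlim
    have h2 := (ENNReal.continuous_rpow_const (y := 1 / 2)).tendsto 0 |>.comp hlim
    simp only [ENNReal.zero_rpow_of_pos (show (0 : ℝ) < 1 / 2 by norm_num)] at h2
    refine h2.congr fun s => ?_
    rw [eLpNorm_eq_lintegral_rpow_enorm_toReal (by norm_num) (by norm_num)]
    simp
  · filter_upwards [hnear] with s hs
    have c1 := (contDiff_modulate β a b hg (t := s) (by linarith)).continuous
    have c2 := (contDiff_modulate β a b hg ht0).continuous
    exact ((c1.sub c2).measurable.enorm.pow_const _)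
  · filter_upwards [hnear] with s hs
    refine ae_of_all _ fun x => ?_
    have h0 : 0 < (1 + (x / (t + 1)) ^ 2)⁻¹ := by positivity
    have h1 : (1 + (x / (t + 1)) ^ 2)⁻¹ ≤ 1 :=
      inv_le_one_of_one_le₀ (by nlinarith [sq_nonneg (x / (t + 1))])
    rw [← ofReal_norm, ENNReal.ofReal_rpow_of_nonneg (norm_nonneg _) (by norm_num)]
    refine ENNReal.ofReal_le_ofReal ?_
    rw [Real.rpow_two]
    calc _ ≤ ((C : ℝ) * 4 ^ k * (1 + (x / (t + 1)) ^ 2)⁻¹ +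
            C * 4 ^ k * (1 + (x / (t + 1)) ^ 2)⁻¹) ^ 2 := by
          gcongr
          exact (norm_sub_le _ _).trans (add_le_add (hb s hs.1 hs.2 x) (hb t ht (by linarith) x))
      _ = (2 * ((C : ℝ) * 4 ^ k)) ^ 2 * ((1 + (x / (t + 1)) ^ 2)⁻¹ * (1 + (x / (t + 1)) ^ 2)⁻¹) := by
          ring
      _ ≤ (2 * ((C : ℝ) * 4 ^ k)) ^ 2 * ((1 + (x / (t + 1)) ^ 2)⁻¹ * 1) := by gcongr
      _ = _ := by rw [mul_one]
  · rw [← ofReal_integral_eq_lintegral_ofReal hint (ae_of_all _ fun x => by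
      simp only [hh, Pi.zero_apply]; positivity)]
    exact ENNReal.ofReal_ne_top
  · refine ae_of_all _ fun x => ?_
    have hm : ContinuousWithinAt (fun s => modulate β a b g s x) (Ici 1) t := by
      have h1 := (contDiffOn_modulate β a b hg).continuousOn
      exact (h1.comp (f := fun s : ℝ => (s, x)) (s := Ici 1) (by fun_prop)
        fun s (hs : 1 ≤ s) => ⟨show 0 < s by linarith, mem_univ _⟩) t ht
    have h2 : Tendsto (fun s => modulate β a b g s x - modulate β a b g t x) (𝓝[Ici 1] t) (𝓝 0) := by
      simpa using hm.tendsto.sub_const (modulate β a b g t x)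
    have h3 := ((ENNReal.continuous_rpow_const (y := 2)).comp
      (continuous_enorm (E := ℂ))).tendsto 0 |>.comp h2
    simpa [Function.comp_def] using h3

theorem exists_schwartz_modulate (hg : g ∈ logClass k) {t : ℝ} (ht : 1 ≤ t) :
    ∃ f : 𝓢(ℝ, ℂ), ⇑f = modulate β a b g t := by
  have ht0 : 0 < t := by linarith
  obtain ⟨G, hG⟩ := exists_iteratedDeriv_modulate β a b hg
  refine ⟨⟨modulate β a b g t, contDiff_modulate β a b hg ht0, fun m n => ?_⟩, rfl⟩
  have hmem : ∀ m : ℕ, coordY ^ m * G n ∈ logClass k := by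
    intro m
    induction m with
    | zero => simpa using (hG n).1
    | succ m ih => rw [pow_succ', mul_assoc]; exact logClass.coordY_mul_mem ih
  obtain ⟨C, hC⟩ := exists_norm_modulate_le β a b (hmem m)
  have hr := logRate_nonneg ht
  refine ⟨t ^ m * (C * logRate t ^ k * t ^ (-(1 / 2) : ℝ)), fun x => ?_⟩
  have h1 : (1 + (x / t) ^ 2)⁻¹ ≤ 1 := inv_le_one_of_one_le₀ (by nlinarith [sq_nonneg (x / t)])
  rw [norm_iteratedFDeriv_eq_norm_iteratedDeriv, (hG n).2 t ht0]
  -- Powers of x = ty are moved onto the profile, where multiplication by y preserves the class.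
  have h2 : ‖x‖ ^ m * ‖modulate β a b (G n) t x‖ =
      t ^ m * ‖modulate β a b (coordY ^ m * G n) t x‖ := by
    have h3 : x = t * (x / t) := by field_simp
    simp only [modulate, coordY, Pi.mul_apply, Pi.pow_apply, norm_mul, norm_pow, Complex.norm_real]
    have h4 : ‖x‖ = t * ‖x / t‖ := by
      conv_lhs => rw [h3]
      rw [norm_mul, Real.norm_of_nonneg ht0.le]
    rw [h4, mul_pow]
    ring
  rw [h2]
  gcongr
  calc _ ≤ _ := hC t ht x
    _ ≤ C * logRate t ^ k * t ^ (-(1 / 2) : ℝ) * 1 := by gcongr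
    _ = _ := mul_one _

end Modulate

theorem tsum_weight_mul_le {c : DerivWeight} {B : ℕ → ℝ≥0}
    (hc : ∀ j, j ≠ 0 → c j * B j ≤ (1 / 2) ^ j) :
    ∑' j, ((c j * B j : ℝ≥0) : ℝ≥0∞) ≤ (B 0 + 1 : ℝ≥0) := by
  rw [tsum_eq_zero_add' ENNReal.summable, c.zero_eq_one, one_mul, ENNReal.coe_add]
  refine add_le_add le_rfl ?_
  calc ∑' j, ((c (j + 1) * B (j + 1) : ℝ≥0) : ℝ≥0∞) ≤ ∑' j : ℕ, (2⁻¹ : ℝ≥0∞) ^ (j + 1) := by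
        refine ENNReal.tsum_le_tsum fun j => ?_
        have := ENNReal.coe_le_coe.2 (hc (j + 1) (Nat.succ_ne_zero j))
        refine this.trans_eq ?_
        rw [ENNReal.coe_pow, one_div, ENNReal.coe_inv two_ne_zero, ENNReal.coe_ofNat]
    _ = 1 := by
        rw [ENNReal.tsum_geometric_add_one, ENNReal.one_sub_inv_two, inv_inv]
        exact ENNReal.inv_mul_cancel (by norm_num) (by norm_num)
    _ = _ := by simp

/-- The terms j ≥ 1 sum to at most 1, so the constant sees only `B 0` and not the weights. -/
theorem wnorm_le_of_baseNorm_le {p : ℝ≥0∞} {c : DerivWeight} {B : ℕ → ℝ≥0}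
    (hc : ∀ j, j ≠ 0 → c j * B j ≤ (1 / 2) ^ j) {f : ℝ → ℂ} {R : ℝ≥0∞}
    (hf : ∀ j, baseNorm p (iteratedDeriv j f) ≤ B j * R) :
    wnorm p c f ≤ (B 0 + 1 : ℝ≥0) * R := by
  calc wnorm p c f ≤ ∑' j, ((c j * B j : ℝ≥0) : ℝ≥0∞) * R := by
        refine ENNReal.tsum_le_tsum fun j => ?_
        rw [ENNReal.coe_mul, mul_assoc]
        exact mul_le_mul' le_rfl (hf j)
    _ = (∑' j, ((c j * B j : ℝ≥0) : ℝ≥0∞)) * R := ENNReal.tsum_mul_right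
    _ ≤ _ := mul_le_mul' (tsum_weight_mul_le hc) le_rfl

/-- The curves in the energy space given by modulated profiles. -/
structure IsModulatedCurve (β : ℝ) (a b : 𝓢(ℝ, ℝ)) (k : ℕ) (g : ℝ → ℝ → ℂ) (K : ℝ)
    {c : DerivWeight} (G : ℝ → EnergySpace c) : Prop where
  coe_eq : ∀ t, 1 ≤ t → (G t : ℝ → ℂ) = modulate β a b g t
  continuousOn : ContinuousOn G (Ici 1)
  norm_le : ∀ t, 1 ≤ t → ‖G t‖ ≤ K * logRate t ^ k
  mulBound : ∀ t, 1 ≤ t → EnergySpace.MulBound (G t) (K * logRate t ^ k * t ^ (-(1 / 2) : ℝ))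

/-- The order of quantifiers matters: `K` is fixed before the weights, so M and the order of the
expansion may depend on it while the weights are adapted later to all profiles in use. -/
theorem exists_isModulatedCurve (β : ℝ) (a b : 𝓢(ℝ, ℝ)) {k : ℕ} {g : ℝ → ℝ → ℂ}
    (hg : g ∈ logClass k) : ∃ (K : ℝ) (B : ℕ → ℝ≥0), 0 ≤ K ∧ ∀ c : DerivWeight,
      (∀ j, j ≠ 0 → c j * B j ≤ (1 / 2) ^ j) → ∃ G : ℝ → EnergySpace c,
        IsModulatedCurve β a b k g K G := by
  obtain ⟨F, hF⟩ := exists_iteratedDeriv_modulate β a b hg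
  have hex := fun j => exists_eLpNorm_modulate_le β a b (hF j).1
  choose C hC using hex
  -- `baseNorm` of the j-th derivative involves the orders j and j + 1; `K` is `B 0 + 1`.
  refine ⟨(C 0 + C 1 + 1 : ℝ≥0), fun j => C j + C (j + 1), by positivity, fun c hc => ?_⟩
  have hsucc : ∀ t, 1 ≤ t → ∀ j, deriv (modulate β a b (F j) t) = modulate β a b (F (j + 1)) t := by
    intro t ht j
    rw [← (hF j).2 t (by linarith), ← iteratedDeriv_succ, (hF (j + 1)).2 t (by linarith)]
  have hbase2 : ∀ t, 1 ≤ t → ∀ j, baseNorm 2 (iteratedDeriv j (modulate β a b g t)) ≤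
      (C j + C (j + 1) : ℝ≥0) * ENNReal.ofReal (logRate t ^ k) := by
    intro t ht j
    rw [(hF j).2 t (by linarith), baseNorm, hsucc t ht, ENNReal.coe_add, add_mul]
    exact add_le_add (hC j t ht).1 (hC (j + 1) t ht).1
  have hbaseT : ∀ t, 1 ≤ t → ∀ j, baseNorm ∞ (iteratedDeriv j (modulate β a b g t)) ≤
      (C j + C (j + 1) : ℝ≥0) * ENNReal.ofReal (logRate t ^ k * t ^ (-(1 / 2) : ℝ)) := by
    intro t ht j
    rw [(hF j).2 t (by linarith), baseNorm, hsucc t ht, ENNReal.coe_add, add_mul]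
    exact add_le_add (hC j t ht).2 (hC (j + 1) t ht).2
  have hw2 := fun t ht => wnorm_le_of_baseNorm_le hc (hbase2 t ht)
  have hwT := fun t ht => wnorm_le_of_baseNorm_le hc (hbaseT t ht)
  have hmem : ∀ t, 1 ≤ t → ∃ f : EnergySpace c, (f : ℝ → ℂ) = modulate β a b g t := by
    intro t ht
    obtain ⟨f, hf⟩ := exists_schwartz_modulate β a b hg ht
    refine ⟨EnergySpace.ofSchwartz f ?_, hf⟩
    rw [hf]
    exact ne_top_of_le_ne_top (ENNReal.mul_ne_top ENNReal.coe_ne_top ENNReal.ofReal_ne_top) (hw2 t ht)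
  have hex : ∃ G : ℝ → EnergySpace c, ∀ t, 1 ≤ t → (G t : ℝ → ℂ) = modulate β a b g t := by
    classical
    refine ⟨fun t => if ht : 1 ≤ t then (hmem t ht).choose else 0, fun t ht => ?_⟩
    simp only [ht, dif_pos]
    exact (hmem t ht).choose_spec
  obtain ⟨G, hG⟩ := hex
  refine ⟨G, hG, ?_, fun t ht => ?_, fun t ht => ?_⟩
  · intro t ht
    have ht : 1 ≤ t := ht
    rw [ContinuousWithinAt, tendsto_iff_norm_sub_tendsto_zero]
    have hcongr : ∀ᶠ s in 𝓝[Ici 1] t, (∑' j, (c j : ℝ≥0∞) *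
        (eLpNorm (modulate β a b (F j) s - modulate β a b (F j) t) 2 +
        eLpNorm (modulate β a b (F (j + 1)) s - modulate β a b (F (j + 1)) t) 2)).toReal =
        ‖G s - G t‖ := by
      filter_upwards [eventually_mem_nhdsWithin] with s (hs : 1 ≤ s)
      have hs0 : 0 < s := by linarith
      have ht0 : 0 < t := by linarith
      rw [EnergySpace.norm_def, EnergySpace.coe_sub, hG s hs, hG t ht, wnorm]
      have hj : ∀ j, iteratedDeriv j (modulate β a b g s - modulate β a b g t) =
          modulate β a b (F j) s - modulate β a b (F j) t := fun j => by
        ext x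
        rw [iteratedDeriv_sub_eq (contDiff_modulate β a b hg hs0) (contDiff_modulate β a b hg ht0),
          (hF j).2 s hs0, (hF j).2 t ht0]
      congr 2
      ext1 j
      rw [baseNorm, ← iteratedDeriv_succ, hj, hj]
    refine Tendsto.congr' hcongr ?_
    -- Dominated convergence over j; the weights make the majorant summable, and each term tends to
    -- 0 by continuity in L².
    have h := tendsto_lintegral_filter_of_dominated_convergence (μ := Measure.count (α := ℕ))
      (l := 𝓝[Ici 1] t)
      (F := fun s j => (c j : ℝ≥0∞) *
        (eLpNorm (modulate β a b (F j) s - modulate β a b (F j) t) 2 +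
        eLpNorm (modulate β a b (F (j + 1)) s - modulate β a b (F (j + 1)) t) 2)) (f := fun _ => 0)
      (fun j => (c j * (C j + C (j + 1)) : ℝ≥0) * (2 * ENNReal.ofReal (4 ^ k)))
      (Eventually.of_forall fun s => .of_discrete) ?_ ?_ (ae_of_all _ fun j => ?_)
    · simp only [lintegral_count, tsum_zero] at h
      exact (ENNReal.tendsto_toReal ENNReal.zero_ne_top).comp h
    · filter_upwards [eventually_mem_nhdsWithin] with s (hs : 1 ≤ s)
      refine ae_of_all _ fun j => ?_
      have hd : ∀ j, eLpNorm (modulate β a b (F j) s - modulate β a b (F j) t) 2 ≤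
          C j * (2 * ENNReal.ofReal (4 ^ k)) := by
        intro j
        have c1 := (contDiff_modulate β a b (hF j).1 (t := s) (by linarith)).continuous
        have c2 := (contDiff_modulate β a b (hF j).1 (t := t) (by linarith)).continuous
        have hr : ∀ s, 1 ≤ s → eLpNorm (modulate β a b (F j) s) 2 ≤
            C j * ENNReal.ofReal (4 ^ k) := fun s hs => (hC j s hs).1.trans
          (mul_le_mul' le_rfl (ENNReal.ofReal_le_ofReal
            (pow_le_pow_left₀ (logRate_nonneg hs) (logRate_le_four hs) k)))
        refine (eLpNorm_sub_le c1.aestronglyMeasurable c2.aestronglyMeasurable one_le_two).trans ?_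
        refine (add_le_add (hr s hs) (hr t ht)).trans_eq ?_
        ring
      rw [ENNReal.coe_mul, mul_assoc, ENNReal.coe_add, add_mul]
      exact mul_le_mul' le_rfl (add_le_add (hd j) (hd (j + 1)))
    · rw [lintegral_count, ENNReal.tsum_mul_right]
      refine ENNReal.mul_ne_top ?_ (ENNReal.mul_ne_top (by norm_num) ENNReal.ofReal_ne_top)
      exact ne_top_of_le_ne_top ENNReal.coe_ne_top (tsum_weight_mul_le hc)
    · have h1 := (tendsto_eLpNorm_modulate_sub β a b (hF j).1 ht).add
        (tendsto_eLpNorm_modulate_sub β a b (hF (j + 1)).1 ht)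
      simpa using ENNReal.Tendsto.const_mul (a := (c j : ℝ≥0∞)) h1 (Or.inr ENNReal.coe_ne_top)
  · have hr := logRate_nonneg ht
    have h := hw2 t ht
    rw [← hG t ht, ← EnergySpace.ofReal_norm, ← ENNReal.ofReal_coe_nnreal,
      ← ENNReal.ofReal_mul (by positivity)] at h
    exact (ENNReal.ofReal_le_ofReal_iff (by positivity)).1 h
  · have hr := logRate_nonneg ht
    have ht0 : 0 < t := by linarith
    have h := hwT t ht
    rw [← hG t ht, ← ENNReal.ofReal_coe_nnreal, ← ENNReal.ofReal_mul (by positivity),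
      ← mul_assoc] at h
    exact fun f => EnergySpace.norm_mul_le_of_wnorm_top_le _ f (by positivity) h

theorem IsModulatedCurve.spatiallySmooth {β : ℝ} {a b : 𝓢(ℝ, ℝ)} {k : ℕ} {g : ℝ → ℝ → ℂ} {K : ℝ}
    {c : DerivWeight} {G : ℝ → EnergySpace c} (hG : IsModulatedCurve β a b k g K G)
    (hg : g ∈ logClass k) {T : ℝ} (hT : 1 ≤ T) (n : ℕ) : SpatiallySmooth n T (fun t => G t) := by
  obtain ⟨F, hF⟩ := exists_iteratedDeriv_modulate β a b hg
  intro j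
  have h1 := (contDiffOn_modulate β a b (hF j).1).mono
    (prod_mono (Ioi_subset_Ioi (show (0 : ℝ) ≤ T by linarith)) (Subset.refl univ))
  refine (h1.of_le (by exact_mod_cast le_top)).congr fun p hp => ?_
  have hp1 : T < p.1 := hp.1
  show iteratedDeriv j (G p.1) p.2 = _
  rw [hG.coe_eq p.1 (by linarith), (hF j).2 p.1 (by linarith)]

/-! ### The correction to the approximate solution and the conclusion -/

theorem eventually_logRate_le : ∀ᶠ t in atTop, logRate t ≤ t ^ (-(1 / 2) : ℝ) := by
  have h : Tendsto (fun t : ℝ => (1 + Real.log t) / t ^ (1 / 4 : ℝ)) atTop (𝓝 0) := by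
    have h1 := (isLittleO_log_rpow_atTop (show (0 : ℝ) < 1 / 4 by norm_num)).tendsto_div_nhds_zero
    have h2 := tendsto_inv_atTop_zero.comp (tendsto_rpow_atTop (show (0 : ℝ) < 1 / 4 by norm_num))
    have := h2.add h1
    rw [add_zero] at this
    refine this.congr fun t => ?_
    simp only [Function.comp_apply]
    ring
  filter_upwards [h.eventually (gt_mem_nhds one_pos), eventually_ge_atTop 1] with t h1 ht
  have ht0 : 0 < t := by linarith
  have hlog := Real.log_nonneg ht
  rw [div_lt_one (by positivity)] at h1
  calc logRate t ≤ t⁻¹ * (t ^ (1 / 4 : ℝ)) ^ 2 := by unfold logRate; gcongr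
    _ = t ^ (-(1 / 2) : ℝ) := by
      rw [← Real.rpow_natCast, ← Real.rpow_mul ht0.le, ← Real.rpow_neg_one,
        ← Real.rpow_add ht0]
      norm_num

/-- Half of each t⁻¹ is spent on the logarithms: n ≥ 2M + 4 leaves t^(-M-2), and the spare t⁻¹ beats
the constant. -/
theorem eventually_mul_logRate_pow_le (K : ℝ) (hK : 0 ≤ K) {M : ℝ} (hM : 0 < M) {n : ℕ}
    (hn : 2 * M + 4 ≤ n) : ∀ᶠ t in atTop, K * logRate t ^ n ≤ M / 2 * t ^ (-M - 1) := by
  filter_upwards [eventually_logRate_le, eventually_ge_atTop 1, eventually_ge_atTop (2 * K / M)]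
    with t h1 ht htK
  have ht0 : 0 < t := by linarith
  have hr := logRate_nonneg ht
  rw [div_le_iff₀ hM] at htK
  calc K * logRate t ^ n ≤ K * (t ^ (-(1 / 2) : ℝ)) ^ n := by gcongr
    _ = K * t ^ (-(1 / 2) * n : ℝ) := by rw [← Real.rpow_natCast, ← Real.rpow_mul ht0.le]
    _ ≤ K * t ^ (-M - 2) := by
      gcongr
      linarith
    _ = K * t⁻¹ * t ^ (-M - 1) := by
      rw [mul_assoc, ← Real.rpow_neg_one, ← Real.rpow_add ht0]; ring_nf
    _ ≤ M / 2 * t ^ (-M - 1) := by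
      gcongr
      rw [← div_eq_mul_inv, div_le_iff₀ ht0]
      linarith

theorem modulate_add (β : ℝ) (a b : 𝓢(ℝ, ℝ)) (g h : ℝ → ℝ → ℂ) (t : ℝ) :
    modulate β a b (g + h) t = modulate β a b g t + modulate β a b h t := by
  ext x
  simp only [modulate, Pi.add_apply]
  ring

namespace EnergySpace
variable {c : DerivWeight}

theorem spatiallySmooth_nonlinearity (β γ : ℝ) {V : ℝ → EnergySpace c} {n : ℕ∞} {T : ℝ}
    (hV : SpatiallySmooth n T (fun t => V t)) :
    SpatiallySmooth n T (fun t => nonlinearity β γ (V t)) := by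
  have mul : ∀ {f g : ℝ → EnergySpace c}, SpatiallySmooth n T (fun t => f t) →
      SpatiallySmooth n T (fun t => g t) → SpatiallySmooth n T (fun t => (f t * g t : EnergySpace c)) :=
    fun {f g} hf hg => hf.mul hg (fun t _ => (f t).contDiff) (fun t _ => (g t).contDiff)
  have hs : SpatiallySmooth n T (fun t => (star (V t) : EnergySpace c)) := hV.star
  have h3 := mul hV (mul hs hV)
  have h5 := mul hV (mul hs h3)
  exact (h3.smul (fun t _ => EnergySpace.contDiff _) β).add
    (h5.smul (fun t _ => EnergySpace.contDiff _) γ)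
    (fun t _ => ((β : ℂ) • (V t * (star (V t) * V t))).contDiff)
    (fun t _ => ((γ : ℂ) • (V t * (star (V t) * (V t * (star (V t) * V t))))).contDiff)

theorem nonlinearity_apply (β γ : ℝ) (v : EnergySpace c) (x : ℝ) :
    nonlinearity β γ v x = (β : ℂ) * (v x * (star (v x) * v x)) +
      (γ : ℂ) * (v x * (star (v x) * (v x * (star (v x) * v x)))) := rfl

/-- The correction to an approximate solution `A` whose residual is `R`. -/
theorem exists_correction (β γ : ℝ) {A R : ℝ → EnergySpace c} {T M m : ℝ} (hT : 1 ≤ T)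
    (hM : 1 ≤ M) (hm : 0 ≤ m) (hA : ContinuousOn A (Ici T)) (hR : ContinuousOn R (Ici T))
    (hAm : ∀ t, T ≤ t → MulBound (A t) (m * t ^ (-(1 / 2) : ℝ)))
    (hκ : 2 * (3 * |β| * (m + 2) ^ 2 + 5 * |γ| * (m + 2) ^ 4) ≤ M)
    (hRM : ∀ t, T ≤ t → ‖R t‖ ≤ M / 2 * t ^ (-M - 1))
    (hAs : ∀ n : ℕ, SpatiallySmooth n T (fun t => A t))
    (hRs : ∀ n : ℕ, SpatiallySmooth n T (fun t => R t)) :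
    ∃ w : ℝ → EnergySpace c, (∀ t, T ≤ t → ‖w t‖ ≤ t ^ (-M)) ∧
      (∀ n : ℕ, SpatiallySmooth n T (fun t => w t)) ∧ ∀ t, T < t → ∀ x,
        HasDerivAt (fun s => w s x) (Complex.I * iteratedDeriv 2 (w t) x - Complex.I *
          (nonlinearity β γ (A t + w t) x - nonlinearity β γ (A t) x - R t x)) t := by
  set N : ℝ → EnergySpace c → EnergySpace c := fun r w =>
    nonlinearity β γ (A r + w) - nonlinearity β γ (A r) - R r with hN
  have hbound : ∀ r, T ≤ r → ∀ w : EnergySpace c, ‖w‖ ≤ r ^ (-M) →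
      -- The 2 is the constant of the product estimate, applied to ‖w‖ ≤ r^(-M) ≤ r^(-1/2).
      MulBound (A r + w) ((m + 2) * r ^ (-(1 / 2) : ℝ)) := by
    intro r hr w hw
    have hr1 : 1 ≤ r := hT.trans hr
    have h1 : r ^ (-M) ≤ r ^ (-(1 / 2) : ℝ) :=
      Real.rpow_le_rpow_of_exponent_le hr1 (by linarith)
    refine ((hAm r hr).add (mulBound_two_norm w)).mono ?_
    linarith
  obtain ⟨z, hz, hzM, hzd⟩ := exists_decaying_solution (T := T) (M := M)
    (κ := 3 * |β| * (m + 2) ^ 2 + 5 * |γ| * (m + 2) ^ 4) (by linarith) (by linarith)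
    (by positivity) hκ N
    (fun w hw => (((continuous_nonlinearity β γ).comp_continuousOn (hA.add hw)).sub
      ((continuous_nonlinearity β γ).comp_continuousOn hA)).sub hR)
    (fun r hr w w' hw hw' => by
      have hr1 : 1 ≤ r := hT.trans hr
      have hr0 : 0 < r := by linarith
      have h1 : N r w - N r w' = nonlinearity β γ (A r + w) - nonlinearity β γ (A r + w') := by
        simp only [hN]; abel
      have h2 := norm_nonlinearity_sub_le β γ (by positivity) (hbound r hr w hw) (hbound r hr w' hw')
      rw [add_sub_add_left_eq_sub] at h2
      rw [h1]
      refine h2.trans (mul_le_mul_of_nonneg_right ?_ (norm_nonneg _))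
      have h3 : (r ^ (-(1 / 2) : ℝ)) ^ 2 = r⁻¹ := by
        rw [← Real.rpow_natCast, ← Real.rpow_mul hr0.le]; norm_num [Real.rpow_neg_one]
      have h4 : (r ^ (-(1 / 2) : ℝ)) ^ 4 ≤ r⁻¹ := by
        rw [show (r ^ (-(1 / 2) : ℝ)) ^ 4 = ((r ^ (-(1 / 2) : ℝ)) ^ 2) * (r ^ (-(1 / 2) : ℝ)) ^ 2 by ring,
          h3]
        exact mul_le_of_le_one_left (by positivity) (inv_le_one_of_one_le₀ hr1)
      rw [mul_pow, mul_pow, h3, add_mul]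
      calc _ ≤ 3 * |β| * ((m + 2) ^ 2 * r⁻¹) + 5 * |γ| * ((m + 2) ^ 4 * r⁻¹) := by gcongr
        _ = _ := by ring)
    (fun r hr => by
      have h1 : N r 0 = -R r := by simp [hN]
      rw [h1, norm_neg]
      exact hRM r hr)
  set w : ℝ → EnergySpace c := fun t => free t (z t) with hw
  have hwc : ContinuousOn w (Ioi T) := (continuousOn_free hz continuous_id).mono
    Ioi_subset_Ici_self
  have hderiv : ∀ j t, T < t → ∀ x, HasDerivAt (fun s => evalDeriv j x (w s))
      (Complex.I * evalDeriv (j + 2) x (w t) - Complex.I * iteratedDeriv j (N t (w t)) x) t := by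
    intro j t ht x
    refine (hasDerivAt_evalDeriv_free_apply (hzd t ht) j x).congr_deriv ?_
    -- w = e^{it∂²}z undoes the interaction picture: the factor e^{-it∂²} in z′ cancels.
    rw [map_neg, map_smul, free_free_neg, map_neg, map_smul, smul_eq_mul, ← sub_eq_add_neg,
      evalDeriv_apply j x (N t (free t (z t)))]
  have hadd : ∀ n : ℕ, SpatiallySmooth n T (fun t => w t) →
      SpatiallySmooth n T (fun t => (A t + w t : EnergySpace c)) := fun n hn =>
    (hAs n).add hn (fun t _ => (A t).contDiff) (fun t _ => (w t).contDiff)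
  have hsmooth := spatiallySmooth_of_hasDerivAt hwc (F := fun t => N t (w t)) hderiv
    (fun n hn => by
      have h1 := (spatiallySmooth_nonlinearity β γ (hadd n hn)).sub
        (spatiallySmooth_nonlinearity β γ (hAs n)) (fun t _ => EnergySpace.contDiff _)
        (fun t _ => EnergySpace.contDiff _)
      exact h1.sub (hRs n) (fun t _ => (nonlinearity β γ (A t + w t) - nonlinearity β γ (A t)).contDiff)
        (fun t _ => (R t).contDiff))
  refine ⟨w, fun t ht => ?_, hsmooth, fun t ht x => ?_⟩
  · rw [hw, norm_free]
    exact hzM t ht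
  · have h := hderiv 0 t ht x
    simp only [evalDeriv_apply, iteratedDeriv_zero] at h
    exact h

end EnergySpace

theorem logRate_le_two_mul {t : ℝ} (ht : 1 ≤ t) :
    logRate t ≤ 2 * ((1 + Real.log (1 + t)) ^ 2 * (1 + t)⁻¹) := by
  have h1 : t⁻¹ ≤ 2 * (1 + t)⁻¹ := by
    rw [← div_eq_mul_inv, inv_eq_one_div, div_le_div_iff₀ (by linarith) (by linarith)]
    linarith
  have h2 : Real.log t ≤ Real.log (1 + t) := Real.log_le_log (by linarith) (by linarith)
  have h3 := Real.log_nonneg ht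
  calc logRate t ≤ (2 * (1 + t)⁻¹) * (1 + Real.log (1 + t)) ^ 2 := by
        unfold logRate; gcongr
    _ = _ := by ring

theorem rpow_neg_le_logRate {t M : ℝ} (ht : 1 ≤ t) (hM : 1 ≤ M) : t ^ (-M) ≤ logRate t := by
  have h3 := Real.log_nonneg ht
  have ht0 : 0 < t := by linarith
  calc t ^ (-M) ≤ t ^ (-1 : ℝ) := Real.rpow_le_rpow_of_exponent_le ht (by linarith)
    _ = t⁻¹ * 1 := by rw [Real.rpow_neg_one, mul_one]
    _ ≤ logRate t := by
      unfold logRate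
      gcongr
      nlinarith

/-- A solution asymptotic to the profile. -/
theorem exists_solution (β γ : ℝ) (a b : 𝓢(ℝ, ℝ)) :
    ∃ (T : ℝ) (v : ℝ → ℝ → ℂ), 0 < T ∧ IsSmoothSolution β γ T v ∧
      ∃ C : ℝ, ∀ t : ℝ, T < t →
        eLpNorm (fun x : ℝ => v t x - profile β a b t x) ∞ volume +
          eLpNorm (fun x : ℝ => v t x - profile β a b t x) 2 volume
        ≤ ENNReal.ofReal (C * (1 + Real.log (1 + t)) ^ 2 * (1 + t)⁻¹) := by
  set α := logMonomial 0 0 (complexS a) with hα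
  have hα0 : α ∈ logClass 0 := logClass.monomial_mem _ le_rfl le_rfl
  have hαs : star α = α := by
    ext t y
    simp [hα, logMonomial, complexS_apply]
  obtain ⟨K₀, B₀, hK₀, hc₀⟩ := exists_isModulatedCurve β a b hα0
  -- M depends on the leading profile alone; the 1 in `K₀ + 1` is reserved for the Newton
  -- corrections, which are small for large t. Thus M is known before the number n of Newton steps.
  set M := max 1 (2 * (3 * |β| * (K₀ + 1 + 2) ^ 2 + 5 * |γ| * (K₀ + 1 + 2) ^ 4)) with hMdef
  have hM1 : 1 ≤ M := le_max_left _ _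
  obtain ⟨n, hn⟩ := exists_nat_ge (2 * M + 4)
  obtain ⟨J, hJ, hres⟩ := exists_jet_residual_mem β γ (complexS a) hαs
    (slope_mem (slopeLog β a) (complexS (derivR b)))
    (slope_mem (derivS (slopeLog β a)) (derivS (complexS (derivR b))))
    (slopeSq_mem (slopeLog β a) (complexS (derivR b))) n
  have hρ := logClass.tau_mul_mem (m := 0) (n := n) (by norm_num) hres (by omega)
  have heq := fun t ht x => modulate_residual β a b γ J (t := t) ht x
  rw [← hα] at hJ
  simp only [phaseSlope] at heq
  generalize tau 0 * residual β γ (logMonomial 0 0 (complexS a))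
    (slope (slopeLog β a) (complexS (derivR b)))
    (slope (derivS (slopeLog β a)) (derivS (complexS (derivR b))))
    (slopeSq (slopeLog β a) (complexS (derivR b))) J = ρ at hρ heq
  obtain ⟨K₁, B₁, hK₁, hc₁⟩ := exists_isModulatedCurve β a b hJ
  obtain ⟨K₂, B₂, hK₂, hc₂⟩ := exists_isModulatedCurve β a b hρ
  -- One sequence of weights for the leading profile, the Newton corrections and the residual.
  obtain ⟨c, hc⟩ := DerivWeight.exists_mul_le (fun j => B₀ j + B₁ j + B₂ j)
  obtain ⟨G₀, hG₀⟩ := hc₀ c fun j hj => (hc j hj).trans' (by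
    gcongr; exact (le_self_add.trans le_self_add))
  obtain ⟨G₁, hG₁⟩ := hc₁ c fun j hj => (hc j hj).trans' (by
    gcongr; exact (le_add_self.trans le_self_add))
  obtain ⟨G₂, hG₂⟩ := hc₂ c fun j hj => (hc j hj).trans' (by
    gcongr; exact le_add_self)
  have hlog0 : ∀ᶠ t in atTop, K₁ * logRate t ≤ 1 := by
    have h1 := (tendsto_rpow_neg_atTop (show (0 : ℝ) < 1 / 2 by norm_num)).const_mul K₁
    rw [mul_zero] at h1
    filter_upwards [h1.eventually (gt_mem_nhds one_pos), eventually_logRate_le] with t h2 h3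
    exact (mul_le_mul_of_nonneg_left h3 hK₁).trans h2.le
  obtain ⟨T₀, hT₀⟩ := eventually_atTop.1
    (hlog0.and (eventually_mul_logRate_pow_le K₂ hK₂ (by linarith) hn))
  set T := max T₀ 1 with hTdef
  have hT : 1 ≤ T := le_max_right _ _
  have hTT : ∀ t, T ≤ t → T₀ ≤ t := fun t ht => (le_max_left _ _).trans ht
  have hsub : Ici T ⊆ Ici 1 := Ici_subset_Ici.2 hT
  -- `G₀` is exactly v₀, so v - v₀ = G₁ + w.
  set A : ℝ → EnergySpace c := fun t => G₀ t + G₁ t with hA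
  have hAJ : ∀ t, 1 ≤ t → (A t : ℝ → ℂ) = modulate β a b J.val t := by
    intro t ht
    rw [hA, EnergySpace.coe_add, hG₀.coe_eq t ht, hG₁.coe_eq t ht, ← modulate_add]
    congr 1
    abel
  have hAs : ∀ n : ℕ, SpatiallySmooth n T (fun t => A t) := fun n =>
    (hG₀.spatiallySmooth hα0 hT n).add (hG₁.spatiallySmooth hJ hT n)
      (fun t _ => (G₀ t).contDiff) (fun t _ => (G₁ t).contDiff)
  obtain ⟨w, hwM, hws, hwd⟩ := EnergySpace.exists_correction β γ (A := A) (R := G₂) (T := T) (M := M)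
    (m := K₀ + 1) hT hM1 (by positivity)
    ((hG₀.continuousOn.add hG₁.continuousOn).mono hsub) (hG₂.continuousOn.mono hsub)
    (fun t ht => by
      have ht1 := hT.trans ht
      have ht0 : 0 < t := by linarith
      refine ((hG₀.mulBound t ht1).add (hG₁.mulBound t ht1)).mono ?_
      have h1 := (hT₀ t (hTT t ht)).1
      rw [pow_zero, mul_one, pow_one, add_mul]
      gcongr)
    (le_max_right _ _)
    (fun t ht => (hG₂.norm_le t (hT.trans ht)).trans (hT₀ t (hTT t ht)).2) hAs
    (hG₂.spatiallySmooth hρ hT)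
  refine ⟨T, fun t x => (A t + w t : EnergySpace c) x, by linarith, ⟨?_, fun t ht x => ?_⟩,
    -- `K₁ + 1` bounds G₁ and w in units of `logRate`; one factor 2 is for the two norms, the other
    -- for passing from t to 1 + t.
    4 * (K₁ + 1), fun t ht => ?_⟩
  · rw [contDiffOn_infty]
    intro n
    have h := ((hAs n).add (hws n) (fun t _ => (A t).contDiff) (fun t _ => (w t).contDiff)) 0
    simp only [iteratedDeriv_zero] at h
    exact h
  · have ht1 : 1 < t := by linarith
    have hAd := heq t (by linarith) x
    have hAd' := hAd.congr_of_eventuallyEq (f₁ := fun s => A s x) (by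
      filter_upwards [Ioi_mem_nhds ht1] with s (hs : 1 < s)
      rw [hAJ s hs.le])
    have hv := (hAd'.add (hwd t ht x)).deriv
    have h2 : iteratedDeriv 2 (A t + w t : EnergySpace c) x =
        iteratedDeriv 2 (A t) x + iteratedDeriv 2 (w t) x := EnergySpace.iteratedDeriv_add' _ _ _ _
    have hd : deriv (fun τ => (A τ + w τ : EnergySpace c) x) t = _ := hv
    have hfun : (fun z => (A t + w t : EnergySpace c) z) = ⇑(A t + w t) := rfl
    beta_reduce
    rw [hd, hfun, h2, EnergySpace.nonlinearity_apply, EnergySpace.nonlinearity_apply,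
      hG₂.coe_eq t ht1.le, ← hAJ t ht1.le]
    have hn2 : (((‖(A t + w t : EnergySpace c) x‖ ^ 2 : ℝ)) : ℂ) =
        (A t + w t : EnergySpace c) x * star ((A t + w t : EnergySpace c) x) := by
      rw [← Complex.normSq_eq_norm_sq, ← Complex.mul_conj]; rfl
    have hn4 : (((‖(A t + w t : EnergySpace c) x‖ ^ 4 : ℝ)) : ℂ) =
        ((A t + w t : EnergySpace c) x * star ((A t + w t : EnergySpace c) x)) ^ 2 := by
      rw [← hn2]; push_cast; ring
    rw [hn2, hn4]
    generalize (A t + w t : EnergySpace c) x = V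
    generalize star V = V'
    generalize star ((A t : EnergySpace c) x) = A'
    linear_combination (iteratedDeriv 2 (A t) x + iteratedDeriv 2 (w t) x -
      β * (V * (V' * V)) - γ * (V * (V' * (V * (V' * V))))) * Complex.I_sq
  · have ht1 : 1 ≤ t := by linarith
    have hfun : (fun x => (A t + w t : EnergySpace c) x - profile β a b t x) =
        ⇑(G₁ t + w t : EnergySpace c) := by
      ext x
      have h0 : profile β a b t x = G₀ t x := by
        rw [profile_eq_modulate, hG₀.coe_eq t ht1]
      rw [h0]
      simp only [hA, EnergySpace.coe_add, Pi.add_apply]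
      ring
    rw [hfun]
    refine (add_le_add (EnergySpace.eLpNorm_top_le _) (EnergySpace.eLpNorm_two_le _)).trans ?_
    rw [← ENNReal.ofReal_add (norm_nonneg _) (norm_nonneg _)]
    refine ENNReal.ofReal_le_ofReal ?_
    have h1 := hG₁.norm_le t ht1
    rw [pow_one] at h1
    have h2 := (hwM t ht.le).trans (rpow_neg_le_logRate ht1 hM1)
    have h3 := norm_add_le (G₁ t) (w t)
    have h4 := mul_le_mul_of_nonneg_left (logRate_le_two_mul ht1) (show 0 ≤ K₁ + 1 by linarith)
    linarith

end NLSScattering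

end

theorem theorem1 (a b : 𝓢(ℝ, ℝ)) :
    ∃ β₀ : ℝ, 0 < β₀ ∧ ∀ β γ : ℝ, (0 ≤ β ∨ |β| ≤ β₀) →
      ∃ (T : ℝ) (v : ℝ → ℝ → ℂ), 0 < T ∧ NLSScattering.IsSmoothSolution β γ T v ∧
        ∃ C : ℝ, ∀ t : ℝ, T < t →
          MeasureTheory.eLpNorm
              (fun x : ℝ => v t x - NLSScattering.profile β a b t x) ∞ MeasureTheory.volume +
            MeasureTheory.eLpNorm
              (fun x : ℝ => v t x - NLSScattering.profile β a b t x) 2 MeasureTheory.volume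
          ≤ ENNReal.ofReal (C * (1 + Real.log (1 + t)) ^ 2 * (1 + t)⁻¹) := by
  exact ⟨1, one_pos, fun β γ _ => NLSScattering.exists_solution β γ a b⟩
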